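/- Let $p$ be a prime, $n,a\ge 1$, $q=p^a$, and normalize $\operatorname{ord}_p p=1$ on $\overline{\mathbb Q}_p$. Let $\gamma\in\overline{\mathbb Q}_p$ be a root of $\sum_{j\ge 0}T^{p^j}/p^j$ with $\operatorname{ord}_p\gamma=1/(p-1)$. Fix a $q$-th root $\gamma^{1/q}$ of $\gamma$, and use its powers as the fractional powers of $\gamma$. Let $\mathfrak O_q$ be the ring of integers of $\mathbb Q_q(\gamma^{1/q})$, where $\mathbb Q_q$ is the unramified extension of $\mathbb Q_p$ of degree $a$. For $u\in\mathbb Z^n$ put $$m(u)=\max\{0,-u_1,\dots,-u_n\},\qquad w(u)=u_1+\dots+u_n+(n+1)m(u).$$ For $0\le k\le a$ let $$\mathcal O_{p^k}=\Big\{\sum_{r\ge0}a(r)\gamma^{r(n+1)/p^k}t^r : a(r)\in\mathfrak O_q,\ a(r)\to0\Big\},\qquad \Big\|\sum_{r\ge 0} a(r)\gamma^{r(n+1)/p^k}t^r\Big\|=\sup_r|a(r)|,$$ $$\mathcal C_{p^k}=\Big\{\sum_{u\in\mathbb Z^n}\xi(u)\gamma^{w(u)}t^{p^km(u)}x^u :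 \xi(u)\in\mathcal O_{p^k},\ \|\xi(u)\|\to0\text{ as }w(u)\to\infty\Big\},$$ and for $b,c\in\mathbb R$ let $$\mathcal O_{p^k}(b;c)=\Big\{\sum_{r\ge0}a(r)\gamma^{r(n+1)/p^k}t^r : a(r)\in\mathfrak O_q,\ \operatorname{ord}_pa(r)\ge br+c\text{ for all } r\Big\}.$$ Write $\mathcal O=\mathcal O_{p^0}$ and $\mathcal C=\mathcal C_{p^0}$. Let $K(t,x)=x_1+\dots+x_n+\frac{t}{x_1\cdots x_n}$, $\gamma_i=\sum_{j=0}^i\gamma^{p^j}/p^j$, $H(t,x)=\sum_{i\ge0}\gamma_iK(t^{p^i},x^{p^i})$, and $$D_{t^{p^k},l}=x_l\frac{\partial}{\partial x_l}+x_l\frac{\partial H(t^{p^k},x)}{\partial x_l}\qquad(1\le l\le n).$$ Let $H^n(\mathcal C_{p^k},D_{t^{p^k}})=\mathcal C_{p^k}/\sum_{l=1}^nD_{t^{p^k},l}\,\mathcal C_{p^k}$ be the top cohomology of the Koszul complex of these operators on $\mathcal C_{p^k}$. Let $E(T)=\exp\big(\sum_{j\ge0}T^{p^j}/p^j\big)$,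 $\theta(T)=E(\gamma T)$, $F(t,x)=\theta(x_1)\cdots\theta(x_n)\,\theta\big(t/(x_1\cdots x_n)\big)$, let $\psi_x$ be the map $\sum_u a(u)x^u\mapsto\sum_u a(pu)x^u$, and let $\alpha_1=\psi_x\circ F(t,x)$. Put $e_i=\gamma^ix_1\cdots x_i$ for $0\le i\le n$ (so $e_0=1$). **Theorem.** For $k\in\{0,1\}$ the operators $D_{t^{p^k},l}$ map $\mathcal C_{p^k}$ into itself, and the classes of $e_0,\dots,e_n$ form a basis of the $\mathcal O_{p^k}$-module $H^n(\mathcal C_{p^k},D_{t^{p^k}})$. The map $\alpha_1$ sends $\mathcal C$ into $\mathcal C_p$ and induces an additive map $\bar\alpha_1:H^n(\mathcal C,D_t)\to H^n(\mathcal C_p,D_{t^p})$, the relative Frobenius. Writing $$\bar\alpha_1(e_i)=\sum_{j=0}^n\tilde A(j,i)\,e_j\quad\text{in }H^n(\mathcal C_p,D_{t^p}),\qquad \tilde A(j,i)\in\mathcal O_p,$$ we have, for all $0\le i,j\le n$, $$\tilde A(j,i)\in\mathcal O_p\big(\tfrac{n+1}{p};\,j\big),$$ that is, $\tilde A(j,i)=\sum_{r\ge0}a(r)\gamma^{r(n+1)/p}t^r$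 with $a(r)\in\mathfrak O_q$ and $\operatorname{ord}_pa(r)\ge\frac{n+1}{p}r+j$ for all $r\ge0$. -/

import Mathlib

noncomputable section

namespace HyperKloosterman

/-! ### The base field and its ring of integers -/

/-- `ord_p x ≥ c`, for `x` in the algebraic closure of `ℚ_p`, where `ord_p p = 1`
(the norm satisfies `‖x‖ = p ^ (- ord_p x)`; the condition holds for `x = 0`). -/
def OrdGE (p : ℕ) [Fact p.Prime] (x : PadicAlgCl p) (c : ℝ) : Prop :=
  ‖x‖ ≤ (p : ℝ) ^ (-c)

/-- The unramified extension `ℚ_q` of `ℚ_p` of degree `a`, `q = p ^ a`, inside the algebraic closure: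
it is generated by the `(q - 1)`-th roots of unity. -/
def Qq (p a : ℕ) [Fact p.Prime] : IntermediateField ℚ_[p] (PadicAlgCl p) :=
  IntermediateField.adjoin ℚ_[p] {z : PadicAlgCl p | z ^ (p ^ a - 1) = 1}

/-- The field `ℚ_q(g)`. It is used with `g` a `q`-th root of `γ`. -/
def baseField (p a : ℕ) [Fact p.Prime] (g : PadicAlgCl p) :
    IntermediateField ℚ_[p] (PadicAlgCl p) :=
  Qq p a ⊔ IntermediateField.adjoin ℚ_[p] {g}

/-- The ring of integers `𝔒_q` of `ℚ_q(g)`. -/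
def intRing (p a : ℕ) [Fact p.Prime] (g : PadicAlgCl p) : Subring (PadicAlgCl p) where
  carrier := {x | x ∈ baseField p a g ∧ ‖x‖ ≤ 1}
  mul_mem' := fun {x y} hx hy => ⟨mul_mem hx.1 hy.1, by
    rw [norm_mul]; exact mul_le_one₀ hx.2 (norm_nonneg y) hy.2⟩
  one_mem' := ⟨one_mem _, by simp⟩
  add_mem' := fun {x y} hx hy => ⟨add_mem hx.1 hy.1,
    (IsUltrametricDist.norm_add_le_max x y).trans (max_le hx.2 hy.2)⟩
  zero_mem' := ⟨zero_mem _, by simp⟩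
  neg_mem' := fun {x} hx => ⟨neg_mem hx.1, by rw [norm_neg]; exact hx.2⟩

/-- For `g` a `p ^ a`-th root of `γ` and `k ≤ a`, this is the chosen `p ^ k`-th root
`γ ^ (1 / p ^ k) = g ^ (p ^ (a - k))` of `γ`. -/
def rootGamma (p a : ℕ) [Fact p.Prime] (g : PadicAlgCl p) (k : ℕ) : PadicAlgCl p :=
  g ^ p ^ (a - k)

/-! ### The rings of power series in `t` -/

/-- `ξ = ∑ r, c r * γ ^ (r * (n + 1) / p ^ k) * t ^ r` as a formal power series in `t`. -/
def HasCoeffs (p n a : ℕ) [Fact p.Prime] (g : PadicAlgCl p) (k : ℕ)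
    (ξ : PowerSeries (PadicAlgCl p)) (c : ℕ → PadicAlgCl p) : Prop :=
  ∀ r, PowerSeries.coeff r ξ = c r * rootGamma p a g k ^ (r * (n + 1))

lemma HasCoeffs.mul {p n a : ℕ} [Fact p.Prime] {g : PadicAlgCl p} {k : ℕ}
    {ξ η : PowerSeries (PadicAlgCl p)} {c d : ℕ → PadicAlgCl p}
    (hc : HasCoeffs p n a g k ξ c) (hd : HasCoeffs p n a g k η d) :
    HasCoeffs p n a g k (ξ * η)
      (fun r => ∑ x ∈ Finset.HasAntidiagonal.antidiagonal r, c x.1 * d x.2) := by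
  intro r
  rw [PowerSeries.coeff_mul, Finset.sum_mul]
  refine Finset.sum_congr rfl fun x hx => ?_
  rw [hc, hd, ← Finset.HasAntidiagonal.mem_antidiagonal.1 hx, add_mul, pow_add]
  ring

lemma norm_conv_le {p : ℕ} [Fact p.Prime] {c d : ℕ → PadicAlgCl p} {ε : ℝ} (hε : 0 ≤ ε)
    (r : ℕ) (h : ∀ x y, x + y = r → ‖c x‖ * ‖d y‖ ≤ ε) :
    ‖∑ x ∈ Finset.HasAntidiagonal.antidiagonal r, c x.1 * d x.2‖ ≤ ε := by
  refine IsUltrametricDist.norm_sum_le_of_forall_le_of_nonneg hε fun x hx => ?_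
  rw [norm_mul]
  exact h _ _ (Finset.HasAntidiagonal.mem_antidiagonal.1 hx)

lemma tendsto_conv {p : ℕ} [Fact p.Prime] {c d : ℕ → PadicAlgCl p}
    (hc : Filter.Tendsto c Filter.atTop (nhds 0)) (hd : Filter.Tendsto d Filter.atTop (nhds 0))
    (hc1 : ∀ r, ‖c r‖ ≤ 1) (hd1 : ∀ r, ‖d r‖ ≤ 1) :
    Filter.Tendsto (fun r => ∑ x ∈ Finset.HasAntidiagonal.antidiagonal r, c x.1 * d x.2)
      Filter.atTop (nhds 0) := by
  rw [Metric.tendsto_atTop] at hc hd ⊢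
  intro ε hε
  obtain ⟨N, hN⟩ := hc (ε / 2) (half_pos hε)
  obtain ⟨M, hM⟩ := hd (ε / 2) (half_pos hε)
  refine ⟨N + M, fun r hr => ?_⟩
  rw [dist_zero_right]
  refine lt_of_le_of_lt (norm_conv_le (half_pos hε).le r fun x y hxy => ?_) (half_lt_self hε)
  rcases le_or_gt N x with hx | hx
  · have h1 := hN x hx
    rw [dist_zero_right] at h1
    exact (mul_le_of_le_one_right (norm_nonneg _) (hd1 y)).trans h1.le
  · have h1 := hM y (by omega)
    rw [dist_zero_right] at h1
    exact (mul_le_of_le_one_left (norm_nonneg _) (hc1 x)).trans h1.le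

/-- The ring `O_{p^k}` (for `k ≤ a`) of all series `∑ r, c r * γ ^ (r * (n + 1) / p ^ k) * t ^ r`
with `c r ∈ 𝔒_q` and `c r → 0`. -/
def ringO (p n a : ℕ) [Fact p.Prime] (g : PadicAlgCl p) (k : ℕ) :
    Subring (PowerSeries (PadicAlgCl p)) where
  carrier := {ξ | ∃ c : ℕ → PadicAlgCl p, (∀ r, c r ∈ intRing p a g) ∧
    Filter.Tendsto c Filter.atTop (nhds 0) ∧ HasCoeffs p n a g k ξ c}
  mul_mem' := by
    rintro ξ η ⟨c, hc, hc0, hcξ⟩ ⟨d, hd, hd0, hdη⟩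
    exact ⟨_, fun r => sum_mem fun x _ => mul_mem (hc _) (hd _),
      tendsto_conv hc0 hd0 (fun r => (hc r).2) (fun r => (hd r).2), hcξ.mul hdη⟩
  one_mem' := by
    refine ⟨fun r => if r = 0 then 1 else 0, fun r => ?_, ?_, fun r => ?_⟩
    · dsimp only
      split_ifs
      · exact one_mem _
      · exact zero_mem _
    · refine tendsto_const_nhds.congr' ?_
      filter_upwards [Filter.eventually_gt_atTop 0] with r hr
      rw [if_neg hr.ne']
    · rw [PowerSeries.coeff_one]
      by_cases h : r = 0
      · simp [h]
      · simp only [if_neg h, zero_mul]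
  add_mem' := by
    rintro ξ η ⟨c, hc, hc0, hcξ⟩ ⟨d, hd, hd0, hdη⟩
    refine ⟨fun r => c r + d r, fun r => add_mem (hc r) (hd r), by simpa using hc0.add hd0,
      fun r => ?_⟩
    rw [map_add, hcξ, hdη, add_mul]
  zero_mem' := ⟨fun _ => 0, fun _ => zero_mem _, tendsto_const_nhds, fun r => by simp⟩
  neg_mem' := by
    rintro ξ ⟨c, hc, hc0, hcξ⟩
    refine ⟨fun r => -c r, fun r => neg_mem (hc r), by simpa using hc0.neg, fun r => ?_⟩
    rw [map_neg, hcξ, neg_mul]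

/-- The set `O_{p^k}(b; e)` of all series `∑ r, c r * γ ^ (r * (n + 1) / p ^ k) * t ^ r` with
`c r ∈ 𝔒_q` and `ord_p (c r) ≥ b * r + e`. -/
def growthO (p n a : ℕ) [Fact p.Prime] (g : PadicAlgCl p) (k : ℕ) (b e : ℝ) :
    Set (PowerSeries (PadicAlgCl p)) :=
  {ξ | ∃ c : ℕ → PadicAlgCl p, (∀ r, c r ∈ intRing p a g ∧ OrdGE p (c r) (b * r + e)) ∧
    HasCoeffs p n a g k ξ c}

/-- The sup-norm `‖ξ‖ = sup_r |c r|` of `ξ = ∑ r, c r * γ ^ (r * (n + 1) / p ^ k) * t ^ r`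
is at most `ε`. -/
def SupNormLE (p n a : ℕ) [Fact p.Prime] (g : PadicAlgCl p) (k : ℕ)
    (ξ : PowerSeries (PadicAlgCl p)) (ε : ℝ) : Prop :=
  ∃ c : ℕ → PadicAlgCl p, HasCoeffs p n a g k ξ c ∧ ∀ r, ‖c r‖ ≤ ε

lemma SupNormLE.add {p n a : ℕ} [Fact p.Prime] {g : PadicAlgCl p} {k : ℕ}
    {ξ η : PowerSeries (PadicAlgCl p)} {ε : ℝ} (h : SupNormLE p n a g k ξ ε)
    (h' : SupNormLE p n a g k η ε) : SupNormLE p n a g k (ξ + η) ε := by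
  obtain ⟨c, hc, hc'⟩ := h
  obtain ⟨d, hd, hd'⟩ := h'
  refine ⟨fun r => c r + d r, fun r => ?_, fun r => ?_⟩
  · rw [map_add, hc, hd, add_mul]
  · exact (IsUltrametricDist.norm_add_le_max _ _).trans (max_le (hc' r) (hd' r))

lemma SupNormLE.zero {p n a : ℕ} [Fact p.Prime] {g : PadicAlgCl p} {k : ℕ} {ε : ℝ}
    (hε : 0 ≤ ε) : SupNormLE p n a g k 0 ε :=
  ⟨fun _ => 0, fun r => by rw [map_zero, zero_mul], fun _ => by rw [norm_zero]; exact hε⟩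

lemma SupNormLE.mul {p n a : ℕ} [Fact p.Prime] {g : PadicAlgCl p} {k : ℕ}
    {ξ η : PowerSeries (PadicAlgCl p)} {ε : ℝ} (h : SupNormLE p n a g k ξ ε) (hε : 0 ≤ ε)
    (hη : η ∈ ringO p n a g k) : SupNormLE p n a g k (η * ξ) ε := by
  obtain ⟨d, hd, -, hdη⟩ := hη
  obtain ⟨c, hc, hc'⟩ := h
  refine ⟨_, hdη.mul hc, fun r => norm_conv_le hε r fun x y _ => ?_⟩
  exact (mul_le_of_le_one_left (norm_nonneg _) (hd x).2).trans (hc' y)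

/-! ### Laurent series in `x_1, …, x_n` -/

/-- `m(u) = max {0, -u_1, …, -u_n}`. -/
def mFun {n : ℕ} (u : Fin n → ℤ) : ℕ := Finset.univ.sup fun i => (-u i).toNat

/-- The weight `w(u) = u_1 + ⋯ + u_n + (n + 1) m(u)`. -/
def wFun {n : ℕ} (u : Fin n → ℤ) : ℤ := ∑ i, u i + (n + 1) * (mFun u : ℤ)

/-- Formal sums `∑ u, ξ u * x ^ u` over `u ∈ ℤ^n`, with coefficients power series in `t`. -/
abbrev Laurent (p n : ℕ) [Fact p.Prime] : Type :=
  (Fin n → ℤ) → PowerSeries (PadicAlgCl p)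

/-- The `O_{p^k}`-module `C_{p^k}` of all `∑ u, ξ u * γ ^ w(u) * t ^ (p ^ k * m(u)) * x ^ u` with
`ξ u ∈ O_{p^k}` and `ξ u → 0` in sup-norm as `w(u) → ∞`. -/
def modC (p n a : ℕ) [Fact p.Prime] (γ g : PadicAlgCl p) (k : ℕ) :
    Submodule (ringO p n a g k) (Laurent p n) where
  carrier := {ζ | ∃ ξ : (Fin n → ℤ) → PowerSeries (PadicAlgCl p),
    (∀ u, ξ u ∈ ringO p n a g k) ∧
    (∀ ε : ℝ, 0 < ε → ∃ N : ℤ, ∀ u, N ≤ wFun u → SupNormLE p n a g k (ξ u) ε) ∧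
    ∀ u, ζ u = ξ u * (PowerSeries.C (γ ^ wFun u) * PowerSeries.X ^ (p ^ k * mFun u))}
  add_mem' := by
    rintro ζ ζ' ⟨ξ, h1, h2, h3⟩ ⟨ξ', h1', h2', h3'⟩
    refine ⟨fun u => ξ u + ξ' u, fun u => add_mem (h1 u) (h1' u), fun ε hε => ?_, fun u => ?_⟩
    · obtain ⟨N, hN⟩ := h2 ε hε
      obtain ⟨M, hM⟩ := h2' ε hε
      exact ⟨max N M, fun u hu => (hN u ((le_max_left _ _).trans hu)).add
        (hM u ((le_max_right _ _).trans hu))⟩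
    · rw [Pi.add_apply, h3, h3', add_mul]
  zero_mem' := ⟨fun _ => 0, fun _ => zero_mem _,
    fun ε hε => ⟨0, fun _ _ => SupNormLE.zero hε.le⟩,
    fun u => by rw [Pi.zero_apply, zero_mul]⟩
  smul_mem' := by
    rintro ⟨η, hη⟩ ζ ⟨ξ, h1, h2, h3⟩
    refine ⟨fun u => η * ξ u, fun u => mul_mem hη (h1 u), fun ε hε => ?_, fun u => ?_⟩
    · obtain ⟨N, hN⟩ := h2 ε hε
      exact ⟨N, fun u hu => (hN u hu).mul hε.le hη⟩
    · rw [mul_assoc, ← h3]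
      rfl

/-- The product of two Laurent series: the coefficient of `t ^ s` in the coefficient of `x ^ u` is
`∑ v, [t ^ s] (f v * h (u - v))`. When `f v` and `h v` are divisible by `t ^ m(v)` for all `v`, as
in all the uses below, only finitely many `v` contribute to it. -/
def lmul {p n : ℕ} [Fact p.Prime] (f h : Laurent p n) : Laurent p n := fun u =>
  PowerSeries.mk fun s => ∑ᶠ v : Fin n → ℤ, PowerSeries.coeff s (f v * h (u - v))

/-- The monomial `c(t) * x ^ u`. -/
def mono {p n : ℕ} [Fact p.Prime] (u : Fin n → ℤ) (c : PowerSeries (PadicAlgCl p)) :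
    Laurent p n := Pi.single u c

/-- The operator `x_l ∂/∂x_l`. -/
def eulerOp {p n : ℕ} [Fact p.Prime] (l : Fin n) (f : Laurent p n) : Laurent p n :=
  fun u => (u l) • f u

/-! ### Relative cohomology -/

/-- `γ_i = ∑ j ≤ i, γ ^ (p ^ j) / p ^ j`. -/
def gammaSeq (p : ℕ) [Fact p.Prime] (γ : PadicAlgCl p) (i : ℕ) : PadicAlgCl p :=
  ∑ j ∈ Finset.range (i + 1), γ ^ p ^ j / (p : PadicAlgCl p) ^ j

/-- `K(t ^ N, x ^ M) = x_1 ^ M + ⋯ + x_n ^ M + t ^ N / (x_1 ⋯ x_n) ^ M`. -/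
def serK (p n : ℕ) [Fact p.Prime] (N M : ℕ) : Laurent p n :=
  (∑ i : Fin n, mono (Pi.single i (M : ℤ)) 1) +
    mono (fun _ => -(M : ℤ)) (PowerSeries.X ^ N)

/-- `H(t ^ (p ^ k), x) = ∑ i, γ_i * K(t ^ (p ^ (i + k)), x ^ (p ^ i))`; for `n ≥ 1` each monomial
`x ^ u` occurs in only finitely many summands. -/
def serH (p n : ℕ) [Fact p.Prime] (γ : PadicAlgCl p) (k : ℕ) : Laurent p n := fun u =>
  ∑ᶠ i : ℕ, PowerSeries.C (gammaSeq p γ i) * serK p n (p ^ (i + k)) (p ^ i) u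

/-- The operator `D_{t^{p^k}, l} = x_l ∂/∂x_l + x_l ∂H(t ^ (p ^ k), x)/∂x_l`. -/
def opD (p n : ℕ) [Fact p.Prime] (γ : PadicAlgCl p) (k : ℕ) (l : Fin n) (f : Laurent p n) :
    Laurent p n :=
  eulerOp l f + lmul (eulerOp l (serH p n γ k)) f

/-- The last differential `Ω^{n-1} → Ω^n` of the Koszul complex of the operators `D_{t^{p^k}, l}`.
Here `ω = ∑ l, ζ_l dx_1/x_1 ∧ ⋯ (omit dx_l/x_l) ⋯ ∧ dx_n/x_n` is given by its coefficients, the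
result by its coefficient at `dx_1/x_1 ∧ ⋯ ∧ dx_n/x_n` (indices in `Fin n` start at `0`). -/
def koszulTop (p n : ℕ) [Fact p.Prime] (γ : PadicAlgCl p) (k : ℕ) (ζ : Fin n → Laurent p n) :
    Laurent p n :=
  ∑ l : Fin n, (-1 : ℤ) ^ l.val • opD p n γ k l (ζ l)

/-- The boundaries `D(Ω^{n-1})` in `Ω^n = C_{p^k} dx_1/x_1 ∧ ⋯ ∧ dx_n/x_n`, where
`Ω^{n-1} = ⨁_l C_{p^k} dx_1/x_1 ∧ ⋯ (omit dx_l/x_l) ⋯ ∧ dx_n/x_n`. As the `D_{t^{p^k}, l}` are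
`O_{p^k}`-linear endomorphisms of `C_{p^k}`, the image is already a submodule of `C_{p^k}`. -/
def boundaries (p n a : ℕ) [Fact p.Prime] (γ g : PadicAlgCl p) (k : ℕ) :
    Submodule (ringO p n a g k) (modC p n a γ g k) :=
  (Submodule.span (ringO p n a g k)
    {f : Laurent p n | ∃ ζ : Fin n → Laurent p n,
      (∀ l, ζ l ∈ modC p n a γ g k) ∧ f = koszulTop p n γ k ζ}).comap
    (modC p n a γ g k).subtype

/-- The top cohomology `H^n(C_{p^k}, D_{t^{p^k}}) = Ω^n / D(Ω^{n-1})`. -/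
abbrev HTop (p n a : ℕ) [Fact p.Prime] (γ g : PadicAlgCl p) (k : ℕ) : Type :=
  modC p n a γ g k ⧸ boundaries p n a γ g k

/-- The cohomology class of an element of `C_{p^k}`. -/
def cls (p n a : ℕ) [Fact p.Prime] (γ g : PadicAlgCl p) (k : ℕ) (ζ : Laurent p n)
    (hζ : ζ ∈ modC p n a γ g k) : HTop p n a γ g k :=
  Submodule.Quotient.mk ⟨ζ, hζ⟩

/-- The exponent `(1, …, 1, 0, …, 0)` with `i` ones. -/
def stairs {n : ℕ} (i : Fin (n + 1)) : Fin n → ℤ := fun l => if l.val < i.val then 1 else 0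

/-- `e_i = γ ^ i * x_1 ⋯ x_i`, for `0 ≤ i ≤ n`. -/
def basisE (p n : ℕ) [Fact p.Prime] (γ : PadicAlgCl p) (i : Fin (n + 1)) : Laurent p n :=
  mono (stairs i) (PowerSeries.C (γ ^ i.val))

/-! ### Relative Frobenius -/

/-- The Artin–Hasse series `E(T) = exp (∑ j, T ^ (p ^ j) / p ^ j)`. -/
def artinHasse (p : ℕ) : PowerSeries ℚ :=
  (PowerSeries.exp ℚ).subst
    (PowerSeries.mk fun m : ℕ => open Classical in if ∃ j : ℕ, m = p ^ j then (1 / m : ℚ) else 0)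

/-- The coefficient `θ_j` of Dwork's splitting function `θ(T) = E(γ T)`. -/
def theta (p : ℕ) [Fact p.Prime] (γ : PadicAlgCl p) (j : ℕ) : PadicAlgCl p :=
  ((PowerSeries.coeff j (artinHasse p) : ℚ) : PadicAlgCl p) * γ ^ j

/-- `F(t, x) = θ(x_1) ⋯ θ(x_n) θ(t / (x_1 ⋯ x_n)) = ∑ u, B(u) x ^ u`, where
`B(u) = ∑ θ_{m_1} ⋯ θ_{m_n} θ_l t ^ l` over all `m_1, …, m_n, l ≥ 0` with `m_i - l = u_i`. -/
def serF (p n : ℕ) [Fact p.Prime] (γ : PadicAlgCl p) : Laurent p n := fun u =>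
  PowerSeries.mk fun l =>
    if ∀ i, 0 ≤ u i + (l : ℤ) then (∏ i, theta p γ (u i + (l : ℤ)).toNat) * theta p γ l else 0

/-- `ψ_x : ∑ a(u) x ^ u ↦ ∑ a(p u) x ^ u`. -/
def psiX {p n : ℕ} [Fact p.Prime] (f : Laurent p n) : Laurent p n := fun u => f ((p : ℤ) • u)

/-- The chain-level relative Frobenius `α_1 = ψ_x ∘ F(t, x)`. In the top degree the chain map
`Frob^n(α_1)` is given by `α_1` itself. -/
def alphaOne (p n : ℕ) [Fact p.Prime] (γ : PadicAlgCl p) (f : Laurent p n) : Laurent p n :=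
  psiX (lmul (serF p n γ) f)

end HyperKloosterman

end

/-!
The proof passes from Laurent series to power series in `n + 1` variables. With
`β = γ ^ (1 / p ^ k)` put `y_l = γ x_l` for `1 ≤ l ≤ n` and `y_0 = γ t ^ (p ^ k) / (x_1 ⋯ x_n)`.
The monomials `t ^ s x ^ u` that occur in `C_{p^k}` are, up to constants, the products
`(β ^ (n + 1) t) ^ c y ^ κ` with `0 ≤ c < p ^ k`, and `C_{p^k}` becomes the set of families `(φ_c)`
of power series in the `y_i` whose coefficients lie in `𝔒_q` and tend to zero (`mem_modC_iff`). In
these coordinates `x_l ∂H/∂x_l = h(y_l) - h(y_0)` for one series `h(y) = y + ⋯` with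
`ord_p h_m ≥ m - 1` (`twist`, `isTwist_twist`), so that `D_{t^{p^k}, l}` acts on each `φ_c`
separately as the difference `Δ_l - Δ_0` of the operators `Δ_i = y_i ∂/∂y_i + h(y_i)`
(`opD_realize`). The combinations of the `e_j` with coefficients in `O_{p^k}` are the families of
combinations of the monomials `y ^ stairExp d`, one in each degree `d = (n + 1) m + j`, namely
`(y_0 ⋯ y_n) ^ m y_1 ⋯ y_j` (`sum_mul_basisE`). This leaves three facts.

*Generation* (`exists_eq_stairSer_add`). Modulo `p` and terms of lower degree, `Δ_l - Δ_0` is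
multiplication by `y_l - y_0`; hence modulo boundaries every monomial may be replaced by the basis
monomial of its degree, with an error that is divisible by `p` or of lower degree. Iteration
converges, because `𝔒_q` is complete. Since `ord_p h_m ≥ m - 1`, each step respects a growth
condition `|f_κ| ≤ B r ^ |κ|` with `1 / p ≤ r ≤ 1`.

*Independence* (`eq_zero_of_stairSer_eq`). For every integral `ξ` there is a bounded sequence `q`
in `ℂ_p` such that the transpose of `y ∂/∂y + h(y)` multiplies `q` by `ξ` (`IsTwist.exists_dual`).
The functional `f ↦ ∑ f_κ q_{κ_0} ⋯ q_{κ_n}` then satisfies `Δ_i f ↦ ξ f` for all `i`, so it kills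
all boundaries. Modulo `p` it sends the basis monomial of degree `d` to the value at `ξ` of a monic
integral polynomial of degree `d`, and a combination of such polynomials with a unit as leading
coefficient takes the value `1` at some integral point.

*Frobenius*. The series `F(t, x)` is `E(y_0) ⋯ E(y_n)` with the Artin–Hasse series `E`, which is
`p`-integral (`norm_coeff_artinHasse_le`). Multiplication by it turns `Δ_i` into
`y_i ∂/∂y_i + h(y_i) - ∑ j, y_i ^ (p ^ j)`, and `h(y) - ∑ j, y ^ (p ^ j)` is
`p h(γ ^ (1 - p) y ^ p)` (`twist_eq_add`); therefore `α_1 D_l = p D_l α_1` (`frobMap_diffOp`). In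
normalized coordinates `ψ_x` sends the exponent `p κ + (c, …, c)` to `κ` in the component `c`, with
the factor `γ ^ ((p - 1) |κ|) β ^ ((p - 1)(n + 1) c)`, of order `|κ| + c (n + 1) / p`
(`alphaOne_realize`, `norm_frobMap_le`). The generation statement with `r = 1 / p` carries this
decay over to the coordinates `Ã(j, i)`: the coefficient of `t ^ (c + p m)` belongs to a basis
monomial of degree `(n + 1) m + j` in the component `c`, and
`(n + 1) m + j + c (n + 1) / p = (n + 1)(c + p m) / p + j` is the claimed bound.
-/

noncomputable section

namespace HyperKloosterman

open Finsupp (single degree)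

/-! ### The coefficient ring is complete -/

lemma norm_natCast_p (p : ℕ) [Fact p.Prime] : ‖(p : PadicAlgCl p)‖ = (p : ℝ)⁻¹ := by
  rw [← map_natCast (algebraMap ℚ_[p] (PadicAlgCl p)), PadicAlgCl.norm_extends, Padic.norm_p]

lemma norm_intCast_le (p : ℕ) [Fact p.Prime] (z : ℤ) : ‖(z : PadicAlgCl p)‖ ≤ 1 := by
  rw [← map_intCast (algebraMap ℚ_[p] (PadicAlgCl p)), PadicAlgCl.norm_extends]
  exact Padic.norm_int_le_one z

lemma inv_p_pos (p : ℕ) [hp : Fact p.Prime] : 0 < (p : ℝ)⁻¹ :=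
  inv_pos.2 (by exact_mod_cast hp.1.pos)

lemma inv_p_lt_one (p : ℕ) [hp : Fact p.Prime] : (p : ℝ)⁻¹ < 1 :=
  inv_lt_one_of_one_lt₀ (by exact_mod_cast hp.1.one_lt)

lemma inv_p_pow_le_one (p : ℕ) [Fact p.Prime] (t : ℕ) : (p : ℝ)⁻¹ ^ t ≤ 1 :=
  pow_le_one₀ (inv_p_pos p).le (inv_p_lt_one p).le

lemma exists_inv_p_pow_le (p : ℕ) [Fact p.Prime] {η : ℝ} (hη : 0 < η) :
    ∃ t : ℕ, (p : ℝ)⁻¹ ^ t ≤ η :=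
  (exists_pow_lt_of_lt_one hη (inv_p_lt_one p)).imp fun _ h => h.le

section
variable {p a : ℕ} [Fact p.Prime] {g : PadicAlgCl p}

instance finiteDimensional_baseField [NeZero (p ^ a - 1)] :
    FiniteDimensional ℚ_[p] (baseField p a g) := by
  have h1 : Finite {z : PadicAlgCl p | z ^ (p ^ a - 1) = 1} := by
    refine Set.Finite.subset (Polynomial.nthRootsFinset (p ^ a - 1) (1 : PadicAlgCl p)).finite_toSet
      fun z hz => ?_
    rw [Finset.mem_coe, Polynomial.mem_nthRootsFinset (NeZero.pos _)]
    exact hz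
  have : FiniteDimensional ℚ_[p] (Qq p a) :=
    IntermediateField.finiteDimensional_adjoin fun x _ => Algebra.IsIntegral.isIntegral x
  have : FiniteDimensional ℚ_[p] (IntermediateField.adjoin ℚ_[p] {g}) :=
    IntermediateField.finiteDimensional_adjoin fun x _ => Algebra.IsIntegral.isIntegral x
  exact IntermediateField.finiteDimensional_sup _ _

lemma norm_sum_sub_le {x : ℕ → PadicAlgCl p} (hx : ∀ t, ‖x t‖ ≤ (p : ℝ)⁻¹ ^ t)
    {s : PadicAlgCl p} (hs : HasSum x s) (T : ℕ) :
    ‖s - ∑ t ∈ Finset.range T, x t‖ ≤ (p : ℝ)⁻¹ ^ T := by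
  have h : Filter.Tendsto (fun M => ∑ t ∈ Finset.range M, x t - ∑ t ∈ Finset.range T, x t)
      Filter.atTop (nhds (s - ∑ t ∈ Finset.range T, x t)) := hs.tendsto_sum_nat.sub_const _
  refine le_of_tendsto h.norm ?_
  filter_upwards [Filter.eventually_ge_atTop T] with M hM
  rw [← Finset.sum_Ico_eq_sub _ hM]
  refine IsUltrametricDist.norm_sum_le_of_forall_le_of_nonneg (pow_nonneg (inv_p_pos p).le _)
    fun t ht => (hx t).trans ?_
  exact pow_le_pow_of_le_one (inv_p_pos p).le (inv_p_lt_one p).le (Finset.mem_Ico.1 ht).1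

lemma norm_hasSum_le {x : ℕ → PadicAlgCl p} {s : PadicAlgCl p} (hs : HasSum x s) {C : ℝ}
    (h0 : 0 ≤ C) (hx : ∀ t, ‖x t‖ ≤ C) : ‖s‖ ≤ C :=
  le_of_tendsto hs.tendsto_sum_nat.norm (Filter.Eventually.of_forall fun _ =>
    IsUltrametricDist.norm_sum_le_of_forall_le_of_nonneg h0 fun t _ => hx t)

/-- The field `ℚ_q(g)` is complete, being of finite degree over `ℚ_p`; so geometrically bounded
series in its ring of integers converge there, although the algebraic closure is not complete. -/
lemma intRing_exists_hasSum (ha : 1 ≤ a) {x : ℕ → PadicAlgCl p} (hR : ∀ t, x t ∈ intRing p a g)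
    (hx : ∀ t, ‖x t‖ ≤ (p : ℝ)⁻¹ ^ t) : ∃ s ∈ intRing p a g, HasSum x s := by
  -- for `q = 1` the field would be generated by all solutions of `z ^ 0 = 1`
  rcases Nat.lt_or_ge 1 (p ^ a) with h | h
  · have : NeZero (p ^ a - 1) := ⟨by omega⟩
    have : FiniteDimensional ℚ_[p] (baseField p a g).toSubalgebra.toSubmodule :=
      inferInstanceAs (FiniteDimensional ℚ_[p] (baseField p a g))
    have : CompleteSpace (baseField p a g).toSubalgebra.toSubmodule :=
      FiniteDimensional.complete ℚ_[p] _
    let y : ℕ → (baseField p a g).toSubalgebra.toSubmodule := fun t => ⟨x t, (hR t).1⟩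
    have : Summable y := Summable.of_norm_bounded
      (summable_geometric_of_lt_one (inv_p_pos p).le (inv_p_lt_one p)) hx
    obtain ⟨s, hs⟩ := this
    have hs' : HasSum x (s : PadicAlgCl p) :=
      hs.map (baseField p a g).toSubalgebra.toSubmodule.subtype continuous_subtype_val
    exact ⟨s, ⟨s.2, norm_hasSum_le hs' zero_le_one fun t => (hR t).2⟩, hs'⟩
  · exact absurd h (not_le.2 (Nat.one_lt_pow (by omega) (Fact.out : p.Prime).one_lt))

lemma intCast_mem_intRing (z : ℤ) : (z : PadicAlgCl p) ∈ intRing p a g := intCast_mem _ z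

end

/-! ### Restricted power series -/

/-- Formal power series in `y_0, …, y_n`, given by their coefficients. This is the type underlying
`MvPowerSeries`, taken as a bare function type because mostly its pointwise structure is used. -/
abbrev Ser (p n : ℕ) [Fact p.Prime] : Type := (Fin (n + 1) →₀ ℕ) → PadicAlgCl p

/-- The power series has coefficients in `𝔒_q`, and they tend to zero as the total degree grows. -/
structure IsRestricted (p n a : ℕ) [Fact p.Prime] (g : PadicAlgCl p) (f : Ser p n) : Prop where
  mem : ∀ κ, f κ ∈ intRing p a g
  small : ∀ η : ℝ, 0 < η → ∃ D : ℕ, ∀ κ, D ≤ degree κ → ‖f κ‖ ≤ η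

section
variable {p n a : ℕ} [Fact p.Prime] {g : PadicAlgCl p}

namespace IsRestricted
variable {f f' : Ser p n}

lemma zero : IsRestricted p n a g 0 :=
  ⟨fun _ => zero_mem _, fun η hη => ⟨0, fun _ _ => by simpa using hη.le⟩⟩

lemma add (h : IsRestricted p n a g f) (h' : IsRestricted p n a g f') :
    IsRestricted p n a g (f + f') := by
  refine ⟨fun κ => add_mem (h.mem κ) (h'.mem κ), fun η hη => ?_⟩
  obtain ⟨D, hD⟩ := h.small η hη
  obtain ⟨D', hD'⟩ := h'.small η hη
  exact ⟨max D D', fun κ hκ => (IsUltrametricDist.norm_add_le_max _ _).trans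
    (max_le (hD κ (by omega)) (hD' κ (by omega)))⟩

lemma neg (h : IsRestricted p n a g f) : IsRestricted p n a g (-f) := by
  refine ⟨fun κ => neg_mem (h.mem κ), fun η hη => ?_⟩
  obtain ⟨D, hD⟩ := h.small η hη
  exact ⟨D, fun κ hκ => by rw [Pi.neg_apply, norm_neg]; exact hD κ hκ⟩

lemma sub (h : IsRestricted p n a g f) (h' : IsRestricted p n a g f') :
    IsRestricted p n a g (f - f') := by
  rw [sub_eq_add_neg]; exact h.add h'.neg

lemma sum {ι : Type*} (s : Finset ι) {f : ι → Ser p n} (h : ∀ i ∈ s, IsRestricted p n a g (f i)) :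
    IsRestricted p n a g (∑ i ∈ s, f i) := by
  classical
  induction s using Finset.induction_on with
  | empty => simpa using zero
  | insert i s hi ih =>
    rw [Finset.sum_insert hi]
    exact (h i (Finset.mem_insert_self i s)).add
      (ih fun j hj => h j (Finset.mem_insert_of_mem hj))

lemma single (κ : Fin (n + 1) →₀ ℕ) {b : PadicAlgCl p} (hb : b ∈ intRing p a g) :
    IsRestricted p n a g (Pi.single κ b) := by
  refine ⟨fun κ' => ?_, fun η hη => ⟨degree κ + 1, fun κ' hκ' => ?_⟩⟩
  · rcases eq_or_ne κ' κ with rfl | h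
    · rwa [Pi.single_eq_same]
    · rw [Pi.single_eq_of_ne h]; exact zero_mem _
  · rw [Pi.single_eq_of_ne, norm_zero]
    · exact hη.le
    · rintro rfl; omega

end IsRestricted

/-! ### The operators -/

/-- The operator `y_i ∂/∂y_i + h(y_i)` on formal power series in `y_0, …, y_n`. -/
def coordOp (h : ℕ → PadicAlgCl p) (i : Fin (n + 1)) : Ser p n →ₗ[PadicAlgCl p] Ser p n where
  toFun f κ := (κ i : PadicAlgCl p) * f κ +
    ∑ m ∈ Finset.range (κ i + 1), h m * f (κ - single i m)
  map_add' f f' := by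
    funext κ
    simp only [Pi.add_apply, mul_add, Finset.sum_add_distrib]
    ring
  map_smul' c f := by
    funext κ
    simp only [Pi.smul_apply, smul_eq_mul, RingHom.id_apply, mul_add, Finset.mul_sum]
    congr 1
    · ring
    · exact Finset.sum_congr rfl fun m _ => by ring

lemma coordOp_apply (h : ℕ → PadicAlgCl p) (i : Fin (n + 1)) (f : Ser p n)
    (κ : Fin (n + 1) →₀ ℕ) : coordOp h i f κ = (κ i : PadicAlgCl p) * f κ +
      ∑ m ∈ Finset.range (κ i + 1), h m * f (κ - single i m) := rfl

/-- The difference of the operators of the variables `y_{l+1}` and `y_0`. -/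
def diffOp (h : ℕ → PadicAlgCl p) (l : Fin n) : Ser p n →ₗ[PadicAlgCl p] Ser p n :=
  coordOp h l.succ - coordOp h 0

/-- The coefficients of `h(y) = y + h_2 y ^ 2 + ⋯` lie in `𝔒_q` and satisfy
`ord_p h_m ≥ m - 1`. -/
structure IsTwist (p a : ℕ) [Fact p.Prime] (g : PadicAlgCl p) (h : ℕ → PadicAlgCl p) : Prop where
  zero : h 0 = 0
  one : h 1 = 1
  mem : ∀ m, h m ∈ intRing p a g
  norm_succ_le : ∀ m, ‖h (m + 1)‖ ≤ (p : ℝ)⁻¹ ^ m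

lemma single_le_of_mem_range {κ : Fin (n + 1) →₀ ℕ} {i : Fin (n + 1)} {m : ℕ}
    (hm : m ∈ Finset.range (κ i + 1)) : single i m ≤ κ := by
  rw [Finsupp.single_le_iff]
  exact Nat.lt_succ_iff.1 (Finset.mem_range.1 hm)

lemma degree_sub_single {κ : Fin (n + 1) →₀ ℕ} {i : Fin (n + 1)} {m : ℕ}
    (hm : m ∈ Finset.range (κ i + 1)) : degree (κ - single i m) + m = degree κ := by
  have h := congrArg degree (tsub_add_cancel_of_le (single_le_of_mem_range hm))
  rwa [map_add, Finsupp.degree_single] at h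

lemma IsTwist.small {h : ℕ → PadicAlgCl p} (hh : IsTwist p a g h) {η : ℝ} (hη : 0 < η) :
    ∃ M : ℕ, ∀ m, M ≤ m → ‖h m‖ ≤ η := by
  obtain ⟨t, ht⟩ := exists_inv_p_pow_le p hη
  refine ⟨t + 1, fun m hm => ?_⟩
  obtain ⟨m, rfl⟩ : ∃ k, m = k + 1 := ⟨m - 1, by omega⟩
  exact (hh.norm_succ_le m).trans
    ((pow_le_pow_of_le_one (inv_p_pos p).le (inv_p_lt_one p).le (by omega)).trans ht)

lemma IsRestricted.coordOp {h : ℕ → PadicAlgCl p} (hh : IsTwist p a g h) (i : Fin (n + 1))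
    {f : Ser p n} (hf : IsRestricted p n a g f) : IsRestricted p n a g (coordOp h i f) := by
  refine ⟨fun κ => add_mem (mul_mem (natCast_mem _ _) (hf.mem κ))
    (sum_mem fun m _ => mul_mem (hh.mem m) (hf.mem _)), fun η hη => ?_⟩
  obtain ⟨D, hD⟩ := hf.small η hη
  obtain ⟨M, hM⟩ := hh.small hη
  refine ⟨D + M, fun κ hκ => ?_⟩
  refine (IsUltrametricDist.norm_add_le_max _ _).trans (max_le ?_
    (IsUltrametricDist.norm_sum_le_of_forall_le_of_nonneg hη.le fun m hm => ?_))
  · rw [norm_mul]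
    refine (mul_le_of_le_one_left (norm_nonneg _) ?_).trans (hD κ (by omega))
    exact_mod_cast norm_intCast_le p (κ i)
  · rw [norm_mul]
    have := degree_sub_single hm
    rcases le_or_gt M m with h1 | h1
    · exact (mul_le_of_le_one_right (norm_nonneg _) (hf.mem _).2).trans (hM m h1)
    · exact (mul_le_of_le_one_left (norm_nonneg _) (hh.mem m).2).trans (hD _ (by omega))

lemma IsRestricted.diffOp {h : ℕ → PadicAlgCl p} (hh : IsTwist p a g h) (l : Fin n)
    {f : Ser p n} (hf : IsRestricted p n a g f) : IsRestricted p n a g (diffOp h l f) :=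
  (hf.coordOp hh _).sub (hf.coordOp hh _)

/-- The higher terms of `(y_i ∂/∂y_i + h(y_i)) (b y ^ κ) = κ_i b y ^ κ + b y_i y ^ κ + ⋯`. -/
lemma coordOp_single_sub {h : ℕ → PadicAlgCl p} (hh : IsTwist p a g h) (i : Fin (n + 1))
    (κ : Fin (n + 1) →₀ ℕ) (b : PadicAlgCl p) (κ' : Fin (n + 1) →₀ ℕ) :
    (coordOp h i (Pi.single κ b) - Pi.single κ ((κ i : PadicAlgCl p) * b) -
        Pi.single (κ + single i 1) b : Ser p n) κ' = 0 ∨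
      ∃ m, degree κ' = degree κ + (m + 2) ∧
        (coordOp h i (Pi.single κ b) - Pi.single κ ((κ i : PadicAlgCl p) * b) -
          Pi.single (κ + single i 1) b : Ser p n) κ' = h (m + 2) * b := by
  classical
  simp only [Pi.sub_apply, coordOp_apply]
  have h0 : (κ' i : PadicAlgCl p) * (Pi.single κ b : Ser p n) κ' =
      (Pi.single κ ((κ i : PadicAlgCl p) * b) : Ser p n) κ' := by
    rcases eq_or_ne κ' κ with rfl | hne
    · simp
    · simp [Pi.single_eq_of_ne hne]
  rw [h0, add_sub_cancel_left]
  by_cases hex : ∃ m, κ' = κ + single i m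
  · obtain ⟨m, rfl⟩ := hex
    have hsum : ∑ x ∈ Finset.range ((κ + single i m) i + 1),
        h x * (Pi.single κ b : Ser p n) (κ + single i m - single i x) = h m * b := by
      rw [Finset.sum_eq_single m]
      · simp
      · intro x hx hxm
        rw [Pi.single_eq_of_ne, mul_zero]
        intro he
        have h1 := tsub_add_cancel_of_le (single_le_of_mem_range hx)
        rw [he] at h1
        have h2 := congrArg (fun v => v i) (add_left_cancel h1)
        simp only [Finsupp.single_eq_same] at h2
        exact hxm h2
      · intro hm
        simp at hm
    rw [hsum]
    rcases m with _ | _ | m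
    · left
      rw [hh.zero, zero_mul, Pi.single_eq_of_ne, sub_zero]
      intro he
      have := congrArg (fun v => v i) he
      simp at this
    · left
      rw [zero_add, hh.one, one_mul, Pi.single_eq_same, sub_self]
    · right
      refine ⟨m, by rw [map_add, Finsupp.degree_single], ?_⟩
      rw [Pi.single_eq_of_ne, sub_zero]
      intro he
      have := congrArg (fun v => v i) he
      simp at this
  · left
    rw [Finset.sum_eq_zero, Pi.single_eq_of_ne, sub_zero]
    · intro he; exact hex ⟨1, he⟩
    · intro x hx
      rw [Pi.single_eq_of_ne, mul_zero]
      intro he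
      refine hex ⟨x, ?_⟩
      rw [← he, tsub_add_cancel_of_le (single_le_of_mem_range hx)]

end

/-! ### Reduction to the basis monomials -/

/-- The exponent of the basis monomial `(y_0 ⋯ y_n) ^ m * y_1 ⋯ y_j` of degree
`d = (n + 1) m + j`, `0 ≤ j ≤ n`. -/
def stairExp (n d : ℕ) : Fin (n + 1) →₀ ℕ :=
  Finsupp.equivFunOnFinite.symm fun i =>
    d / (n + 1) + if 1 ≤ i.val ∧ i.val ≤ d % (n + 1) then 1 else 0

lemma stairExp_apply (n d : ℕ) (i : Fin (n + 1)) : stairExp n d i =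
    d / (n + 1) + if 1 ≤ i.val ∧ i.val ≤ d % (n + 1) then 1 else 0 := rfl

lemma sum_stair (n j : ℕ) (hj : j ≤ n) :
    ∑ i : Fin (n + 1), (if 1 ≤ i.val ∧ i.val ≤ j then 1 else 0) = j := by
  rw [Fin.sum_univ_eq_sum_range (fun i => if 1 ≤ i ∧ i ≤ j then 1 else 0), ← Finset.sum_filter,
    Finset.sum_const, smul_eq_mul, mul_one]
  have : Finset.filter (fun i => 1 ≤ i ∧ i ≤ j) (Finset.range (n + 1)) = Finset.Icc 1 j := by
    ext i
    simp only [Finset.mem_filter, Finset.mem_range, Finset.mem_Icc]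
    omega
  rw [this, Nat.card_Icc, Nat.add_sub_cancel]

lemma degree_stairExp (n d : ℕ) : degree (stairExp n d) = d := by
  rw [Finsupp.degree_eq_sum]
  simp only [stairExp_apply, Finset.sum_add_distrib]
  rw [sum_stair n _ (Nat.lt_succ_iff.1 (Nat.mod_lt d n.succ_pos))]
  simp only [Finset.sum_const, Finset.card_univ, Fintype.card_fin, smul_eq_mul]
  exact Nat.div_add_mod d (n + 1)

section
variable {p n a : ℕ} [Fact p.Prime] {g : PadicAlgCl p}

/-- The combination `∑ d, c d * y ^ stairExp d` of the basis monomials. -/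
def stairSer : (ℕ → PadicAlgCl p) →ₗ[PadicAlgCl p] Ser p n where
  toFun c κ := if κ = stairExp n (degree κ) then c (degree κ) else 0
  map_add' c c' := by
    funext κ
    simp only [Pi.add_apply]
    split_ifs
    · rfl
    · rw [add_zero]
  map_smul' b c := by
    funext κ
    simp only [Pi.smul_apply, RingHom.id_apply]
    split_ifs
    · rfl
    · rw [smul_zero]

lemma stairSer_apply (c : ℕ → PadicAlgCl p) (κ : Fin (n + 1) →₀ ℕ) :
    (stairSer c : Ser p n) κ = if κ = stairExp n (degree κ) then c (degree κ) else 0 := rfl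

lemma stairSer_single (d : ℕ) (b : PadicAlgCl p) :
    (stairSer (Pi.single d b) : Ser p n) = Pi.single (stairExp n d) b := by
  funext κ
  rw [stairSer_apply]
  by_cases h : κ = stairExp n d
  · subst h
    rw [degree_stairExp, if_pos rfl, Pi.single_eq_same, Pi.single_eq_same]
  · rw [Pi.single_eq_of_ne h]
    split_ifs with h1
    · rw [Pi.single_eq_of_ne]
      rintro h2
      exact h (h2 ▸ h1)
    · rfl

/-- Membership in the `t`-th step of the filtration used in the reduction: the coefficients lie in
`𝔒_q`, tend to zero, are divisible by `p ^ t` and satisfy the growth condition `(B, r)`. -/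
structure InStep (p n a : ℕ) [Fact p.Prime] (g : PadicAlgCl p) (B r : ℝ) (t : ℕ)
    (f : Ser p n) : Prop where
  res : IsRestricted p n a g f
  growth : ∀ κ, ‖f κ‖ ≤ B * r ^ degree κ
  div : ∀ κ, ‖f κ‖ ≤ (p : ℝ)⁻¹ ^ t

/-- The series is, modulo the next step of the filtration, the sum of a combination of basis
monomials and of a boundary. -/
def Reducible (p n a : ℕ) [Fact p.Prime] (g : PadicAlgCl p) (h : ℕ → PadicAlgCl p) (B r : ℝ)
    (t : ℕ) (f : Ser p n) : Prop :=
  ∃ (c : ℕ → PadicAlgCl p) (G : Fin n → Ser p n),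
    (∀ d, c d ∈ intRing p a g ∧ ‖c d‖ ≤ B * r ^ d ∧ ‖c d‖ ≤ (p : ℝ)⁻¹ ^ t) ∧
    (∀ η : ℝ, 0 < η → ∃ D : ℕ, ∀ d, D ≤ d → ‖c d‖ ≤ η) ∧
    (∀ l, IsRestricted p n a g (G l) ∧ ∀ κ, ‖G l κ‖ ≤ (p : ℝ)⁻¹ ^ t) ∧
    InStep p n a g B r (t + 1) (f - stairSer c - ∑ l, diffOp h l (G l))

variable {B r : ℝ} {t : ℕ} {h : ℕ → PadicAlgCl p}

lemma InStep.add {f f' : Ser p n} (hf : InStep p n a g B r t f) (hf' : InStep p n a g B r t f') :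
    InStep p n a g B r t (f + f') :=
  ⟨hf.res.add hf'.res,
    fun κ => (IsUltrametricDist.norm_add_le_max _ _).trans (max_le (hf.growth κ) (hf'.growth κ)),
    fun κ => (IsUltrametricDist.norm_add_le_max _ _).trans (max_le (hf.div κ) (hf'.div κ))⟩

lemma InStep.neg {f : Ser p n} (hf : InStep p n a g B r t f) : InStep p n a g B r t (-f) :=
  ⟨hf.res.neg, fun κ => by rw [Pi.neg_apply, norm_neg]; exact hf.growth κ,
    fun κ => by rw [Pi.neg_apply, norm_neg]; exact hf.div κ⟩

lemma InStep.zero (hB : 0 ≤ B) (hr : 0 ≤ r) : InStep p n a g B r t 0 :=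
  ⟨IsRestricted.zero, fun κ => by rw [Pi.zero_apply, norm_zero]; positivity,
    fun κ => by rw [Pi.zero_apply, norm_zero]; positivity⟩

lemma Reducible.of_inStep (hB : 0 ≤ B) (hr : 0 ≤ r) {f : Ser p n}
    (hf : InStep p n a g B r (t + 1) f) : Reducible p n a g h B r t f := by
  refine ⟨0, 0, fun d => ⟨zero_mem _, ?_, ?_⟩, fun η hη => ⟨0, fun d _ => ?_⟩,
    fun l => ⟨IsRestricted.zero, fun κ => ?_⟩, ?_⟩
  · rw [Pi.zero_apply, norm_zero]; positivity
  · rw [Pi.zero_apply, norm_zero]; positivity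
  · rw [Pi.zero_apply, norm_zero]; exact hη.le
  · simp
  · simpa using hf

lemma Reducible.add {f f' : Ser p n} (hf : Reducible p n a g h B r t f)
    (hf' : Reducible p n a g h B r t f') : Reducible p n a g h B r t (f + f') := by
  obtain ⟨c, G, h1, h2, h3, h4⟩ := hf
  obtain ⟨c', G', h1', h2', h3', h4'⟩ := hf'
  refine ⟨c + c', G + G', fun d => ⟨add_mem (h1 d).1 (h1' d).1, ?_, ?_⟩, fun η hη => ?_,
    fun l => ⟨(h3 l).1.add (h3' l).1, fun κ => ?_⟩, ?_⟩
  · exact (IsUltrametricDist.norm_add_le_max _ _).trans (max_le (h1 d).2.1 (h1' d).2.1)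
  · exact (IsUltrametricDist.norm_add_le_max _ _).trans (max_le (h1 d).2.2 (h1' d).2.2)
  · obtain ⟨D, hD⟩ := h2 η hη
    obtain ⟨D', hD'⟩ := h2' η hη
    exact ⟨max D D', fun d hd => (IsUltrametricDist.norm_add_le_max _ _).trans
      (max_le (hD d (by omega)) (hD' d (by omega)))⟩
  · exact (IsUltrametricDist.norm_add_le_max _ _).trans (max_le ((h3 l).2 κ) ((h3' l).2 κ))
  · have := h4.add h4'
    convert this using 1
    simp only [map_add, Pi.add_apply, Finset.sum_add_distrib]
    abel

lemma Reducible.sum (hB : 0 ≤ B) (hr : 0 ≤ r) {ι : Type*} (s : Finset ι) {f : ι → Ser p n}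
    (hf : ∀ i ∈ s, Reducible p n a g h B r t (f i)) :
    Reducible p n a g h B r t (∑ i ∈ s, f i) := by
  classical
  induction s using Finset.induction_on with
  | empty => exact Reducible.of_inStep hB hr (InStep.zero hB hr)
  | insert i s hi ih =>
    rw [Finset.sum_insert hi]
    exact (hf i (Finset.mem_insert_self i s)).add
      (ih fun j hj => hf j (Finset.mem_insert_of_mem hj))

lemma Reducible.diffOp_single (hB : 0 ≤ B) (hr : 0 ≤ r) (l : Fin n) (κ : Fin (n + 1) →₀ ℕ)
    {b : PadicAlgCl p} (hb : b ∈ intRing p a g) (hbt : ‖b‖ ≤ (p : ℝ)⁻¹ ^ t) :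
    Reducible p n a g h B r t (diffOp h l (Pi.single κ b)) := by
  refine ⟨0, Pi.single l (Pi.single κ b), fun d => ⟨zero_mem _, ?_, ?_⟩,
    fun η hη => ⟨0, fun d _ => ?_⟩, fun l' => ?_, ?_⟩
  · rw [Pi.zero_apply, norm_zero]; positivity
  · rw [Pi.zero_apply, norm_zero]; positivity
  · rw [Pi.zero_apply, norm_zero]; exact hη.le
  · rcases eq_or_ne l' l with rfl | hl
    · rw [Pi.single_eq_same]
      refine ⟨IsRestricted.single κ hb, fun κ' => ?_⟩
      rcases eq_or_ne κ' κ with rfl | hκ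
      · rwa [Pi.single_eq_same]
      · rw [Pi.single_eq_of_ne hκ, norm_zero]; positivity
    · rw [Pi.single_eq_of_ne hl]
      exact ⟨IsRestricted.zero, fun κ' => by rw [Pi.zero_apply, norm_zero]; positivity⟩
  · rw [Finset.sum_eq_single l, Pi.single_eq_same, map_zero, sub_zero, sub_self]
    · exact InStep.zero hB hr
    · intro l' _ hl
      rw [Pi.single_eq_of_ne hl, map_zero]
    · intro hl; exact absurd (Finset.mem_univ l) hl

lemma Reducible.single_stairExp (hB : 0 ≤ B) (hr : 0 ≤ r) (d : ℕ) {b : PadicAlgCl p}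
    (hb : b ∈ intRing p a g) (hbB : ‖b‖ ≤ B * r ^ d) (hbt : ‖b‖ ≤ (p : ℝ)⁻¹ ^ t) :
    Reducible p n a g h B r t (Pi.single (stairExp n d) b) := by
  refine ⟨Pi.single d b, 0, fun d' => ?_, fun η hη => ⟨d + 1, fun d' hd' => ?_⟩,
    fun l => ⟨IsRestricted.zero, fun κ => ?_⟩, ?_⟩
  · rcases eq_or_ne d' d with rfl | hd
    · rw [Pi.single_eq_same]; exact ⟨hb, hbB, hbt⟩
    · rw [Pi.single_eq_of_ne hd, norm_zero]
      exact ⟨zero_mem _, by positivity, by positivity⟩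
  · rw [Pi.single_eq_of_ne (by omega), norm_zero]; exact hη.le
  · simp
  · rw [stairSer_single, sub_self]
    simpa using InStep.zero hB hr

/-- The higher terms of `(y_i ∂/∂y_i + h(y_i)) (b y ^ κ)` gain a factor `p`, and they satisfy the
growth condition because `ord_p h_m ≥ m - 1` compensates the rise of the degree by `m - 1`. -/
lemma inStep_coordOp_single_sub (hh : IsTwist p a g h) (hB : 0 ≤ B) (hr : (p : ℝ)⁻¹ ≤ r)
    (i : Fin (n + 1)) (κ : Fin (n + 1) →₀ ℕ) {b : PadicAlgCl p} (hb : b ∈ intRing p a g)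
    (hbB : ‖b‖ ≤ B * r ^ (degree κ + 1)) (hbt : ‖b‖ ≤ (p : ℝ)⁻¹ ^ t) :
    InStep p n a g B r (t + 1) (coordOp h i (Pi.single κ b) -
      Pi.single κ ((κ i : PadicAlgCl p) * b) - Pi.single (κ + single i 1) b) := by
  have hr0 : 0 ≤ r := (inv_p_pos p).le.trans hr
  refine ⟨?_, fun κ' => ?_, fun κ' => ?_⟩
  · exact (((IsRestricted.single κ hb).coordOp hh i).sub
      (IsRestricted.single κ (mul_mem (natCast_mem _ _) hb))).sub (IsRestricted.single _ hb)
  · rcases coordOp_single_sub hh i κ b κ' with h0 | ⟨m, hm, h0⟩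
    · rw [h0, norm_zero]; positivity
    · rw [h0, hm, norm_mul]
      calc ‖h (m + 2)‖ * ‖b‖ ≤ (p : ℝ)⁻¹ ^ (m + 1) * (B * r ^ (degree κ + 1)) :=
            mul_le_mul (hh.norm_succ_le _) hbB (norm_nonneg _) (pow_nonneg (inv_p_pos p).le _)
        _ ≤ r ^ (m + 1) * (B * r ^ (degree κ + 1)) := by
            refine mul_le_mul_of_nonneg_right ?_ (by positivity)
            exact pow_le_pow_left₀ (inv_p_pos p).le hr _
        _ = B * r ^ (degree κ + (m + 2)) := by ring
  · rcases coordOp_single_sub hh i κ b κ' with h0 | ⟨m, hm, h0⟩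
    · rw [h0, norm_zero]; positivity
    · rw [h0, norm_mul, pow_succ, mul_comm]
      refine mul_le_mul hbt ((hh.norm_succ_le _).trans ?_) (norm_nonneg _) (by positivity)
      exact pow_le_of_le_one (inv_p_pos p).le (inv_p_lt_one p).le (by omega)

/-- Modulo boundaries and monomials of lower degree, a factor `y_{l+1}` may be replaced
by `y_0`, and conversely. -/
lemma reducible_single_iff (hh : IsTwist p a g h) (hB : 0 ≤ B) (hr : (p : ℝ)⁻¹ ≤ r) (hr1 : r ≤ 1)
    (l : Fin n) (κ : Fin (n + 1) →₀ ℕ) {b : PadicAlgCl p} (hb : b ∈ intRing p a g)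
    (hbB : ‖b‖ ≤ B * r ^ (degree κ + 1)) (hbt : ‖b‖ ≤ (p : ℝ)⁻¹ ^ t)
    (ih : ∀ b ∈ intRing p a g, ‖b‖ ≤ B * r ^ degree κ → ‖b‖ ≤ (p : ℝ)⁻¹ ^ t →
      Reducible p n a g h B r t (Pi.single κ b)) :
    Reducible p n a g h B r t (Pi.single (κ + single l.succ 1) b) ↔
      Reducible p n a g h B r t (Pi.single (κ + single 0 1) b) := by
  have hr0 : 0 ≤ r := (inv_p_pos p).le.trans hr
  have hB' : ‖b‖ ≤ B * r ^ degree κ := hbB.trans (mul_le_mul_of_nonneg_left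
    (pow_le_pow_of_le_one hr0 hr1 (Nat.le_succ _)) hB)
  have key : ∀ z : ℤ, Reducible p n a g h B r t (Pi.single κ ((z : PadicAlgCl p) * b)) := by
    intro z
    have hz : ‖(z : PadicAlgCl p) * b‖ ≤ ‖b‖ := by
      rw [norm_mul]
      exact mul_le_of_le_one_left (norm_nonneg _) (norm_intCast_le p z)
    exact ih _ (mul_mem (intCast_mem_intRing z) hb) (hz.trans hB') (hz.trans hbt)
  have e1 := Reducible.of_inStep (h := h) hB hr0 (inStep_coordOp_single_sub hh hB hr l.succ κ hb
    hbB hbt)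
  have e1' := Reducible.of_inStep (h := h) hB hr0 (inStep_coordOp_single_sub hh hB hr l.succ κ hb
    hbB hbt).neg
  have e2 := Reducible.of_inStep (h := h) hB hr0 (inStep_coordOp_single_sub hh hB hr 0 κ hb
    hbB hbt)
  have e2' := Reducible.of_inStep (h := h) hB hr0 (inStep_coordOp_single_sub hh hB hr 0 κ hb
    hbB hbt).neg
  have e3 := Reducible.diffOp_single (n := n) (h := h) hB hr0 l κ hb hbt
  have e3' := Reducible.diffOp_single (n := n) (h := h) hB hr0 l κ (neg_mem hb)
    (by rwa [norm_neg])
  have e4 := key ((κ 0 : ℤ) - κ l.succ)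
  have e4' := key ((κ l.succ : ℤ) - κ 0)
  have hs : ∀ x y : PadicAlgCl p, (Pi.single κ (x - y) : Ser p n) =
    Pi.single κ x - Pi.single κ y := fun x y =>
    Pi.single_sub (f := fun _ => PadicAlgCl p) κ x y
  push_cast at e4 e4'
  rw [sub_mul, hs] at e4 e4'
  rw [Pi.single_neg, map_neg] at e3'
  simp only [diffOp, LinearMap.sub_apply] at e3 e3'
  constructor
  · intro hx
    convert (((e3'.add e4').add hx).add e2').add e1 using 1
    abel
  · intro hx
    convert (((e3.add e4).add hx).add e1').add e2 using 1
    abel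

lemma exists_eq_add_single {κ : Fin (n + 1) →₀ ℕ} {i : Fin (n + 1)} (hi : κ i ≠ 0) :
    ∃ κ', κ = κ' + single i 1 := by
  refine ⟨κ - single i 1, (tsub_add_cancel_of_le ?_).symm⟩
  rw [Finsupp.single_le_iff]
  omega

/-- By induction on the degree, a monomial is equivalent to any other of the same degree: all of
them are compared with the power of `y_0`, by exchanging one factor `y_l` at a time. -/
lemma reducible_single (hh : IsTwist p a g h) (hB : 0 ≤ B) (hr : (p : ℝ)⁻¹ ≤ r) (hr1 : r ≤ 1)
    (d : ℕ) : ∀ κ : Fin (n + 1) →₀ ℕ, degree κ = d → ∀ b ∈ intRing p a g,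
      ‖b‖ ≤ B * r ^ d → ‖b‖ ≤ (p : ℝ)⁻¹ ^ t → Reducible p n a g h B r t (Pi.single κ b) := by
  have hr0 : 0 ≤ r := (inv_p_pos p).le.trans hr
  induction d with
  | zero =>
    intro κ hκ b hb hbB hbt
    have : κ = stairExp n 0 := by
      rw [(Finsupp.degree_eq_zero_iff κ).1 hκ]
      exact ((Finsupp.degree_eq_zero_iff _).1 (degree_stairExp n 0)).symm
    rw [this]
    exact Reducible.single_stairExp hB hr0 0 hb hbB hbt
  | succ d ih =>
    intro κ hκ b hb hbB hbt
    -- induction on the number `e` of factors other than `y_0`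
    have key : ∀ (e : ℕ) (κ : Fin (n + 1) →₀ ℕ), degree κ = d + 1 → κ 0 + e = d + 1 →
        (Reducible p n a g h B r t (Pi.single κ b) ↔
          Reducible p n a g h B r t (Pi.single (single 0 (d + 1)) b)) := by
      intro e
      induction e with
      | zero =>
        intro κ hκ h0
        have : κ = single 0 (d + 1) := by
          rw [Finsupp.degree_eq_sum, Fin.sum_univ_succ] at hκ
          have hz : ∑ i : Fin n, κ i.succ = 0 := by omega
          rw [Finset.sum_eq_zero_iff] at hz
          ext i
          refine Fin.cases ?_ (fun i => ?_) i
          · rw [Finsupp.single_eq_same]; exact h0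
          · rw [Finsupp.single_eq_of_ne (Fin.succ_ne_zero i)]; exact hz i (Finset.mem_univ i)
        rw [this]
      | succ e ihe =>
        intro κ hκ h0
        have hκ' := hκ
        rw [Finsupp.degree_eq_sum, Fin.sum_univ_succ] at hκ'
        obtain ⟨l, -, hl⟩ : ∃ l ∈ (Finset.univ : Finset (Fin n)), κ l.succ ≠ 0 :=
          Finset.exists_ne_zero_of_sum_ne_zero (by omega)
        obtain ⟨κ', rfl⟩ := exists_eq_add_single hl
        have hd : degree κ' = d := by
          rw [map_add, Finsupp.degree_single] at hκ; omega
        rw [reducible_single_iff hh hB hr hr1 l κ' hb (by rwa [hd]) hbt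
          (by rw [hd]; exact ih κ' hd)]
        refine ihe _ ?_ ?_
        · rw [map_add, Finsupp.degree_single, hd]
        · rw [Finsupp.add_apply, Finsupp.single_eq_of_ne (Fin.succ_ne_zero l).symm] at h0
          rw [Finsupp.add_apply, Finsupp.single_eq_same]
          omega
    have hle : ∀ κ : Fin (n + 1) →₀ ℕ, κ 0 ≤ degree κ := fun κ => Finsupp.le_degree 0 κ
    rw [key _ κ hκ (Nat.add_sub_of_le (hκ ▸ hle κ)),
      ← key _ (stairExp n (d + 1)) (degree_stairExp n _)
        (Nat.add_sub_of_le ((hle _).trans (degree_stairExp n _).le))]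
    exact Reducible.single_stairExp hB hr0 (d + 1) hb hbB hbt

lemma finite_degree_lt (n D : ℕ) : {κ : Fin (n + 1) →₀ ℕ | degree κ < D}.Finite := by
  refine Set.Finite.subset (Set.finite_Iic (Finsupp.equivFunOnFinite.symm fun _ => D))
    fun κ hκ => ?_
  intro i
  exact (Finsupp.le_degree i κ).trans (le_of_lt hκ)

/-- Only finitely many coefficients of a restricted series are not divisible by `p ^ (t + 1)`, so
one step of the reduction is a finite sum of reductions of monomials. -/
lemma InStep.reducible (hh : IsTwist p a g h) (hB : 0 ≤ B) (hr : (p : ℝ)⁻¹ ≤ r) (hr1 : r ≤ 1)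
    {f : Ser p n} (hf : InStep p n a g B r t f) : Reducible p n a g h B r t f := by
  classical
  have hr0 : 0 ≤ r := (inv_p_pos p).le.trans hr
  obtain ⟨D, hD⟩ := hf.res.small ((p : ℝ)⁻¹ ^ (t + 1)) (pow_pos (inv_p_pos p) _)
  set s := (finite_degree_lt n D).toFinset
  have hs : ∀ κ, κ ∈ s ↔ degree κ < D := fun κ => by simp [s]
  have hval : ∀ κ, (∑ κ' ∈ s, (Pi.single κ' (f κ') : Ser p n)) κ =
      if degree κ < D then f κ else 0 := by
    intro κ
    rw [Finset.sum_apply, Finset.sum_pi_single]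
    simp only [hs]
  have hfin : Reducible p n a g h B r t (∑ κ ∈ s, (Pi.single κ (f κ) : Ser p n)) :=
    Reducible.sum hB hr0 s fun κ _ => reducible_single hh hB hr hr1 _ κ rfl _ (hf.res.mem κ)
      (hf.growth κ) (hf.div κ)
  have hrest : InStep p n a g B r (t + 1) (f - ∑ κ ∈ s, (Pi.single κ (f κ) : Ser p n)) := by
    refine ⟨hf.res.sub (IsRestricted.sum s fun κ _ => IsRestricted.single κ (hf.res.mem κ)),
      fun κ => ?_, fun κ => ?_⟩ <;> rw [Pi.sub_apply, hval]
    · split_ifs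
      · rw [sub_self, norm_zero]; positivity
      · rw [sub_zero]; exact hf.growth κ
    · split_ifs with h1
      · rw [sub_self, norm_zero]; positivity
      · rw [sub_zero]; exact hD κ (not_lt.1 h1)
  have := hfin.add (Reducible.of_inStep (h := h) hB hr0 hrest)
  rwa [add_sub_cancel] at this

end

section
variable {p n a : ℕ} [Fact p.Prime] {g : PadicAlgCl p}
variable {B r : ℝ} {h : ℕ → PadicAlgCl p}

lemma hasSum_diffOp {G : ℕ → Ser p n} {G' : Ser p n} (hG : ∀ κ, HasSum (fun t => G t κ) (G' κ))
    (l : Fin n) (κ : Fin (n + 1) →₀ ℕ) :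
    HasSum (fun t => diffOp h l (G t) κ) (diffOp h l G' κ) := by
  have key : ∀ i, HasSum (fun t => coordOp h i (G t) κ) (coordOp h i G' κ) := fun i =>
    ((hG κ).mul_left _).add (hasSum_sum fun m _ => (hG _).mul_left _)
  exact (key _).sub (key _)

lemma hasSum_stairSer {c : ℕ → ℕ → PadicAlgCl p} {c' : ℕ → PadicAlgCl p}
    (hc : ∀ d, HasSum (fun t => c t d) (c' d)) (κ : Fin (n + 1) →₀ ℕ) :
    HasSum (fun t => (stairSer (c t) : Ser p n) κ) ((stairSer c' : Ser p n) κ) := by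
  simp only [stairSer_apply]
  split_ifs
  · exact hc _
  · exact hasSum_zero

lemma small_of_hasSum {ι : Type*} (deg : ι → ℕ) {x : ℕ → ι → PadicAlgCl p}
    {s : ι → PadicAlgCl p} (hs : ∀ i, HasSum (fun t => x t i) (s i))
    (hx : ∀ t i, ‖x t i‖ ≤ (p : ℝ)⁻¹ ^ t)
    (h0 : ∀ t, ∀ η : ℝ, 0 < η → ∃ D : ℕ, ∀ i, D ≤ deg i → ‖x t i‖ ≤ η)
    (η : ℝ) (hη : 0 < η) : ∃ D : ℕ, ∀ i, D ≤ deg i → ‖s i‖ ≤ η := by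
  obtain ⟨T, hT⟩ := exists_inv_p_pow_le p hη
  choose D hD using fun t => h0 t η hη
  refine ⟨(Finset.range T).sup D, fun i hi => ?_⟩
  have h1 := norm_sum_sub_le (fun t => hx t i) (hs i) T
  have h2 : ‖∑ t ∈ Finset.range T, x t i‖ ≤ η :=
    IsUltrametricDist.norm_sum_le_of_forall_le_of_nonneg hη.le fun t ht =>
      hD t i ((Finset.le_sup ht).trans hi)
  rw [← sub_add_cancel (s i) (∑ t ∈ Finset.range T, x t i)]
  exact (IsUltrametricDist.norm_add_le_max _ _).trans (max_le (h1.trans hT) h2)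

/-- Every restricted series is a combination of the basis monomials modulo boundaries, and a growth
condition `‖f κ‖ ≤ B r ^ |κ|` with `1 / p ≤ r ≤ 1` carries over to the coefficients. -/
theorem exists_eq_stairSer_add (ha : 1 ≤ a) (hh : IsTwist p a g h) (hB : 0 ≤ B)
    (hr : (p : ℝ)⁻¹ ≤ r) (hr1 : r ≤ 1) {f : Ser p n} (hf : IsRestricted p n a g f)
    (hfB : ∀ κ, ‖f κ‖ ≤ B * r ^ degree κ) :
    ∃ (c : ℕ → PadicAlgCl p) (G : Fin n → Ser p n),
      (∀ d, c d ∈ intRing p a g ∧ ‖c d‖ ≤ B * r ^ d) ∧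
      (∀ η : ℝ, 0 < η → ∃ D : ℕ, ∀ d, D ≤ d → ‖c d‖ ≤ η) ∧
      (∀ l, IsRestricted p n a g (G l)) ∧ f = stairSer c + ∑ l, diffOp h l (G l) := by
  have hr0 : 0 ≤ r := (inv_p_pos p).le.trans hr
  have step : ∀ (t : ℕ) (f : Ser p n), InStep p n a g B r t f → Reducible p n a g h B r t f :=
    fun t f hf => hf.reducible hh hB hr hr1
  unfold Reducible at step
  choose! C G h1 h2 h3 h4 using step
  -- `F t` is the remainder of `f` after `t` reduction steps
  let F : ℕ → Ser p n := fun t => Nat.rec f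
    (fun t ft => ft - stairSer (C t ft) - ∑ l, diffOp h l (G t ft l)) t
  have hF : ∀ t, InStep p n a g B r t (F t) := by
    intro t
    induction t with
    | zero => exact ⟨hf, hfB, fun κ => by rw [pow_zero]; exact (hf.mem κ).2⟩
    | succ t ih => exact h4 t _ ih
  have hFs : ∀ t, F (t + 1) = F t - stairSer (C t (F t)) - ∑ l, diffOp h l (G t (F t) l) :=
    fun t => rfl
  choose c hcR hc using fun d => intRing_exists_hasSum ha (x := fun t => C t (F t) d)
    (fun t => (h1 t _ (hF t) d).1) (fun t => (h1 t _ (hF t) d).2.2)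
  choose G' hGR hG using fun l κ => intRing_exists_hasSum ha (x := fun t => G t (F t) l κ)
    (fun t => (h3 t _ (hF t) l).1.mem κ) (fun t => (h3 t _ (hF t) l).2 κ)
  refine ⟨c, G', fun d => ⟨hcR d, norm_hasSum_le (hc d) (by positivity)
    fun t => (h1 t _ (hF t) d).2.1⟩, ?_, fun l => ⟨hGR l, ?_⟩, ?_⟩
  · exact small_of_hasSum id hc (fun t d => (h1 t _ (hF t) d).2.2) fun t => h2 t _ (hF t)
  · exact small_of_hasSum degree (hG l) (fun t κ => (h3 t _ (hF t) l).2 κ)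
      fun t => (h3 t _ (hF t) l).1.small
  · funext κ
    have e1 : HasSum (fun t => (stairSer (C t (F t)) : Ser p n) κ +
        ∑ l, diffOp h l (G t (F t) l) κ) ((stairSer c : Ser p n) κ + ∑ l, diffOp h l (G' l) κ) :=
      (hasSum_stairSer hc κ).add (hasSum_sum fun l _ => hasSum_diffOp (hG l) l κ)
    have e2 : ∀ T, ∑ t ∈ Finset.range T, ((stairSer (C t (F t)) : Ser p n) κ +
        ∑ l, diffOp h l (G t (F t) l) κ) = f κ - F T κ := by
      intro T
      induction T with
      | zero => simp [F]
      | succ T ih =>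
        rw [Finset.sum_range_succ, ih, hFs]
        simp only [Pi.sub_apply, Finset.sum_apply]
        ring
    have e3 : Filter.Tendsto (fun T => F T κ) Filter.atTop (nhds 0) := by
      rw [tendsto_zero_iff_norm_tendsto_zero]
      exact squeeze_zero (fun _ => norm_nonneg _) (fun T => (hF T).div κ)
        (tendsto_pow_atTop_nhds_zero_of_lt_one (inv_p_pos p).le (inv_p_lt_one p))
    have e4 := e1.tendsto_sum_nat
    simp only [e2] at e4
    have e5 := tendsto_nhds_unique e4 (e3.const_sub (f κ))
    rw [sub_zero] at e5
    rw [Pi.add_apply, Finset.sum_apply]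
    exact e5.symm

end

/-! ### Functionals annihilating the boundaries -/

section
variable {p : ℕ} [Fact p.Prime]

lemma norm_sub_le_max (x y : ℂ_[p]) : ‖x - y‖ ≤ max ‖x‖ ‖y‖ := by
  rw [sub_eq_add_neg, ← norm_neg y]
  exact IsUltrametricDist.norm_add_le_max x (-y)

lemma norm_sub_natCast_le {ξ : ℂ_[p]} (hξ : ‖ξ‖ ≤ 1) (k : ℕ) : ‖ξ - k‖ ≤ 1 :=
  (norm_sub_le_max _ _).trans
    (max_le hξ (IsUltrametricDist.norm_natCast_le_one _ _))

lemma summable_mul_bounded {H x : ℕ → ℂ_[p]} (hH : Filter.Tendsto H Filter.atTop (nhds 0)) {C : ℝ}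
    (hx : ∀ m, ‖x m‖ ≤ C) : Summable fun m => H m * x m := by
  refine NonarchimedeanAddGroup.summable_of_tendsto_cofinite_zero ?_
  rw [Nat.cofinite_eq_atTop]
  rw [tendsto_zero_iff_norm_tendsto_zero] at hH ⊢
  refine squeeze_zero (fun _ => norm_nonneg _) (fun m => ?_) (by simpa using hH.mul_const C)
  rw [norm_mul]
  exact mul_le_mul_of_nonneg_left (hx m) (norm_nonneg _)

/-- One step of the iteration solving `q_{k+1} + ∑ m, H_m q_{k+2+m} = (ξ - k) q_k`, `q_0 = 1`. -/
def dualStep (H : ℕ → ℂ_[p]) (ξ : ℂ_[p]) (x : ℕ → ℂ_[p]) : ℕ → ℂ_[p]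
  | 0 => 1
  | k + 1 => (ξ - k) * dualStep H ξ x k - ∑' m, H m * x (k + 2 + m)

lemma norm_dualStep_le {H : ℕ → ℂ_[p]} {ξ : ℂ_[p]} (hξ : ‖ξ‖ ≤ 1) (hb : ∀ m, ‖H m‖ ≤ (p : ℝ)⁻¹)
    {x : ℕ → ℂ_[p]} {C : ℝ} (hx : ∀ m, ‖x m‖ ≤ C) (k : ℕ) :
    ‖dualStep H ξ x k‖ ≤ max 1 ((p : ℝ)⁻¹ * C) := by
  induction k with
  | zero => rw [dualStep, norm_one]; exact le_max_left _ _
  | succ k ih =>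
    rw [dualStep]
    refine (norm_sub_le_max _ _).trans (max_le ?_ ((?_ : _ ≤ _).trans
      (le_max_right _ _)))
    · rw [norm_mul]
      exact (mul_le_of_le_one_left (norm_nonneg _) (norm_sub_natCast_le hξ k)).trans ih
    · refine IsUltrametricDist.norm_tsum_le_of_forall_le fun m => ?_
      rw [norm_mul]
      exact mul_le_mul (hb m) (hx _) (norm_nonneg _) (inv_p_pos p).le

lemma norm_dualStep_sub_le {H : ℕ → ℂ_[p]} {ξ : ℂ_[p]} (hξ : ‖ξ‖ ≤ 1)
    (hH : Filter.Tendsto H Filter.atTop (nhds 0)) (hb : ∀ m, ‖H m‖ ≤ (p : ℝ)⁻¹)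
    {x y : ℕ → ℂ_[p]} {C C' E : ℝ} (hx : ∀ m, ‖x m‖ ≤ C) (hy : ∀ m, ‖y m‖ ≤ C')
    (hxy : ∀ m, ‖x m - y m‖ ≤ E) (k : ℕ) :
    ‖dualStep H ξ x k - dualStep H ξ y k‖ ≤ (p : ℝ)⁻¹ * E := by
  have hE : 0 ≤ E := (norm_nonneg _).trans (hxy 0)
  induction k with
  | zero =>
    rw [dualStep, dualStep, sub_self, norm_zero]
    exact mul_nonneg (inv_p_pos p).le hE
  | succ k ih =>
    have e : dualStep H ξ x (k + 1) - dualStep H ξ y (k + 1) =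
        (ξ - k) * (dualStep H ξ x k - dualStep H ξ y k) -
          ∑' m, H m * (x (k + 2 + m) - y (k + 2 + m)) := by
      simp only [mul_sub]
      rw [Summable.tsum_sub (summable_mul_bounded hH fun m => hx _)
        (summable_mul_bounded hH fun m => hy _), dualStep, dualStep]
      ring
    rw [e]
    refine (norm_sub_le_max _ _).trans (max_le ?_ ?_)
    · rw [norm_mul]
      exact (mul_le_of_le_one_left (norm_nonneg _) (norm_sub_natCast_le hξ k)).trans ih
    · refine IsUltrametricDist.norm_tsum_le_of_forall_le fun m => ?_
      rw [norm_mul]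
      exact mul_le_mul (hb m) (hxy _) (norm_nonneg _) (inv_p_pos p).le

/-- The iteration is a contraction of the space of bounded sequences, so the recursion has a
bounded solution although each term involves all the later ones. -/
lemma exists_dualStep_eq {H : ℕ → ℂ_[p]} {ξ : ℂ_[p]} (hξ : ‖ξ‖ ≤ 1)
    (hH : Filter.Tendsto H Filter.atTop (nhds 0)) (hb : ∀ m, ‖H m‖ ≤ (p : ℝ)⁻¹) :
    ∃ q : ℕ → ℂ_[p], (∀ k, ‖q k‖ ≤ 1) ∧ dualStep H ξ q = q := by
  let Φ : (BoundedContinuousFunction ℕ ℂ_[p]) → BoundedContinuousFunction ℕ ℂ_[p] := fun x =>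
    BoundedContinuousFunction.ofNormedAddCommGroupDiscrete (dualStep H ξ x)
      (max 1 ((p : ℝ)⁻¹ * ‖x‖)) (norm_dualStep_le hξ hb fun m => x.norm_coe_le_norm m)
  have hΦ : ContractingWith (⟨(p : ℝ)⁻¹, (inv_p_pos p).le⟩ : NNReal) Φ := by
    refine ⟨inv_p_lt_one p, LipschitzWith.of_dist_le_mul fun x y => ?_⟩
    refine (BoundedContinuousFunction.dist_le (mul_nonneg (inv_p_pos p).le dist_nonneg)).2
      fun k => ?_
    rw [dist_eq_norm]
    refine norm_dualStep_sub_le hξ hH hb (fun m => x.norm_coe_le_norm m)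
      (fun m => y.norm_coe_le_norm m) (fun m => ?_) k
    rw [← dist_eq_norm]
    exact BoundedContinuousFunction.dist_coe_le_dist m
  have hfix := hΦ.fixedPoint_isFixedPt
  set q := ContractingWith.fixedPoint Φ hΦ
  have hq : dualStep H ξ q = q := congrArg (fun x : BoundedContinuousFunction ℕ ℂ_[p] => ⇑x) hfix
  refine ⟨q, fun k => ?_, hq⟩
  have h1 : ‖q‖ ≤ max 1 ((p : ℝ)⁻¹ * ‖q‖) := by
    refine (BoundedContinuousFunction.norm_le (le_max_of_le_left zero_le_one)).2 fun k => ?_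
    rw [← congrFun hq k]
    exact norm_dualStep_le hξ hb (fun m => q.norm_coe_le_norm m) k
  rcases le_max_iff.1 h1 with h2 | h2
  · exact (q.norm_coe_le_norm k).trans h2
  · have : ‖q‖ ≤ 0 := by nlinarith [inv_p_lt_one p, norm_nonneg q]
    exact (q.norm_coe_le_norm k).trans (this.trans zero_le_one)

variable {n a : ℕ} {g : PadicAlgCl p} {h : ℕ → PadicAlgCl p}

/-- For integral `ξ` there is a sequence `q` on which multiplication by `ξ` is the transpose of
`y ∂/∂y + h(y)` on power series in one variable. For `h(y) = y` it would be
`q_k = ξ (ξ - 1) ⋯ (ξ - k + 1)`, and in general this holds modulo `p`. -/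
lemma IsTwist.exists_dual (hh : IsTwist p a g h) {ξ : PadicAlgCl p} (hξ : ‖ξ‖ ≤ 1) :
    ∃ q : ℕ → ℂ_[p], (∀ k, ‖q k‖ ≤ 1) ∧
      (∀ k, HasSum (fun m => algebraMap _ ℂ_[p] (h m) * q (k + m))
        ((algebraMap _ ℂ_[p] ξ - k) * q k)) ∧
      ∀ k, ‖q k - algebraMap _ ℂ_[p] ((descPochhammer (PadicAlgCl p) k).eval ξ)‖ ≤ (p : ℝ)⁻¹ := by
  set H : ℕ → ℂ_[p] := fun m => algebraMap _ ℂ_[p] (h (m + 2))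
  have hHn : ∀ m, ‖H m‖ ≤ (p : ℝ)⁻¹ ^ (m + 1) := fun m => by
    rw [norm_algebraMap']; exact hh.norm_succ_le (m + 1)
  have hb : ∀ m, ‖H m‖ ≤ (p : ℝ)⁻¹ := fun m =>
    (hHn m).trans (pow_le_of_le_one (inv_p_pos p).le (inv_p_lt_one p).le (by omega))
  have hH : Filter.Tendsto H Filter.atTop (nhds 0) := by
    rw [tendsto_zero_iff_norm_tendsto_zero]
    refine squeeze_zero (fun _ => norm_nonneg _) hHn ?_
    exact (tendsto_pow_atTop_nhds_zero_of_lt_one (inv_p_pos p).le (inv_p_lt_one p)).comp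
      (Filter.tendsto_add_atTop_nat 1)
  have hξ' : ‖algebraMap _ ℂ_[p] ξ‖ ≤ 1 := by rwa [norm_algebraMap']
  obtain ⟨q, hq1, hq⟩ := exists_dualStep_eq hξ' hH hb
  have hrec : ∀ k, q (k + 1) = (algebraMap _ ℂ_[p] ξ - k) * q k - ∑' m, H m * q (k + 2 + m) := by
    intro k
    conv_lhs => rw [← hq]
    rw [dualStep, hq]
  have hq0 : q 0 = 1 := by rw [← hq, dualStep]
  refine ⟨q, hq1, fun k => ?_, fun k => ?_⟩
  · rw [← hasSum_nat_add_iff' 2]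
    have h1 := (summable_mul_bounded hH (x := fun m => q (k + 2 + m)) fun m => hq1 _).hasSum
    have e1 : (fun m => algebraMap _ ℂ_[p] (h (m + 2)) * q (k + (m + 2))) =
        fun m => H m * q (k + 2 + m) := by
      funext m
      rw [show k + (m + 2) = k + 2 + m by ring]
    have e2 : (algebraMap _ ℂ_[p] ξ - k) * q k -
        ∑ i ∈ Finset.range 2, algebraMap _ ℂ_[p] (h i) * q (k + i) =
          ∑' m, H m * q (k + 2 + m) := by
      rw [Finset.sum_range_succ, Finset.sum_range_one, hh.zero, hh.one, map_zero, map_one, hrec]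
      ring
    rw [e1, e2]
    exact h1
  · induction k with
    | zero =>
      rw [hq0, descPochhammer_zero, Polynomial.eval_one, map_one, sub_self, norm_zero]
      exact (inv_p_pos p).le
    | succ k ih =>
      have e : q (k + 1) - algebraMap _ ℂ_[p] ((descPochhammer (PadicAlgCl p) (k + 1)).eval ξ) =
          (algebraMap _ ℂ_[p] ξ - k) *
            (q k - algebraMap _ ℂ_[p] ((descPochhammer (PadicAlgCl p) k).eval ξ)) -
          ∑' m, H m * q (k + 2 + m) := by
        rw [descPochhammer_succ_eval, map_mul, map_sub, map_natCast, hrec]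
        ring
      rw [e]
      refine (norm_sub_le_max _ _).trans (max_le ?_ ?_)
      · rw [norm_mul]
        exact (mul_le_of_le_one_left (norm_nonneg _) (norm_sub_natCast_le hξ' k)).trans ih
      · refine IsUltrametricDist.norm_tsum_le_of_forall_le fun m => ?_
        rw [norm_mul]
        exact (mul_le_of_le_one_right (norm_nonneg _) (hq1 _)).trans (hb m)

lemma norm_prod_le_one {ι : Type*} (s : Finset ι) {x : ι → ℂ_[p]} (hx : ∀ i, ‖x i‖ ≤ 1) :
    ‖∏ i ∈ s, x i‖ ≤ 1 := by
  rw [norm_prod]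
  exact Finset.prod_le_one (fun _ _ => norm_nonneg _) fun i _ => hx i

lemma norm_prod_sub_prod_le {ι : Type*} (s : Finset ι) {x y : ι → ℂ_[p]} {η : ℝ} (hη : 0 ≤ η)
    (hx : ∀ i, ‖x i‖ ≤ 1) (hy : ∀ i, ‖y i‖ ≤ 1) (hxy : ∀ i, ‖x i - y i‖ ≤ η) :
    ‖∏ i ∈ s, x i - ∏ i ∈ s, y i‖ ≤ η := by
  classical
  induction s using Finset.induction_on with
  | empty => simpa using hη
  | insert i s hi ih =>
    rw [Finset.prod_insert hi, Finset.prod_insert hi,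
      show x i * ∏ i ∈ s, x i - y i * ∏ i ∈ s, y i =
        x i * (∏ i ∈ s, x i - ∏ i ∈ s, y i) + (x i - y i) * ∏ i ∈ s, y i by ring]
    refine (IsUltrametricDist.norm_add_le_max _ _).trans (max_le ?_ ?_)
    · rw [norm_mul]
      exact (mul_le_of_le_one_left (norm_nonneg _) (hx i)).trans ih
    · rw [norm_mul]
      exact (mul_le_of_le_one_right (norm_nonneg _) (norm_prod_le_one s hy)).trans (hxy i)

lemma summable_of_small {ι : Type*} {x : ι → ℂ_[p]}
    (hx : ∀ η : ℝ, 0 < η → ∃ s : Set ι, s.Finite ∧ ∀ i ∉ s, ‖x i‖ ≤ η) : Summable x := by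
  refine NonarchimedeanAddGroup.summable_of_tendsto_cofinite_zero ?_
  rw [Metric.tendsto_nhds]
  intro ε hε
  obtain ⟨s, hs, hs'⟩ := hx (ε / 2) (half_pos hε)
  rw [Filter.eventually_cofinite]
  refine hs.subset fun i hi => by_contra fun his => hi ?_
  rw [dist_zero_right]
  exact (hs' i his).trans_lt (half_lt_self hε)

/-- The pairs of an exponent `κ` and of some `m ≤ κ_i` correspond to the pairs of an arbitrary
exponent `κ - m e_i` and an arbitrary `m`. -/
def shearEquiv (n : ℕ) (i : Fin (n + 1)) :
    (Σ κ : Fin (n + 1) →₀ ℕ, {m // m ∈ Finset.range (κ i + 1)}) ≃ (Fin (n + 1) →₀ ℕ) × ℕ where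
  toFun x := (x.1 - single i x.2.1, x.2.1)
  invFun y := ⟨y.1 + single i y.2, y.2, by simp⟩
  left_inv := by
    rintro ⟨κ, m, hm⟩
    have h1 : κ - single i m + single i m = κ :=
      tsub_add_cancel_of_le (single_le_of_mem_range hm)
    refine Sigma.ext h1 ?_
    simp only
    congr 1
    · rw [h1]
    · exact proof_irrel_heq _ _
  right_inv := by
    rintro ⟨κ, m⟩
    simp

/-- The functional `f ↦ ∑ κ, f_κ q_{κ_0} ⋯ q_{κ_n}` turns every operator `y_i ∂/∂y_i + h(y_i)` into
multiplication by `ξ`. -/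
lemma hasSum_coordOp (hh : IsTwist p a g h) {ξ : ℂ_[p]} {q : ℕ → ℂ_[p]}
    (hq1 : ∀ k, ‖q k‖ ≤ 1)
    (hq : ∀ k, HasSum (fun m => algebraMap _ ℂ_[p] (h m) * q (k + m)) ((ξ - k) * q k))
    {f : Ser p n} (hf : IsRestricted p n a g f) (i : Fin (n + 1)) :
    ∃ S : ℂ_[p], HasSum (fun κ => algebraMap _ ℂ_[p] (f κ) * ∏ j, q (κ j)) S ∧
      HasSum (fun κ => algebraMap _ ℂ_[p] (coordOp h i f κ) * ∏ j, q (κ j)) (ξ * S) := by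
  have hχ : ∀ κ : Fin (n + 1) →₀ ℕ, ‖∏ j, q (κ j)‖ ≤ 1 := fun κ =>
    norm_prod_le_one _ fun j => hq1 _
  have hsum : ∀ f : Ser p n, IsRestricted p n a g f →
      Summable fun κ => algebraMap _ ℂ_[p] (f κ) * ∏ j, q (κ j) := by
    intro f hf
    refine summable_of_small fun η hη => ?_
    obtain ⟨D, hD⟩ := hf.small η hη
    refine ⟨_, finite_degree_lt n D, fun κ hκ => ?_⟩
    rw [norm_mul, norm_algebraMap']
    exact (mul_le_of_le_one_right (norm_nonneg _) (hχ κ)).trans (hD κ (not_lt.1 hκ))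
  have hf1 : IsRestricted p n a g (fun κ => (κ i : PadicAlgCl p) * f κ) := by
    refine ⟨fun κ => mul_mem (natCast_mem _ _) (hf.mem κ), fun η hη => ?_⟩
    obtain ⟨D, hD⟩ := hf.small η hη
    refine ⟨D, fun κ hκ => ?_⟩
    rw [norm_mul]
    refine (mul_le_of_le_one_left (norm_nonneg _) ?_).trans (hD κ hκ)
    exact_mod_cast norm_intCast_le p (κ i)
  obtain ⟨S, hS⟩ := hsum f hf
  obtain ⟨S₁, hS₁⟩ := hsum _ hf1
  refine ⟨S, hS, ?_⟩
  -- the double series over all `κ` and `m`, summed in two ways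
  set F : (Fin (n + 1) →₀ ℕ) × ℕ → ℂ_[p] := fun y =>
    algebraMap _ ℂ_[p] (f y.1) * (algebraMap _ ℂ_[p] (h y.2) * ∏ j, q ((y.1 + single i y.2) j))
  have hF : Summable F := by
    refine summable_of_small fun η hη => ?_
    obtain ⟨D, hD⟩ := hf.small η hη
    obtain ⟨M, hM⟩ := hh.small hη
    refine ⟨_, (finite_degree_lt n D).prod (Set.finite_lt_nat M), fun y hy => ?_⟩
    rw [norm_mul, norm_mul, norm_algebraMap', norm_algebraMap']
    rw [Set.mem_prod, not_and_or] at hy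
    rcases hy with hy | hy
    · refine (mul_le_of_le_one_right (norm_nonneg _) ?_).trans (hD _ (not_lt.1 hy))
      exact mul_le_one₀ (hh.mem _).2 (norm_nonneg _) (hχ _)
    · refine (mul_le_of_le_one_left (by positivity) (hf.mem _).2).trans ?_
      exact (mul_le_of_le_one_right (norm_nonneg _) (hχ _)).trans (hM _ (not_lt.1 hy))
  have h1 : ∀ κ : Fin (n + 1) →₀ ℕ, HasSum (fun m => F (κ, m))
      (ξ * (algebraMap _ ℂ_[p] (f κ) * ∏ j, q (κ j)) -
        algebraMap _ ℂ_[p] ((κ i : PadicAlgCl p) * f κ) * ∏ j, q (κ j)) := by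
    intro κ
    have e : ∀ m, ∏ j, q ((κ + single i m) j) =
        q (κ i + m) * ∏ j ∈ Finset.univ.erase i, q (κ j) := by
      intro m
      rw [← Finset.mul_prod_erase _ _ (Finset.mem_univ i)]
      congr 1
      · simp
      · refine Finset.prod_congr rfl fun j hj => ?_
        rw [Finsupp.add_apply, Finsupp.single_eq_of_ne (Finset.ne_of_mem_erase hj), add_zero]
    have h2 := ((hq (κ i)).mul_right (∏ j ∈ Finset.univ.erase i, q (κ j))).mul_left
      (algebraMap _ ℂ_[p] (f κ))
    have e1 : (fun m => F (κ, m)) = fun m => algebraMap _ ℂ_[p] (f κ) *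
        (algebraMap _ ℂ_[p] (h m) * q (κ i + m) * ∏ j ∈ Finset.univ.erase i, q (κ j)) := by
      funext m
      simp only [F, e]
      ring
    have e2 : ξ * (algebraMap _ ℂ_[p] (f κ) * ∏ j, q (κ j)) -
        algebraMap _ ℂ_[p] ((κ i : PadicAlgCl p) * f κ) * ∏ j, q (κ j) =
        algebraMap _ ℂ_[p] (f κ) *
          ((ξ - (κ i : ℕ)) * q (κ i) * ∏ j ∈ Finset.univ.erase i, q (κ j)) := by
      rw [← Finset.mul_prod_erase _ _ (Finset.mem_univ i), map_mul, map_natCast]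
      ring
    rw [e1, e2]
    exact h2
  have h2 := hF.hasSum.prod_fiberwise h1
  have h3 : ∑' y, F y = ξ * S - S₁ := h2.unique ((hS.mul_left ξ).sub hS₁)
  have h4 := ((shearEquiv n i).hasSum_iff.2 hF.hasSum).sigma fun κ => hasSum_fintype _
  rw [h3] at h4
  have h5 := hS₁.add h4
  rw [add_sub_cancel] at h5
  refine (congrArg (HasSum · (ξ * S)) (funext fun κ => ?_)).mpr h5
  rw [coordOp_apply, map_add, add_mul, map_sum, Finset.sum_mul, ← Finset.sum_coe_sort]
  congr 1
  refine Finset.sum_congr rfl fun m _ => ?_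
  have hle : single i m.1 ≤ κ := single_le_of_mem_range m.2
  simp only [F, shearEquiv, Function.comp_apply, Equiv.coe_fn_mk, tsub_add_cancel_of_le hle,
    map_mul]
  ring

lemma hasSum_diffOp_zero (hh : IsTwist p a g h) {ξ : ℂ_[p]} {q : ℕ → ℂ_[p]}
    (hq1 : ∀ k, ‖q k‖ ≤ 1)
    (hq : ∀ k, HasSum (fun m => algebraMap _ ℂ_[p] (h m) * q (k + m)) ((ξ - k) * q k))
    {f : Ser p n} (hf : IsRestricted p n a g f) (l : Fin n) :
    HasSum (fun κ => algebraMap _ ℂ_[p] (diffOp h l f κ) * ∏ j, q (κ j)) 0 := by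
  obtain ⟨S, hS, h1⟩ := hasSum_coordOp hh hq1 hq hf l.succ
  obtain ⟨S', hS', h2⟩ := hasSum_coordOp hh hq1 hq hf 0
  rw [hS.unique hS'] at h1
  have := h1.sub h2
  rw [sub_self] at this
  have e : (fun κ => algebraMap _ ℂ_[p] (diffOp h l f κ) * ∏ j, q (κ j)) = fun κ =>
      algebraMap _ ℂ_[p] (coordOp h l.succ f κ) * ∏ j, q (κ j) -
        algebraMap _ ℂ_[p] (coordOp h 0 f κ) * ∏ j, q (κ j) := by
    funext κ
    rw [diffOp, LinearMap.sub_apply, Pi.sub_apply, map_sub, sub_mul]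
  rw [e]
  exact this

end

/-! ### Independence of the basis monomials -/

section
variable {p n a : ℕ} [Fact p.Prime] {g : PadicAlgCl p} {h : ℕ → PadicAlgCl p}

/-- The monic polynomial to which the functional of `ξ` maps the basis monomial of degree `d`,
modulo `p`. -/
def stairPoly (p n d : ℕ) [Fact p.Prime] : Polynomial (PadicAlgCl p) :=
  ∏ i, descPochhammer (PadicAlgCl p) (stairExp n d i)

lemma stairPoly_monic (n d : ℕ) : (stairPoly p n d).Monic :=
  Polynomial.monic_prod_of_monic _ _ fun _ _ => monic_descPochhammer _ _

lemma stairPoly_natDegree (n d : ℕ) : (stairPoly p n d).natDegree = d := by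
  rw [stairPoly, Polynomial.natDegree_prod_of_monic _ _ fun _ _ => monic_descPochhammer _ _]
  simp only [descPochhammer_natDegree]
  rw [← Finsupp.degree_eq_sum, degree_stairExp]

lemma stairPoly_degree (n d : ℕ) : (stairPoly p n d).degree = d := by
  rw [Polynomial.degree_eq_natDegree (stairPoly_monic n d).ne_zero, stairPoly_natDegree]

lemma norm_eval_descPochhammer {ξ : PadicAlgCl p} (hξ : 1 < ‖ξ‖) (k : ℕ) :
    ‖(descPochhammer (PadicAlgCl p) k).eval ξ‖ = ‖ξ‖ ^ k := by
  induction k with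
  | zero => rw [descPochhammer_zero, Polynomial.eval_one, norm_one, pow_zero]
  | succ k ih =>
    rw [descPochhammer_succ_eval, norm_mul, ih, pow_succ]
    congr 1
    have h1 : ‖-(k : PadicAlgCl p)‖ < ‖ξ‖ := by
      rw [norm_neg]
      exact (IsUltrametricDist.norm_natCast_le_one _ _).trans_lt hξ
    rw [sub_eq_add_neg, IsUltrametricDist.norm_add_eq_max_of_norm_ne_norm h1.ne',
      max_eq_left h1.le]

lemma norm_eval_stairPoly {ξ : PadicAlgCl p} (hξ : 1 < ‖ξ‖) (n d : ℕ) :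
    ‖(stairPoly p n d).eval ξ‖ = ‖ξ‖ ^ d := by
  rw [stairPoly, Polynomial.eval_prod, norm_prod]
  simp only [norm_eval_descPochhammer hξ]
  rw [Finset.prod_pow_eq_pow_sum, ← Finsupp.degree_eq_sum, degree_stairExp]

/-- A combination of the polynomials `stairPoly` with integral coefficients and leading
coefficient `1` takes the value `1` at an integral point. -/
lemma exists_eval_sum_stairPoly_eq_one (n : ℕ) {b : ℕ → PadicAlgCl p} {d : ℕ} (hbd : b d = 1)
    (hb : ∀ i < d, ‖b i‖ ≤ 1) : ∃ ξ : PadicAlgCl p, ‖ξ‖ ≤ 1 ∧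
      ∑ i ∈ Finset.range (d + 1), b i * (stairPoly p n i).eval ξ = 1 := by
  rcases Nat.eq_zero_or_pos d with rfl | hd
  · refine ⟨0, by simp, ?_⟩
    have h1 : stairPoly p n 0 = 1 :=
      Polynomial.eq_one_of_monic_natDegree_zero (stairPoly_monic n 0) (stairPoly_natDegree n 0)
    rw [Finset.sum_range_one, hbd, h1, Polynomial.eval_one, one_mul]
  set Q : Polynomial (PadicAlgCl p) :=
    ∑ i ∈ Finset.range d, Polynomial.C (b i) * stairPoly p n i - 1
  have hQ : Q.degree < d := by
    rw [← Polynomial.mem_degreeLT]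
    refine sub_mem (sum_mem fun i hi => ?_) ?_
    · rw [Polynomial.mem_degreeLT]
      rw [← Polynomial.smul_eq_C_mul]
      refine (Polynomial.degree_smul_le _ _).trans_lt ?_
      rw [stairPoly_degree]
      exact_mod_cast Finset.mem_range.1 hi
    · rw [Polynomial.mem_degreeLT, Polynomial.degree_one]
      exact_mod_cast hd
  obtain ⟨ξ, hξ⟩ := IsAlgClosed.exists_root (stairPoly p n d + Q) (by
    rw [Polynomial.degree_add_eq_left_of_degree_lt (by rwa [stairPoly_degree]), stairPoly_degree]
    exact_mod_cast hd.ne')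
  have hsum : (stairPoly p n d).eval ξ +
      (∑ i ∈ Finset.range d, b i * (stairPoly p n i).eval ξ - 1) = 0 := by
    have := hξ
    rw [Polynomial.IsRoot.def, Polynomial.eval_add, Polynomial.eval_sub,
      Polynomial.eval_finsetSum, Polynomial.eval_one] at this
    simpa only [Polynomial.eval_mul, Polynomial.eval_C] using this
  refine ⟨ξ, le_of_not_gt fun hξ1 => ?_, ?_⟩
  · have h1 : ‖(stairPoly p n d).eval ξ‖ ≤ ‖ξ‖ ^ (d - 1) := by
      rw [eq_neg_of_add_eq_zero_left hsum, norm_neg]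
      rw [sub_eq_add_neg]
      refine (IsUltrametricDist.norm_add_le_max _ _).trans (max_le
        (IsUltrametricDist.norm_sum_le_of_forall_le_of_nonneg (by positivity) fun i hi => ?_) ?_)
      · have hi' := Finset.mem_range.1 hi
        rw [norm_mul, norm_eval_stairPoly hξ1]
        exact (mul_le_of_le_one_left (by positivity) (hb i hi')).trans
          (pow_le_pow_right₀ hξ1.le (by omega))
      · rw [norm_neg, norm_one]
        exact one_le_pow₀ hξ1.le
    rw [norm_eval_stairPoly hξ1] at h1
    exact absurd h1 (not_le.2 (pow_lt_pow_right₀ hξ1 (by omega)))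
  · rw [Finset.sum_range_succ, hbd]
    linear_combination hsum

lemma stairExp_injective (n : ℕ) : Function.Injective (stairExp n) := fun d d' hd => by
  rw [← degree_stairExp n d, hd, degree_stairExp]

/-- No nontrivial null combination of the basis monomials is a boundary. The functionals of the
points `ξ` kill the boundaries, and modulo `p` they send the combination to the values of a
polynomial whose leading coefficient is a unit, after a suitable normalization. -/
theorem eq_zero_of_stairSer_eq (hh : IsTwist p a g h) {c : ℕ → PadicAlgCl p}
    (hc : ∀ η : ℝ, 0 < η → ∃ D : ℕ, ∀ d, D ≤ d → ‖c d‖ ≤ η) {G : Fin n → Ser p n}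
    (hG : ∀ l, IsRestricted p n a g (G l)) (he : stairSer c = ∑ l, diffOp h l (G l)) : c = 0 := by
  by_contra hne
  obtain ⟨d1, hd1⟩ := Function.ne_iff.1 hne
  have hpos1 : 0 < ‖c d1‖ := norm_pos_iff.2 hd1
  -- the last index `d0` at which the norm is maximal
  obtain ⟨d0, hmax, hlast⟩ : ∃ d0, (∀ d, ‖c d‖ ≤ ‖c d0‖) ∧ ∀ d, d0 < d → ‖c d‖ < ‖c d0‖ := by
    obtain ⟨D, hD⟩ := hc (‖c d1‖ / 2) (half_pos hpos1)
    have hd1D : d1 < D := lt_of_not_ge fun hge => by linarith [hD d1 hge]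
    obtain ⟨d0, -, hd0⟩ := Finset.exists_max_image (Finset.range D)
      (fun d => toLex (‖c d‖, d)) ⟨d1, Finset.mem_range.2 hd1D⟩
    have h1 : ‖c d1‖ ≤ ‖c d0‖ := by
      have := Prod.Lex.toLex_le_toLex.1 (hd0 d1 (Finset.mem_range.2 hd1D))
      rcases this with h | h
      · exact h.le
      · exact h.1.le
    have h2 : ∀ d, D ≤ d → ‖c d‖ < ‖c d0‖ := fun d hd => by linarith [hD d hd]
    refine ⟨d0, fun d => ?_, fun d hd => ?_⟩
    · rcases lt_or_ge d D with hdD | hdD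
      · rcases Prod.Lex.toLex_le_toLex.1 (hd0 d (Finset.mem_range.2 hdD)) with h | h
        · exact h.le
        · exact h.1.le
      · exact (h2 d hdD).le
    · rcases lt_or_ge d D with hdD | hdD
      · rcases Prod.Lex.toLex_le_toLex.1 (hd0 d (Finset.mem_range.2 hdD)) with h | h
        · exact h
        · exact absurd h.2 (not_le.2 hd)
      · exact h2 d hdD
  set A := ‖c d0‖
  have hA : 0 < A := hpos1.trans_le (hmax d1)
  have hc0 : c d0 ≠ 0 := norm_pos_iff.1 hA
  obtain ⟨ξ, hξ1, hξ⟩ := exists_eval_sum_stairPoly_eq_one n (b := fun i => c i / c d0) (d := d0)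
    (div_self hc0) (fun i _ => by rw [norm_div]; exact div_le_one_of_le₀ (hmax i) hA.le)
  obtain ⟨q, hq1, hq, hqP⟩ := hh.exists_dual hξ1
  have h0 : HasSum (fun κ => algebraMap _ ℂ_[p] ((stairSer c : Ser p n) κ) * ∏ j, q (κ j)) 0 := by
    have h1 := hasSum_sum fun l (_ : l ∈ Finset.univ) => hasSum_diffOp_zero hh hq1 hq (hG l) l
    rw [Finset.sum_const_zero] at h1
    refine (congrArg (HasSum · 0) (funext fun κ => ?_)).mpr h1
    rw [he, Finset.sum_apply, map_sum, Finset.sum_mul]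
  -- the values of the functional and of the polynomials at the basis monomials
  set χ : ℕ → ℂ_[p] := fun d => ∏ j, q (stairExp n d j)
  have hχ : ∀ d, ‖χ d‖ ≤ 1 := fun d => norm_prod_le_one _ fun j => hq1 _
  have h1 : HasSum (fun d => algebraMap _ ℂ_[p] (c d) * χ d) 0 := by
    rw [← (stairExp_injective n).hasSum_iff] at h0
    · refine (congrArg (HasSum · 0) (funext fun d => ?_)).mpr h0
      rw [Function.comp_apply, stairSer_apply, degree_stairExp, if_pos rfl]
    · intro κ hκ
      rw [stairSer_apply, if_neg (fun hκ' => hκ ⟨_, hκ'.symm⟩), map_zero, zero_mul]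
  set P : ℕ → ℂ_[p] := fun d => algebraMap _ ℂ_[p] ((stairPoly p n d).eval ξ)
  have hP : ∀ d, ‖χ d - P d‖ ≤ (p : ℝ)⁻¹ := by
    intro d
    have : P d = ∏ j, algebraMap _ ℂ_[p]
        ((descPochhammer (PadicAlgCl p) (stairExp n d j)).eval ξ) := by
      simp only [P]
      rw [stairPoly, Polynomial.eval_prod, map_prod]
    rw [this]
    refine norm_prod_sub_prod_le _ (inv_p_pos p).le (fun j => hq1 _) (fun j => ?_) fun j => hqP _
    have h2 := norm_sub_le_max (q (stairExp n d j)) (q (stairExp n d j) - algebraMap _ ℂ_[p]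
        ((descPochhammer (PadicAlgCl p) (stairExp n d j)).eval ξ))
    rw [sub_sub_cancel] at h2
    exact h2.trans (max_le (hq1 _) ((hqP _).trans (inv_p_lt_one p).le))
  have hsumP : ∑ d ∈ Finset.range (d0 + 1), algebraMap _ ℂ_[p] (c d) * P d =
      algebraMap _ ℂ_[p] (c d0) := by
    have := congrArg (fun x => algebraMap _ ℂ_[p] (c d0 * x)) hξ
    simp only [mul_one] at this
    rw [← this, Finset.mul_sum, map_sum]
    refine Finset.sum_congr rfl fun i _ => ?_
    rw [← mul_assoc, mul_div_cancel₀ _ hc0, map_mul]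
  obtain ⟨D, hD⟩ := hc (A / 2) (half_pos hA)
  set M := max D (d0 + 1)
  -- the functional vanishes on the combination, and it is congruent to `c d0` by the choice of `ξ`
  have htail : ‖∑ d ∈ Finset.range M, algebraMap _ ℂ_[p] (c d) * χ d‖ < A := by
    have h2 := (hasSum_nat_add_iff' M).2 h1
    rw [zero_sub] at h2
    rw [← norm_neg, ← h2.tsum_eq]
    refine lt_of_le_of_lt (IsUltrametricDist.norm_tsum_le_of_forall_le fun d => ?_)
      (half_lt_self hA)
    rw [norm_mul, norm_algebraMap']
    exact (mul_le_of_le_one_right (norm_nonneg _) (hχ _)).trans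
      (hD _ ((le_max_left D (d0 + 1)).trans (Nat.le_add_left _ _)))
  have hdiff : ‖∑ d ∈ Finset.range M, (algebraMap _ ℂ_[p] (c d) * χ d -
      if d < d0 + 1 then algebraMap _ ℂ_[p] (c d) * P d else 0)‖ < A := by
    obtain ⟨d, -, hd⟩ := IsUltrametricDist.exists_norm_finsetSum_le (Finset.range M)
      (fun d => algebraMap _ ℂ_[p] (c d) * χ d -
        if d < d0 + 1 then algebraMap _ ℂ_[p] (c d) * P d else 0)
    refine hd.trans_lt ?_
    split_ifs with hlt
    · rw [← mul_sub, norm_mul, norm_algebraMap']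
      calc ‖c d‖ * ‖χ d - P d‖ ≤ A * (p : ℝ)⁻¹ :=
            mul_le_mul (hmax d) (hP d) (norm_nonneg _) hA.le
        _ < A := mul_lt_of_lt_one_right hA (inv_p_lt_one p)
    · rw [sub_zero, norm_mul, norm_algebraMap']
      exact (mul_le_of_le_one_right (norm_nonneg _) (hχ _)).trans_lt (hlast d (by omega))
  have hfilter : ∑ d ∈ Finset.range M,
      (if d < d0 + 1 then algebraMap _ ℂ_[p] (c d) * P d else 0) =
      algebraMap _ ℂ_[p] (c d0) := by
    rw [← hsumP, ← Finset.sum_filter]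
    congr 1
    ext d
    simp only [Finset.mem_filter, Finset.mem_range]
    exact ⟨fun h => h.2, fun h => ⟨h.trans_le (le_max_right _ _), h⟩⟩
  rw [Finset.sum_sub_distrib, hfilter] at hdiff
  have h2 := norm_sub_le_max (∑ d ∈ Finset.range M, algebraMap _ ℂ_[p] (c d) * χ d)
    (∑ d ∈ Finset.range M, algebraMap _ ℂ_[p] (c d) * χ d - algebraMap _ ℂ_[p] (c d0))
  rw [sub_sub_cancel, norm_algebraMap'] at h2
  exact absurd (h2.trans_lt (max_lt htail hdiff)) (lt_irrefl _)

end

/-! ### Integrality of the Artin–Hasse series -/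

section
open PowerSeries
variable {p : ℕ} [hp : Fact p.Prime]

/-- The indicator of the powers of `p`. -/
def powInd (p m : ℕ) : ℕ := if p ^ Nat.log p m = m then 1 else 0

lemma powInd_pow (i : ℕ) : powInd p (p ^ i) = 1 := by
  rw [powInd, Nat.log_pow hp.1.one_lt, if_pos rfl]

lemma powInd_of_ne {p m : ℕ} (h : ∀ i, m ≠ p ^ i) : powInd p m = 0 := if_neg (h _).symm

lemma powInd_eq_add (m : ℕ) :
    powInd p m = (if p ∣ m then powInd p (m / p) else 0) + if m = 1 then 1 else 0 := by
  have hp1 := hp.1.one_lt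
  by_cases h : ∃ i, m = p ^ i
  · obtain ⟨i, rfl⟩ := h
    rw [powInd_pow]
    rcases i with _ | i
    · rw [pow_zero, if_neg (by rw [Nat.dvd_one]; omega), if_pos rfl]
    · rw [if_pos (dvd_pow_self p i.succ_ne_zero), pow_succ, Nat.mul_div_cancel _ hp.1.pos,
        powInd_pow, ← pow_succ, if_neg (Nat.one_lt_pow i.succ_ne_zero hp1).ne']
  · rw [not_exists] at h
    have h1 : m ≠ 1 := by simpa using h 0
    rw [powInd_of_ne h, if_neg h1]
    split_ifs with hd
    · obtain ⟨k, rfl⟩ := hd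
      rw [Nat.mul_div_cancel_left _ hp.1.pos, powInd_of_ne]
      rintro i rfl
      exact h (i + 1) (by rw [pow_succ, mul_comm])
    · rfl

/-- The logarithmic derivative `∑ j, T ^ (p ^ j - 1)` of the Artin–Hasse series. -/
def artinHasseLogDeriv (p : ℕ) : PowerSeries ℚ := PowerSeries.mk fun m => (powInd p (m + 1) : ℚ)

lemma artinHasse_exponent_eq : (PowerSeries.mk fun m : ℕ =>
    open Classical in if ∃ j : ℕ, m = p ^ j then (1 / m : ℚ) else 0) =
    PowerSeries.mk fun m => (powInd p m : ℚ) / m := by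
  ext m
  rw [coeff_mk, coeff_mk]
  split_ifs with h
  · obtain ⟨j, rfl⟩ := h
    rw [powInd_pow, Nat.cast_one]
  · rw [powInd_of_ne (not_exists.1 h), Nat.cast_zero, zero_div]

lemma hasSubst_artinHasse_exponent {p : ℕ} :
    HasSubst (PowerSeries.mk fun m => (powInd p m : ℚ) / m) := by
  refine HasSubst.of_constantCoeff_zero' ?_
  rw [← coeff_zero_eq_constantCoeff_apply, coeff_mk, Nat.cast_zero, div_zero]

lemma derivative_artinHasse : d⁄dX ℚ (artinHasse p) = artinHasseLogDeriv p * artinHasse p := by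
  rw [artinHasse, artinHasse_exponent_eq, derivative_subst hasSubst_artinHasse_exponent,
    derivative_exp, mul_comm]
  congr 1
  ext m
  rw [coeff_derivative, coeff_mk, artinHasseLogDeriv, coeff_mk]
  push_cast
  exact div_mul_cancel₀ _ (by positivity)

lemma constantCoeff_artinHasse : constantCoeff (artinHasse p) = 1 := by
  have h0 : constantCoeff (PowerSeries.mk fun m => (powInd p m : ℚ) / m) = 0 := by
    rw [← coeff_zero_eq_constantCoeff_apply, coeff_mk, Nat.cast_zero, div_zero]
  have h1 := constantCoeff_subst_eq_zero h0 (exp ℚ - 1) (by simp)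
  rw [← coe_substAlgHom hasSubst_artinHasse_exponent, map_sub, map_sub, map_one, map_one,
    sub_eq_zero, coe_substAlgHom] at h1
  rw [artinHasse, artinHasse_exponent_eq]
  exact h1

lemma artinHasse_rec (m : ℕ) : (m : ℚ) * coeff m (artinHasse p) =
    ∑ k ∈ Finset.range (m + 1), (powInd p k : ℚ) * coeff (m - k) (artinHasse p) := by
  rcases m with _ | m
  · have : powInd p 0 = 0 := powInd_of_ne fun i => (pow_pos hp.1.pos i).ne
    simp [this]
  · have h := congrArg (coeff m) (derivative_artinHasse (p := p))
    rw [coeff_derivative, coeff_mul, Finset.Nat.sum_antidiagonal_eq_sum_range_succ_mk] at h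
    have h0 : powInd p 0 = 0 := powInd_of_ne fun i => (pow_pos hp.1.pos i).ne
    rw [Finset.sum_range_succ', h0, Nat.cast_zero, zero_mul, add_zero]
    push_cast
    rw [mul_comm, h]
    refine Finset.sum_congr rfl fun k hk => ?_
    rw [artinHasseLogDeriv, coeff_mk]

lemma eq_of_derivative_eq_mul {F G V : PowerSeries ℚ} (hF : d⁄dX ℚ F = V * F)
    (hG : d⁄dX ℚ G = V * G) (h0 : constantCoeff F = constantCoeff G) : F = G := by
  ext m
  induction m using Nat.strong_induction_on with
  | _ m ih =>
    rcases m with _ | m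
    · simpa using h0
    · have h1 := congrArg (coeff m) hF
      have h2 := congrArg (coeff m) hG
      rw [coeff_derivative, coeff_mul] at h1 h2
      have h3 : ∑ x ∈ Finset.HasAntidiagonal.antidiagonal m, coeff x.1 V * coeff x.2 F =
          ∑ x ∈ Finset.HasAntidiagonal.antidiagonal m, coeff x.1 V * coeff x.2 G := by
        refine Finset.sum_congr rfl fun x hx => ?_
        rw [ih x.2 (by
              have := Finset.HasAntidiagonal.mem_antidiagonal.1 hx
              omega)]
      rw [h3, ← h2] at h1
      exact mul_right_cancel₀ (by positivity) h1

lemma artinHasseLogDeriv_eq : artinHasseLogDeriv p =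
    X ^ (p - 1) * expand p hp.1.ne_zero (artinHasseLogDeriv p) + 1 := by
  have hX : ∀ V : PowerSeries ℚ, X * V = X * (X ^ (p - 1) * expand p hp.1.ne_zero V + 1) ↔
      V = X ^ (p - 1) * expand p hp.1.ne_zero V + 1 := fun V =>
    ⟨fun h => mul_left_cancel₀ X_ne_zero h, fun h => congrArg _ h⟩
  rw [← hX]
  have h1 : X * artinHasseLogDeriv p = PowerSeries.mk fun m => (powInd p m : ℚ) := by
    ext m
    rcases m with _ | m
    · have : powInd p 0 = 0 := powInd_of_ne fun i => (pow_pos hp.1.pos i).ne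
      simp [this]
    · rw [coeff_succ_X_mul, artinHasseLogDeriv, coeff_mk, coeff_mk]
  have h2 : X * (X ^ (p - 1) * expand p hp.1.ne_zero (artinHasseLogDeriv p) + 1) =
      expand p hp.1.ne_zero (X * artinHasseLogDeriv p) + X := by
    rw [map_mul, expand_X, mul_add, mul_one, ← mul_assoc, ← pow_succ',
      Nat.sub_add_cancel hp.1.one_le]
  rw [h2, h1]
  ext m
  rw [map_add, coeff_expand, coeff_mk, coeff_mk, coeff_X, powInd_eq_add]
  push_cast
  split_ifs <;> simp

lemma derivative_expand (f : PowerSeries ℚ) : d⁄dX ℚ (expand p hp.1.ne_zero f) =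
    (p : PowerSeries ℚ) * X ^ (p - 1) * expand p hp.1.ne_zero (d⁄dX ℚ f) := by
  have hs : HasSubst (X ^ p : PowerSeries ℚ) := HasSubst.X_pow hp.1.ne_zero
  rw [expand_apply, expand_apply, derivative_subst hs, derivative_pow, derivative_X]
  ring

/-- Dwork's functional equation `E(T) ^ p = E(T ^ p) exp(p T)` of the Artin–Hasse series. -/
lemma artinHasse_pow : artinHasse p ^ p =
    expand p hp.1.ne_zero (artinHasse p) * rescale (p : ℚ) (exp ℚ) := by
  refine eq_of_derivative_eq_mul (V := (p : PowerSeries ℚ) * artinHasseLogDeriv p) ?_ ?_ ?_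
  · rw [derivative_pow, derivative_artinHasse]
    conv_rhs => rw [← Nat.sub_add_cancel hp.1.one_le, pow_succ]
    rw [Nat.sub_add_cancel hp.1.one_le]
    ring
  · have h1 : d⁄dX ℚ (rescale (p : ℚ) (exp ℚ)) =
        (p : PowerSeries ℚ) * rescale (p : ℚ) (exp ℚ) := by
      ext m
      rw [coeff_derivative, coeff_rescale, coeff_exp, ← map_natCast (C : ℚ →+* PowerSeries ℚ),
        coeff_C_mul, coeff_rescale, coeff_exp]
      simp only [Nat.factorial_succ, eq_ratCast, Rat.cast_id]
      push_cast
      have : (m.factorial : ℚ) ≠ 0 := by positivity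
      field_simp
      ring
    rw [Derivation.leibniz, smul_eq_mul, smul_eq_mul, h1, derivative_expand,
      derivative_artinHasse, map_mul]
    conv_rhs => rw [artinHasseLogDeriv_eq]
    ring
  · rw [map_pow, map_mul, constantCoeff_artinHasse, one_pow,
      ← coeff_zero_eq_constantCoeff_apply, ← coeff_zero_eq_constantCoeff_apply, coeff_rescale,
      coeff_expand, if_pos (dvd_zero p), Nat.zero_div, coeff_zero_eq_constantCoeff_apply,
      constantCoeff_artinHasse]
    simp

lemma norm_pow_div_factorial_le {j : ℕ} (hj : j ≠ 0) :
    ‖(((p : ℚ) ^ j / j.factorial : ℚ) : ℚ_[p])‖ ≤ (p : ℝ)⁻¹ := by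
  have hp0 : (p : ℚ) ≠ 0 := by exact_mod_cast hp.1.ne_zero
  have hj0 : (j.factorial : ℚ) ≠ 0 := by positivity
  rw [Padic.eq_padicNorm, padicNorm.eq_zpow_of_nonzero (div_ne_zero (pow_ne_zero _ hp0) hj0),
    padicValRat.div (pow_ne_zero _ hp0) hj0, padicValRat.pow, padicValRat.self hp.1.one_lt,
    ← zpow_neg_one]
  push_cast
  have h1 : padicValNat p j.factorial < j := lt_of_le_of_lt
    (Nat.le_mul_of_pos_left _ (Nat.sub_pos_of_lt hp.1.one_lt))
    (sub_one_mul_padicValNat_factorial_lt_of_ne_zero p hj)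
  have h2 : padicValRat p (j.factorial : ℚ) = padicValNat p j.factorial := padicValRat.of_nat
  refine zpow_le_zpow_right₀ (by exact_mod_cast hp.1.one_le) ?_
  omega

lemma norm_coeff_expand_sub_pow_le (P : Polynomial ℤ_[p]) (m : ℕ) :
    ‖(Polynomial.expand ℤ_[p] p P - P ^ p).coeff m‖ ≤ (p : ℝ)⁻¹ := by
  have h1 : (Polynomial.expand ℤ_[p] p P - P ^ p).map (PadicInt.toZMod (p := p)) = 0 := by
    rw [Polynomial.map_sub, Polynomial.map_expand, Polynomial.map_pow, ZMod.expand_card, sub_self]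
  have h2 := congrArg (fun Q => Polynomial.coeff Q m) h1
  simp only [Polynomial.coeff_map, Polynomial.coeff_zero] at h2
  rw [← RingHom.mem_ker, PadicInt.ker_toZMod, PadicInt.maximalIdeal_eq_span_p,
    Ideal.mem_span_singleton] at h2
  obtain ⟨y, hy⟩ := h2
  rw [hy, norm_mul, PadicInt.norm_p]
  exact mul_le_of_le_one_right (inv_p_pos p).le (PadicInt.norm_le_one y)

/-- The Artin–Hasse series `E` has `p`-integral coefficients (Dwork's lemma). In degree `m`, compare
`E(T) ^ p` with `E(T ^ p) exp(p T)`: up to terms known to be congruent modulo `p` by induction, the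
difference is `p` times the coefficient of `E`. -/
theorem norm_coeff_artinHasse_le (m : ℕ) : ‖((coeff m (artinHasse p) : ℚ) : ℚ_[p])‖ ≤ 1 := by
  induction m using Nat.strong_induction_on with
  | _ m ih =>
    rcases Nat.eq_zero_or_pos m with rfl | hm
    · rw [coeff_zero_eq_constantCoeff_apply, constantCoeff_artinHasse, Rat.cast_one, norm_one]
    set ι : ℚ →+* ℚ_[p] := algebraMap ℚ ℚ_[p]
    set F : PowerSeries ℚ_[p] := map ι (artinHasse p)
    have hFc : ∀ i, coeff i F = ((coeff i (artinHasse p) : ℚ) : ℚ_[p]) := fun i => by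
      rw [coeff_map]; rfl
    -- the integral truncation of the series below degree `m`
    have hz : ∀ i < m, ∃ z : ℤ_[p], (z : ℚ_[p]) = coeff i F := fun i hi =>
      ⟨⟨coeff i F, by rw [hFc]; exact ih i hi⟩, rfl⟩
    choose! z hz using hz
    set P : Polynomial ℤ_[p] := ∑ i ∈ Finset.range m, Polynomial.monomial i (z i)
    set P' : PowerSeries ℚ_[p] := map PadicInt.Coe.ringHom (P : PowerSeries ℤ_[p])
    have hPc : ∀ i, coeff i P' = if i < m then coeff i F else 0 := by
      intro i
      rw [coeff_map, Polynomial.coeff_coe, Polynomial.finsetSum_coeff]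
      simp only [Polynomial.coeff_monomial]
      rw [Finset.sum_ite_eq']
      simp only [Finset.mem_range]
      split_ifs with hi
      · exact hz i hi
      · exact map_zero _
    have hF0 : constantCoeff F = 1 := by
      rw [← coeff_zero_eq_constantCoeff_apply, hFc, coeff_zero_eq_constantCoeff_apply,
        constantCoeff_artinHasse, Rat.cast_one]
    have hP0 : constantCoeff P' = 1 := by
      rw [← coeff_zero_eq_constantCoeff_apply, hPc, if_pos hm, coeff_zero_eq_constantCoeff_apply,
        hF0]
    have hpow : coeff m (F ^ p) = coeff m (P' ^ p) + p * coeff m F := by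
      obtain ⟨Q, hQ⟩ : (X : PowerSeries ℚ_[p]) ^ m ∣ F - P' := by
        rw [X_pow_dvd_iff]
        intro i hi
        rw [map_sub, hPc, if_pos hi, sub_self]
      have hQ0 : constantCoeff Q = coeff m F := by
        have := congrArg (coeff m) hQ
        rw [map_sub, hPc, if_neg (lt_irrefl m), sub_zero] at this
        rw [this, coeff_X_pow_mul', if_pos le_rfl, Nat.sub_self,
          coeff_zero_eq_constantCoeff_apply]
      have h1 := (Commute.all F P').geom_sum₂_mul p
      have h2 := congrArg (coeff m) h1
      rw [hQ, mul_left_comm, coeff_X_pow_mul', if_pos le_rfl, Nat.sub_self,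
        coeff_zero_eq_constantCoeff_apply, map_mul, hQ0, map_sub, map_sum] at h2
      simp only [map_mul, map_pow, hF0, hP0, one_pow, mul_one, Finset.sum_const,
        Finset.card_range, nsmul_eq_mul] at h2
      rw [h2]
      ring
    set R : PowerSeries ℚ_[p] := map ι (rescale (p : ℚ) (exp ℚ))
    have hR0 : coeff 0 R = 1 := by simp [R]
    have hRc : ∀ j, j ≠ 0 → ‖coeff j R‖ ≤ (p : ℝ)⁻¹ := by
      intro j hj
      have h1 : coeff j R = (((p : ℚ) ^ j / j.factorial : ℚ) : ℚ_[p]) := by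
        rw [coeff_map, coeff_rescale, coeff_exp]
        simp [ι, div_eq_mul_inv]
      rw [h1]
      exact norm_pow_div_factorial_le hj
    have hfun : F ^ p = expand p hp.1.ne_zero F * R := by
      rw [← map_pow, artinHasse_pow, map_mul, map_expand]
    have hexp : ∀ i ≤ m, coeff i (expand p hp.1.ne_zero F) =
        coeff i (expand p hp.1.ne_zero P') := by
      intro i hi
      rw [coeff_expand, coeff_expand]
      split_ifs with hd
      · have : i / p < m := by
          rcases Nat.eq_zero_or_pos i with rfl | hi0
          · simpa using hm
          · exact (Nat.div_lt_self hi0 hp.1.one_lt).trans_le hi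
        rw [hPc, if_pos this]
      · rfl
    have hexpn : ∀ i < m, ‖coeff i (expand p hp.1.ne_zero F)‖ ≤ 1 := by
      intro i hi
      rw [coeff_expand]
      split_ifs with hd
      · rw [hFc]
        exact ih _ ((Nat.div_le_self i p).trans_lt hi)
      · rw [norm_zero]; exact zero_le_one
    have hrhs : ‖coeff m (expand p hp.1.ne_zero F * R) - coeff m (expand p hp.1.ne_zero P')‖ ≤
        (p : ℝ)⁻¹ := by
      rw [coeff_mul, Finset.Nat.sum_antidiagonal_eq_sum_range_succ_mk, Finset.sum_range_succ,
        Nat.sub_self, hR0, mul_one, hexp m le_rfl, add_sub_cancel_right]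
      refine IsUltrametricDist.norm_sum_le_of_forall_le_of_nonneg (inv_p_pos p).le fun i hi => ?_
      have hi' := Finset.mem_range.1 hi
      rw [norm_mul]
      exact (mul_le_of_le_one_left (norm_nonneg _) (hexpn i hi')).trans (hRc _ (by omega))
    have hint : ‖coeff m (expand p hp.1.ne_zero P') - coeff m (P' ^ p)‖ ≤ (p : ℝ)⁻¹ := by
      have h1 : coeff m (expand p hp.1.ne_zero P') - coeff m (P' ^ p) =
          (((Polynomial.expand ℤ_[p] p P - P ^ p).coeff m : ℤ_[p]) : ℚ_[p]) := by
        rw [← map_pow, ← map_expand, coeff_map, coeff_map, ← map_sub, Polynomial.coeff_sub,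
          Polynomial.coeff_expand hp.1.pos, coeff_expand, Polynomial.coeff_coe,
          ← Polynomial.coe_pow, Polynomial.coeff_coe]
        rfl
      rw [h1]
      exact norm_coeff_expand_sub_pow_le P m
    have hfin : (p : ℚ_[p]) * coeff m F =
        (coeff m (expand p hp.1.ne_zero F * R) - coeff m (expand p hp.1.ne_zero P')) +
          (coeff m (expand p hp.1.ne_zero P') - coeff m (P' ^ p)) := by
      rw [← hfun, hpow]
      ring
    have h1 := (IsUltrametricDist.norm_add_le_max _ _).trans (max_le hrhs hint)
    rw [← hfin, norm_mul, Padic.norm_p, hFc] at h1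
    exact le_of_mul_le_mul_left (by rwa [mul_one]) (inv_p_pos p)

end

/-! ### The constants `γ_i` -/

section
variable {p a : ℕ} [hp : Fact p.Prime] {γ g : PadicAlgCl p}

lemma norm_gamma_pow (hord : ‖γ‖ = (p : ℝ) ^ (-(1 / ((p : ℝ) - 1)))) :
    ‖γ‖ ^ (p - 1) = (p : ℝ)⁻¹ := by
  have hp1 : (1 : ℝ) < p := by exact_mod_cast hp.1.one_lt
  rw [hord, ← Real.rpow_natCast, ← Real.rpow_mul (by positivity), Nat.cast_sub hp.1.one_le,
    Nat.cast_one, neg_mul, one_div, inv_mul_cancel₀ (by linarith), Real.rpow_neg_one]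

lemma gamma_ne_zero (hord : ‖γ‖ = (p : ℝ) ^ (-(1 / ((p : ℝ) - 1)))) : γ ≠ 0 := by
  rw [← norm_pos_iff, hord]
  exact Real.rpow_pos_of_pos (by exact_mod_cast hp.1.pos) _

lemma norm_gamma_lt_one (hord : ‖γ‖ = (p : ℝ) ^ (-(1 / ((p : ℝ) - 1)))) : ‖γ‖ < 1 := by
  by_contra h
  have h1 := one_le_pow₀ (not_lt.1 h) (n := p - 1)
  rw [norm_gamma_pow hord] at h1
  exact absurd h1 (not_le.2 (inv_p_lt_one p))

lemma norm_gamma_term (j : ℕ) :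
    ‖γ ^ p ^ j / (p : PadicAlgCl p) ^ j‖ = ‖γ‖ ^ p ^ j * (p : ℝ) ^ j := by
  rw [norm_div, norm_pow, norm_pow, norm_natCast_p, inv_pow, div_inv_eq_mul]

/-- `γ_i` is minus the tail of a vanishing series whose terms have decreasing norms. -/
lemma norm_gammaSeq_le
    (hroot : HasSum (fun j : ℕ => γ ^ p ^ j / (p : PadicAlgCl p) ^ j) 0)
    (hord : ‖γ‖ = (p : ℝ) ^ (-(1 / ((p : ℝ) - 1)))) (i : ℕ) :
    ‖gammaSeq p γ i‖ ≤ ‖γ‖ ^ p ^ (i + 1) * (p : ℝ) ^ (i + 1) := by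
  have hp0 : (0 : ℝ) < p := by exact_mod_cast hp.1.pos
  have hanti : Antitone fun j : ℕ => ‖γ‖ ^ p ^ j * (p : ℝ) ^ j := by
    refine antitone_nat_of_succ_le fun j => ?_
    have e : p ^ (j + 1) = p ^ j + (p - 1) * p ^ j := by
      rw [pow_succ, Nat.sub_mul, one_mul, mul_comm p]
      have : p ^ j ≤ p ^ j * p := Nat.le_mul_of_pos_right _ hp.1.pos
      omega
    have h1 : ‖γ‖ ^ ((p - 1) * p ^ j) * p ≤ 1 := by
      rw [pow_mul, norm_gamma_pow hord]
      calc (p : ℝ)⁻¹ ^ p ^ j * p ≤ (p : ℝ)⁻¹ * p := mul_le_mul_of_nonneg_right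
            (pow_le_of_le_one (inv_p_pos p).le (inv_p_lt_one p).le
              (pow_pos hp.1.pos j).ne') hp0.le
        _ = 1 := inv_mul_cancel₀ hp0.ne'
    rw [e, pow_add, pow_succ]
    calc ‖γ‖ ^ p ^ j * ‖γ‖ ^ ((p - 1) * p ^ j) * ((p : ℝ) ^ j * p) =
          ‖γ‖ ^ p ^ j * (p : ℝ) ^ j * (‖γ‖ ^ ((p - 1) * p ^ j) * p) := by ring
      _ ≤ ‖γ‖ ^ p ^ j * (p : ℝ) ^ j := mul_le_of_le_one_right (by positivity) h1
  have h1 := hroot.tendsto_sum_nat.sub_const (gammaSeq p γ i)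
  rw [zero_sub] at h1
  rw [← norm_neg]
  refine le_of_tendsto h1.norm ?_
  filter_upwards [Filter.eventually_ge_atTop (i + 1)] with M hM
  rw [gammaSeq, ← Finset.sum_Ico_eq_sub _ hM]
  refine IsUltrametricDist.norm_sum_le_of_forall_le_of_nonneg (by positivity) fun j hj => ?_
  rw [norm_gamma_term]
  exact hanti (Finset.mem_Ico.1 hj).1

/-- The coefficients of `h(y) = ∑ i, p ^ i γ_i γ ^ (- p ^ i) y ^ (p ^ i)`: with `y_l = γ x_l`, the
series `x_l ∂H/∂x_l` is `h(y_l) - h(y_0)`, where `y_0 = t / (x_1 ⋯ x_n)` up to a constant. -/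
def twist (p : ℕ) [Fact p.Prime] (γ : PadicAlgCl p) (m : ℕ) : PadicAlgCl p :=
  if p ^ Nat.log p m = m then (m : PadicAlgCl p) * gammaSeq p γ (Nat.log p m) / γ ^ m else 0

lemma twist_pow (i : ℕ) : twist p γ (p ^ i) =
    (p : PadicAlgCl p) ^ i * gammaSeq p γ i / γ ^ p ^ i := by
  rw [twist, Nat.log_pow hp.1.one_lt, if_pos rfl, Nat.cast_pow]

lemma twist_of_ne {m : ℕ} (h : ∀ i, m ≠ p ^ i) : twist p γ m = 0 := if_neg (h _).symm

lemma gammaSeq_succ (i : ℕ) : gammaSeq p γ (i + 1) =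
    gammaSeq p γ i + γ ^ p ^ (i + 1) / (p : PadicAlgCl p) ^ (i + 1) := by
  rw [gammaSeq, Finset.sum_range_succ]; rfl

lemma gammaSeq_zero : gammaSeq p γ 0 = γ := by
  rw [gammaSeq, Finset.sum_range_one, pow_zero, pow_zero, pow_one, div_one]

/-- The coefficientwise form of `H(t, x) - H(t ^ p, x ^ p) = ∑ j, γ ^ (p ^ j) / p ^ j K ^ (p ^ j)`
after logarithmic differentiation. -/
lemma twist_eq_add (hγ : γ ≠ 0) (m : ℕ) : twist p γ m = powInd p m +
    if p ∣ m then (p : PadicAlgCl p) * (γ ^ (m / p) / γ ^ m) * twist p γ (m / p) else 0 := by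
  have hp0 : (p : PadicAlgCl p) ≠ 0 := by exact_mod_cast hp.1.ne_zero
  by_cases h : ∃ i, m = p ^ i
  · obtain ⟨i, rfl⟩ := h
    rw [powInd_pow]
    rcases i with _ | i
    · rw [twist_pow, gammaSeq_zero, pow_zero, pow_zero, pow_one, one_mul, div_self hγ,
        if_neg (by rw [Nat.dvd_one]; exact hp.1.one_lt.ne'), Nat.cast_one, add_zero]
    · rw [if_pos (dvd_pow_self p i.succ_ne_zero), twist_pow, gammaSeq_succ]
      have : p ^ (i + 1) / p = p ^ i := by rw [pow_succ, Nat.mul_div_cancel _ hp.1.pos]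
      rw [this, twist_pow]
      field_simp
      push_cast
      ring
  · rw [not_exists] at h
    rw [powInd_of_ne h, twist_of_ne h]
    split_ifs with hd
    · obtain ⟨k, rfl⟩ := hd
      rw [Nat.mul_div_cancel_left _ hp.1.pos, twist_of_ne (m := k)]
      · simp
      · rintro i rfl
        exact h (i + 1) (by rw [pow_succ, mul_comm])
    · simp

lemma root_mem_baseField : g ∈ baseField p a g :=
  (le_sup_right : IntermediateField.adjoin ℚ_[p] {g} ≤ baseField p a g)
    (IntermediateField.mem_adjoin_simple_self _ g)

lemma gamma_mem_baseField (hg : g ^ p ^ a = γ) : γ ∈ baseField p a g :=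
  hg ▸ pow_mem root_mem_baseField _

lemma gammaSeq_mem_baseField (hg : g ^ p ^ a = γ) (i : ℕ) :
    gammaSeq p γ i ∈ baseField p a g :=
  sum_mem fun _ _ => div_mem (pow_mem (gamma_mem_baseField hg) _) (pow_mem (natCast_mem _ _) _)

lemma norm_twist_le
    (hroot : HasSum (fun j : ℕ => γ ^ p ^ j / (p : PadicAlgCl p) ^ j) 0)
    (hord : ‖γ‖ = (p : ℝ) ^ (-(1 / ((p : ℝ) - 1)))) (m : ℕ) :
    ‖twist p γ (m + 1)‖ ≤ (p : ℝ)⁻¹ ^ m := by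
  by_cases h : ∃ i, m + 1 = p ^ i
  · obtain ⟨i, hi⟩ := h
    have hp0 : (0 : ℝ) < p := by exact_mod_cast hp.1.pos
    have hγ : 0 < ‖γ‖ := norm_pos_iff.2 (gamma_ne_zero hord)
    rw [hi, twist_pow, norm_div, norm_mul, norm_pow, norm_pow, norm_natCast_p,
      div_le_iff₀ (by positivity)]
    have e : p ^ (i + 1) = p ^ i + (p - 1) * p ^ i := by
      rw [pow_succ, Nat.sub_mul, one_mul, mul_comm p]
      have : p ^ i ≤ p ^ i * p := Nat.le_mul_of_pos_right _ hp.1.pos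
      omega
    calc (p : ℝ)⁻¹ ^ i * ‖gammaSeq p γ i‖ ≤
          (p : ℝ)⁻¹ ^ i * (‖γ‖ ^ p ^ (i + 1) * (p : ℝ) ^ (i + 1)) :=
          mul_le_mul_of_nonneg_left (norm_gammaSeq_le hroot hord i) (by positivity)
      _ = (p : ℝ)⁻¹ ^ m * ‖γ‖ ^ p ^ i := by
          rw [e, pow_add, pow_mul, norm_gamma_pow hord, ← hi, pow_succ (p : ℝ)⁻¹ m]
          field_simp
          rw [pow_succ, ← mul_assoc, ← mul_pow, one_div_mul_cancel hp0.ne', one_pow, one_mul]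
      _ ≤ _ := le_rfl
  · rw [twist_of_ne (not_exists.1 h), norm_zero]
    exact pow_nonneg (inv_p_pos p).le _

lemma isTwist_twist (hroot : HasSum (fun j : ℕ => γ ^ p ^ j / (p : PadicAlgCl p) ^ j) 0)
    (hord : ‖γ‖ = (p : ℝ) ^ (-(1 / ((p : ℝ) - 1)))) (hg : g ^ p ^ a = γ) :
    IsTwist p a g (twist p γ) := by
  have h0 : twist p γ 0 = 0 := twist_of_ne fun i => (pow_pos hp.1.pos i).ne
  refine ⟨h0, ?_, fun m => ⟨?_, ?_⟩, norm_twist_le hroot hord⟩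
  · have := twist_pow (p := p) (γ := γ) 0
    rw [gammaSeq_zero, pow_zero, pow_zero, pow_one, one_mul, div_self (gamma_ne_zero hord)] at this
    exact this
  · rw [twist]
    split_ifs
    · exact div_mem (mul_mem (natCast_mem _ _) (gammaSeq_mem_baseField hg _))
        (pow_mem (gamma_mem_baseField hg) _)
    · exact zero_mem _
  · rcases m with _ | m
    · rw [h0, norm_zero]; exact zero_le_one
    · exact (norm_twist_le hroot hord m).trans (inv_p_pow_le_one p m)

end

/-! ### Laurent series as families of power series -/

section
variable {n : ℕ}

/-- The exponent `u` of `x` in the monomial `y ^ κ`, where `y_l = x_l` up to a constant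
for `l ≥ 1` and `y_0 = t ^ N / (x_1 ⋯ x_n)` up to a constant. -/
def xExp (κ : Fin (n + 1) →₀ ℕ) : Fin n → ℤ := fun l => (κ l.succ : ℤ) - κ 0

lemma xExp_add (κ κ' : Fin (n + 1) →₀ ℕ) : xExp (κ + κ') = xExp κ + xExp κ' := by
  funext l
  simp only [xExp, Finsupp.add_apply, Pi.add_apply]
  push_cast
  ring

/-- The exponent `κ` such that `t ^ s x ^ u = t ^ (s % N) y ^ κ` up to a constant; it exists if
`0 ≤ s / N + u_l` for all `l`. -/
def yExp (N : ℕ) (u : Fin n → ℤ) (s : ℕ) : Fin (n + 1) →₀ ℕ :=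
  Finsupp.equivFunOnFinite.symm (Fin.cons (s / N) fun l => (((s / N : ℕ) : ℤ) + u l).toNat)

lemma yExp_zero (N : ℕ) (u : Fin n → ℤ) (s : ℕ) : yExp N u s 0 = s / N := rfl

lemma yExp_succ (N : ℕ) (u : Fin n → ℤ) (s : ℕ) (l : Fin n) :
    yExp N u s l.succ = (((s / N : ℕ) : ℤ) + u l).toNat := rfl

/-- The monomial `t ^ s x ^ u` is a product of `t` and of the variables `y_0, …, y_n`. -/
def InCone (N : ℕ) (u : Fin n → ℤ) (s : ℕ) : Prop := ∀ l, 0 ≤ ((s / N : ℕ) : ℤ) + u l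

lemma InCone.xExp_yExp {N : ℕ} {u : Fin n → ℤ} {s : ℕ} (h : InCone N u s) :
    xExp (yExp N u s) = u := by
  funext l
  rw [xExp, yExp_zero, yExp_succ, Int.toNat_of_nonneg (h l)]
  ring

lemma eq_yExp {N : ℕ} {u : Fin n → ℤ} {s : ℕ} {κ : Fin (n + 1) →₀ ℕ} (hu : xExp κ = u)
    (hs : s / N = κ 0) : κ = yExp N u s := by
  ext i
  refine Fin.cases ?_ (fun l => ?_) i
  · rw [yExp_zero, hs]
  · rw [yExp_succ, ← hu, hs, xExp]
    omega

lemma inCone_of_xExp_eq {N : ℕ} {u : Fin n → ℤ} {s : ℕ} {κ : Fin (n + 1) →₀ ℕ}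
    (hu : xExp κ = u) (hs : s / N = κ 0) : InCone N u s := by
  intro l
  rw [← hu, hs, xExp]
  omega

lemma add_mul_div_of_lt {N c m : ℕ} (hc : c < N) : (c + N * m) / N = m := by
  rw [Nat.add_mul_div_left _ _ (by omega), Nat.div_eq_of_lt hc, zero_add]

lemma add_mul_mod_of_lt {N c m : ℕ} (hc : c < N) : (c + N * m) % N = c := by
  rw [Nat.add_mul_mod_self_left, Nat.mod_eq_of_lt hc]

/-- The exponent `u` of `x` and the degree of a monomial, expressed by `κ`. -/
lemma degree_eq_sum_xExp (κ : Fin (n + 1) →₀ ℕ) :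
    ((degree κ : ℕ) : ℤ) = ∑ l, xExp κ l + (n + 1) * κ 0 := by
  rw [Finsupp.degree_eq_sum, Fin.sum_univ_succ]
  simp only [xExp, Finset.sum_sub_distrib, Finset.sum_const, Finset.card_univ, Fintype.card_fin]
  push_cast
  rw [nsmul_eq_mul]
  ring

end

section
variable {p n : ℕ} [Fact p.Prime] {N : ℕ} {γ β : PadicAlgCl p}

open Classical in
/-- The Laurent series `∑ c < N, ∑ κ, φ_c(κ) (β ^ (n + 1) t) ^ c y ^ κ`, where `y_l = γ x_l` for
`l ≥ 1` and `y_0 = γ t ^ N / (x_1 ⋯ x_n)`. -/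
def realize (N : ℕ) (γ β : PadicAlgCl p) (φ : ℕ → Ser p n) : Laurent p n := fun u =>
  PowerSeries.mk fun s => if InCone N u s then
    φ (s % N) (yExp N u s) * (γ ^ degree (yExp N u s) * β ^ ((n + 1) * (s % N))) else 0

lemma coeff_realize_of_not (φ : ℕ → Ser p n) {u : Fin n → ℤ} {s : ℕ} (h : ¬InCone N u s) :
    PowerSeries.coeff s (realize N γ β φ u) = 0 := by
  rw [realize, PowerSeries.coeff_mk, if_neg h]

lemma coeff_realize (φ : ℕ → Ser p n) {u : Fin n → ℤ} {s : ℕ} {κ : Fin (n + 1) →₀ ℕ}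
    (hu : xExp κ = u) (hs : s / N = κ 0) : PowerSeries.coeff s (realize N γ β φ u) =
      φ (s % N) κ * (γ ^ degree κ * β ^ ((n + 1) * (s % N))) := by
  rw [realize, PowerSeries.coeff_mk, if_pos (inCone_of_xExp_eq hu hs), ← eq_yExp hu hs]

lemma coeff_realize_of_lt (φ : ℕ → Ser p n) {c : ℕ} (hc : c < N) (κ : Fin (n + 1) →₀ ℕ) :
    PowerSeries.coeff (c + N * κ 0) (realize N γ β φ (xExp κ)) =
      φ c κ * (γ ^ degree κ * β ^ ((n + 1) * c)) := by
  rw [coeff_realize φ rfl (add_mul_div_of_lt hc), add_mul_mod_of_lt hc]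

/-- Two Laurent series in the cone are equal if they have the same coefficients there. -/
lemma ext_realize {f : Laurent p n} {φ : ℕ → Ser p n}
    (h0 : ∀ u s, ¬InCone N u s → PowerSeries.coeff s (f u) = 0)
    (h : ∀ (κ : Fin (n + 1) →₀ ℕ) (s : ℕ), s / N = κ 0 → PowerSeries.coeff s (f (xExp κ)) =
      φ (s % N) κ * (γ ^ degree κ * β ^ ((n + 1) * (s % N)))) : f = realize N γ β φ := by
  funext u
  ext s
  by_cases hc : InCone N u s
  · have := h (yExp N u s) s (yExp_zero N u s).symm
    rw [hc.xExp_yExp] at this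
    rw [this, coeff_realize φ hc.xExp_yExp (yExp_zero N u s).symm]
  · rw [h0 u s hc, coeff_realize_of_not φ hc]

lemma realize_congr (hN : 0 < N) {φ φ' : ℕ → Ser p n} (h : ∀ c < N, φ c = φ' c) :
    realize N γ β φ = realize N γ β φ' :=
  ext_realize (fun _ _ => coeff_realize_of_not φ) fun κ s hs => by
    rw [coeff_realize φ rfl hs, h _ (Nat.mod_lt s hN)]

lemma realize_injective (hγ : γ ≠ 0) (hβ : β ≠ 0) {φ φ' : ℕ → Ser p n}
    (h : realize N γ β φ = realize N γ β φ') {c : ℕ} (hc : c < N) : φ c = φ' c := by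
  funext κ
  have := congrArg (PowerSeries.coeff (c + N * κ 0)) (congrFun h (xExp κ))
  rw [coeff_realize_of_lt φ hc, coeff_realize_of_lt φ' hc] at this
  exact mul_right_cancel₀ (mul_ne_zero (pow_ne_zero _ hγ) (pow_ne_zero _ hβ)) this

lemma realize_add (φ φ' : ℕ → Ser p n) :
    realize N γ β (φ + φ') = realize N γ β φ + realize N γ β φ' := by
  symm
  refine ext_realize (fun u s h => ?_) fun κ s hs => ?_
  · rw [Pi.add_apply, map_add, coeff_realize_of_not φ h, coeff_realize_of_not φ' h, add_zero]
  · rw [Pi.add_apply, map_add, coeff_realize φ rfl hs, coeff_realize φ' rfl hs, Pi.add_apply,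
      Pi.add_apply]
    ring

lemma realize_zero : realize N γ β (0 : ℕ → Ser p n) = 0 := by
  have := realize_add (N := N) (γ := γ) (β := β) (0 : ℕ → Ser p n) 0
  rwa [add_zero, left_eq_add] at this

/-- `realize` as a homomorphism of groups. -/
def realizeHom (N : ℕ) (γ β : PadicAlgCl p) : (ℕ → Ser p n) →+ Laurent p n where
  toFun := realize N γ β
  map_zero' := realize_zero
  map_add' := realize_add

/-! ### Products -/

/-- The product of power series in `y_0, …, y_n`, as opposed to the pointwise product of their
coefficients. -/
def serMul (f f' : Ser p n) : Ser p n :=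
  Mul.mul (α := MvPowerSeries (Fin (n + 1)) (PadicAlgCl p)) f f'

lemma serMul_apply (f f' : Ser p n) (κ : Fin (n + 1) →₀ ℕ) : serMul f f' κ =
    ∑ y ∈ Finset.HasAntidiagonal.antidiagonal κ, f y.1 * f' y.2 := by
  classical
  exact MvPowerSeries.coeff_mul κ f f'

/-- The summands of the product of two Laurent series in the cone which do not vanish come from
the decompositions of the exponent `κ`. -/
lemma lmul_aux (hN : 0 < N) (f : Ser p n) (φ : ℕ → Ser p n) (u v : Fin n → ℤ) (s : ℕ)
    (x : ℕ × ℕ) (hx : x.1 + x.2 = s)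
    (h1 : PowerSeries.coeff x.1 (realize N γ β (fun c => if c = 0 then f else 0) v) ≠ 0)
    (h2 : PowerSeries.coeff x.2 (realize N γ β φ (u - v)) ≠ 0) :
    InCone N u s ∧ yExp N v x.1 + yExp N (u - v) x.2 = yExp N u s ∧
      x.1 = N * yExp N v x.1 0 ∧ xExp (yExp N v x.1) = v := by
  have c1 : InCone N v x.1 := by_contra fun h => h1 (coeff_realize_of_not _ h)
  have c2 : InCone N (u - v) x.2 := by_contra fun h => h2 (coeff_realize_of_not _ h)
  have hm : x.1 % N = 0 := by
    by_contra hm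
    rw [coeff_realize _ c1.xExp_yExp (yExp_zero N v x.1).symm, if_neg hm] at h1
    simp at h1
  have hx1 : x.1 = N * (x.1 / N) := by
    conv_lhs => rw [← Nat.div_add_mod x.1 N, hm, add_zero]
  have hu : xExp (yExp N v x.1 + yExp N (u - v) x.2) = u := by
    rw [xExp_add, c1.xExp_yExp, c2.xExp_yExp, add_sub_cancel]
  have hs : s / N = (yExp N v x.1 + yExp N (u - v) x.2) 0 := by
    rw [Finsupp.add_apply, yExp_zero, yExp_zero, ← hx]
    conv_lhs => rw [hx1, add_comm, Nat.add_mul_div_left _ _ hN, add_comm]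
  exact ⟨inCone_of_xExp_eq hu hs, eq_yExp hu hs, hx1, c1.xExp_yExp⟩

lemma finite_support_lmul (hN : 0 < N) (f : Ser p n) (φ : ℕ → Ser p n) (u : Fin n → ℤ) (s : ℕ) :
    (Function.support fun v => PowerSeries.coeff s
      (realize N γ β (fun c => if c = 0 then f else 0) v * realize N γ β φ (u - v))) ⊆
      ((Finset.HasAntidiagonal.antidiagonal (yExp N u s)).image fun y => xExp y.1 :
        Finset (Fin n → ℤ)) := by
  intro v hv
  rw [Function.mem_support, PowerSeries.coeff_mul] at hv
  obtain ⟨x, hx, hx0⟩ := Finset.exists_ne_zero_of_sum_ne_zero hv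
  obtain ⟨-, h1, -, h2⟩ := lmul_aux hN f φ u v s x (Finset.HasAntidiagonal.mem_antidiagonal.1 hx)
    (left_ne_zero_of_mul hx0) (right_ne_zero_of_mul hx0)
  rw [Finset.mem_coe, Finset.mem_image]
  exact ⟨(yExp N v x.1, yExp N (u - v) x.2), Finset.HasAntidiagonal.mem_antidiagonal.2 h1, h2⟩

/-- The product of Laurent series corresponds to the product of power series in the `y_l`, if the
first factor is a series in the `y_l` alone. -/
lemma lmul_realize (hN : 0 < N) (f : Ser p n) (φ : ℕ → Ser p n) :
    lmul (realize N γ β fun c => if c = 0 then f else 0) (realize N γ β φ) =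
      realize N γ β fun c => serMul f (φ c) := by
  classical
  have key : ∀ u s, PowerSeries.coeff s (lmul (realize N γ β fun c => if c = 0 then f else 0)
      (realize N γ β φ) u) = ∑ v ∈ (Finset.HasAntidiagonal.antidiagonal (yExp N u s)).image
        (fun y => xExp y.1), ∑ x ∈ Finset.HasAntidiagonal.antidiagonal s,
          PowerSeries.coeff x.1 (realize N γ β (fun c => if c = 0 then f else 0) v) *
            PowerSeries.coeff x.2 (realize N γ β φ (u - v)) := by
    intro u s
    rw [lmul, PowerSeries.coeff_mk,
      finsum_eq_sum_of_support_subset _ (finite_support_lmul hN f φ u s)]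
    exact Finset.sum_congr rfl fun v _ => PowerSeries.coeff_mul _ _ _
  refine ext_realize (fun u s hc => ?_) fun κ s hs => ?_
  · rw [key]
    refine Finset.sum_eq_zero fun v _ => Finset.sum_eq_zero fun x hx => ?_
    by_contra h0
    exact hc (lmul_aux hN f φ u v s x (Finset.HasAntidiagonal.mem_antidiagonal.1 hx)
      (left_ne_zero_of_mul h0) (right_ne_zero_of_mul h0)).1
  · have hκ : yExp N (xExp κ) s = κ := (eq_yExp rfl hs).symm
    rw [key, hκ, serMul_apply, Finset.sum_mul,
      ← Finset.sum_fiberwise_of_maps_to (g := fun y : (Fin (n + 1) →₀ ℕ) × (Fin (n + 1) →₀ ℕ) =>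
        xExp y.1) (fun y hy => Finset.mem_image_of_mem
          (fun y : (Fin (n + 1) →₀ ℕ) × (Fin (n + 1) →₀ ℕ) => xExp y.1) hy)]
    refine Finset.sum_congr rfl fun v _ => ?_
    have hsplit : ∀ y ∈ (Finset.HasAntidiagonal.antidiagonal κ).filter (fun y => xExp y.1 = v),
        PowerSeries.coeff (N * y.1 0) (realize N γ β (fun c => if c = 0 then f else 0) v) *
          PowerSeries.coeff (s - N * y.1 0) (realize N γ β φ (xExp κ - v)) =
        f y.1 * φ (s % N) y.2 * (γ ^ degree κ * β ^ ((n + 1) * (s % N))) ∧ N * y.1 0 ≤ s := by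
      intro y hy
      rw [Finset.mem_filter, Finset.HasAntidiagonal.mem_antidiagonal] at hy
      obtain ⟨hy, rfl⟩ := hy
      have hs' : s = s % N + N * (y.1 0 + y.2 0) := by
        rw [← Finsupp.add_apply, hy, ← hs, Nat.mod_add_div]
      have hle : N * y.1 0 ≤ s := by rw [hs', mul_add]; omega
      have e1 : s - N * y.1 0 = s % N + N * y.2 0 := by
        conv_lhs => rw [hs', mul_add]
        omega
      have e2 : xExp κ - xExp y.1 = xExp y.2 := by rw [← hy, xExp_add, add_sub_cancel_left]
      have e3 := coeff_realize_of_lt (γ := γ) (β := β) (fun c => if c = 0 then f else 0) hN y.1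
      rw [zero_add, if_pos rfl, mul_zero, pow_zero, mul_one] at e3
      rw [e1, e2, e3, coeff_realize_of_lt φ (Nat.mod_lt s hN), ← hy, map_add, pow_add]
      exact ⟨by ring, hle⟩
    symm
    refine Finset.sum_bij_ne_zero (fun y _ _ => (N * y.1 0, s - N * y.1 0)) (fun y hy _ => ?_)
      (fun y hy _ y' hy' _ h => ?_) (fun x hx hx0 => ?_) (fun y hy _ => (hsplit y hy).1.symm)
    · rw [Finset.HasAntidiagonal.mem_antidiagonal]
      exact Nat.add_sub_of_le (hsplit y hy).2
    · rw [Finset.mem_filter, Finset.HasAntidiagonal.mem_antidiagonal] at hy hy'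
      have h0 : y.1 0 = y'.1 0 := Nat.eq_of_mul_eq_mul_left hN (Prod.ext_iff.1 h).1
      have h1 : y.1 = y'.1 := by
        ext i
        refine Fin.cases h0 (fun l => ?_) i
        have h2 := congrFun (hy.2.trans hy'.2.symm) l
        simp only [xExp] at h2
        omega
      refine Prod.ext h1 (add_left_cancel (a := y.1) ?_)
      rw [hy.1, h1, hy'.1]
    · have hx' := Finset.HasAntidiagonal.mem_antidiagonal.1 hx
      obtain ⟨-, h1, h2, h3⟩ := lmul_aux hN f φ (xExp κ) v s x hx'
        (left_ne_zero_of_mul hx0) (right_ne_zero_of_mul hx0)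
      rw [hκ] at h1
      have hmem : (yExp N v x.1, yExp N (xExp κ - v) x.2) ∈
          (Finset.HasAntidiagonal.antidiagonal κ).filter (fun y => xExp y.1 = v) := by
        rw [Finset.mem_filter, Finset.HasAntidiagonal.mem_antidiagonal]
        exact ⟨h1, h3⟩
      have hxx : (N * yExp N v x.1 0, s - N * yExp N v x.1 0) = x := by
        rw [← h2]
        refine Prod.ext rfl ?_
        simp only
        omega
      refine ⟨_, hmem, ?_, hxx⟩
      rw [← (hsplit _ hmem).1]
      have h4 := Prod.ext_iff.1 hxx
      simp only at h4
      rw [h4.2, h4.1]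
      exact hx0

end

/-! ### The modules `C_{p^k}` in terms of restricted power series -/

section
variable {n : ℕ}

lemma mFun_le_iff {u : Fin n → ℤ} {m : ℕ} : mFun u ≤ m ↔ ∀ l, 0 ≤ (m : ℤ) + u l := by
  rw [mFun, Finset.sup_le_iff]
  exact ⟨fun h l => by have := h l (Finset.mem_univ l); omega,
    fun h l _ => by have := h l; omega⟩

lemma inCone_iff {N : ℕ} (hN : 0 < N) {u : Fin n → ℤ} {s : ℕ} :
    InCone N u s ↔ N * mFun u ≤ s := by
  rw [InCone, ← mFun_le_iff, Nat.le_div_iff_mul_le hN, mul_comm]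

lemma mFun_xExp_le (κ : Fin (n + 1) →₀ ℕ) : mFun (xExp κ) ≤ κ 0 :=
  mFun_le_iff.2 fun l => by rw [xExp]; omega

lemma degree_eq_wFun (κ : Fin (n + 1) →₀ ℕ) : ((degree κ : ℕ) : ℤ) =
    wFun (xExp κ) + (n + 1) * ((κ 0 - mFun (xExp κ) : ℕ) : ℤ) := by
  rw [degree_eq_sum_xExp, wFun, Nat.cast_sub (mFun_xExp_le κ)]
  ring

lemma le_wFun (u : Fin n → ℤ) : (mFun u : ℤ) ≤ wFun u ∧ ∀ l, u l ≤ wFun u := by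
  have h : ∀ l, 0 ≤ (mFun u : ℤ) + u l := mFun_le_iff.1 le_rfl
  have e : wFun u = ∑ l, ((mFun u : ℤ) + u l) + mFun u := by
    rw [wFun, Finset.sum_add_distrib, Finset.sum_const, Finset.card_univ, Fintype.card_fin,
      nsmul_eq_mul]
    ring
  refine ⟨?_, fun l => ?_⟩
  · rw [e]
    linarith [Finset.sum_nonneg fun l (_ : l ∈ Finset.univ) => h l]
  · have := Finset.single_le_sum (fun l (_ : l ∈ Finset.univ) => h l) (Finset.mem_univ l)
    rw [e]
    linarith

lemma finite_wFun_lt (n : ℕ) (M : ℤ) : {u : Fin n → ℤ | wFun u < M}.Finite := by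
  refine (Set.finite_Icc (fun _ => -M) (fun _ => M)).subset fun u hu => ?_
  obtain ⟨h1, h2⟩ := le_wFun u
  have h3 : ∀ l, 0 ≤ (mFun u : ℤ) + u l := mFun_le_iff.1 le_rfl
  have hu' : wFun u < M := hu
  refine ⟨fun l => ?_, fun l => ?_⟩
  · have := h3 l
    show -M ≤ u l
    omega
  · have := h2 l
    show u l ≤ M
    omega

end

section
variable {p n a : ℕ} [hp : Fact p.Prime] {γ g : PadicAlgCl p} {k : ℕ}

/-- The two normalizations of the coefficients agree. -/
lemma gamma_pow_eq {N : ℕ} {β : PadicAlgCl p} (hγ : γ ≠ 0) (hβ : β ^ N = γ)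
    (κ : Fin (n + 1) →₀ ℕ) {s : ℕ} (hs : s / N = κ 0) :
    β ^ ((s - N * mFun (xExp κ)) * (n + 1)) * γ ^ wFun (xExp κ) =
      γ ^ degree κ * β ^ ((n + 1) * (s % N)) := by
  set e := κ 0 - mFun (xExp κ)
  have h1 : s - N * mFun (xExp κ) = s % N + N * e := by
    have h2 := Nat.mod_add_div s N
    rw [hs] at h2
    have h3 : N * κ 0 = N * e + N * mFun (xExp κ) := by
      rw [← mul_add, Nat.sub_add_cancel (mFun_xExp_le κ)]
    omega
  have h2 : γ ^ degree κ = γ ^ wFun (xExp κ) * γ ^ ((n + 1) * e) := by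
    rw [← zpow_natCast γ (degree κ), degree_eq_wFun, zpow_add₀ hγ, ← zpow_natCast γ]
    push_cast
    rfl
  rw [h1, h2, add_mul, pow_add, mul_assoc N, pow_mul β N, hβ, mul_comm e, mul_comm (s % N)]
  ring

lemma coeff_mul_monomial {ξ : PowerSeries (PadicAlgCl p)} {b : PadicAlgCl p} {m s : ℕ} :
    PowerSeries.coeff s (ξ * (PowerSeries.C b * PowerSeries.X ^ m)) =
      if m ≤ s then PowerSeries.coeff (s - m) ξ * b else 0 := by
  rw [← mul_assoc, PowerSeries.coeff_mul_X_pow']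
  split_ifs
  · rw [PowerSeries.coeff_mul_C]
  · rfl

/-- The series in `C_{p^k}` are those given by families of restricted power series. -/
theorem mem_modC_iff (hγ : γ ≠ 0) (hβ : rootGamma p a g k ^ p ^ k = γ) {ζ : Laurent p n} :
    ζ ∈ modC p n a γ g k ↔ ∃ φ : ℕ → Ser p n, (∀ c < p ^ k, IsRestricted p n a g (φ c)) ∧
      ζ = realize (p ^ k) γ (rootGamma p a g k) φ := by
  set β := rootGamma p a g k
  have hN : 0 < p ^ k := pow_pos hp.1.pos k
  have hβ0 : β ≠ 0 := by rintro h; rw [h, zero_pow hN.ne'] at hβ; exact hγ hβ.symm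
  constructor
  · rintro ⟨ξ, h1, h2, h3⟩
    choose C hCR hC0 hC using h1
    have huniq : ∀ u (c' : ℕ → PadicAlgCl p), HasCoeffs p n a g k (ξ u) c' → c' = C u := by
      intro u c' hc'
      funext r
      have := (hc' r).symm.trans (hC u r)
      exact mul_right_cancel₀ (pow_ne_zero _ hβ0) this
    refine ⟨fun c κ => C (xExp κ) (c + p ^ k * κ 0 - p ^ k * mFun (xExp κ)), fun c _ =>
      ⟨fun κ => hCR _ _, fun η hη => ?_⟩, ext_realize (fun u s hc => ?_) fun κ s hs => ?_⟩
    · -- the `ξ u` are small for all but finitely many `u`, and for those the coefficients tend to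
      -- zero separately
      obtain ⟨M, hM⟩ := h2 η hη
      have h4 : ∀ u, ∃ r, ∀ r', r ≤ r' → ‖C u r'‖ ≤ η := by
        intro u
        obtain ⟨r, hr⟩ := Metric.tendsto_atTop.1 (hC0 u) η hη
        exact ⟨r, fun r' hr' => by simpa using (hr r' hr').le⟩
      choose r hr using h4
      set R := (finite_wFun_lt n M).toFinset.sup r
      refine ⟨M.toNat + (n + 1) * R, fun κ hκ => ?_⟩
      rcases le_or_gt M (wFun (xExp κ)) with hw | hw
      · obtain ⟨c', hc', hc'η⟩ := hM _ hw
        dsimp only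
        rw [← huniq _ c' hc']
        exact hc'η _
      · refine hr _ _ (le_trans (Finset.le_sup ((finite_wFun_lt n M).mem_toFinset.2 hw)) ?_)
        set e := κ 0 - mFun (xExp κ) with he
        have h5 := degree_eq_wFun κ
        rw [← he] at h5
        have h6 : (n + 1) * R ≤ (n + 1) * e := by
          zify
          zify at hκ
          have := Int.self_le_toNat M
          linarith
        have h7 : R ≤ e := Nat.le_of_mul_le_mul_left h6 n.succ_pos
        have h8 : e ≤ p ^ k * e := Nat.le_mul_of_pos_left _ hN
        have h9 : p ^ k * κ 0 = p ^ k * e + p ^ k * mFun (xExp κ) := by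
          rw [← mul_add, Nat.sub_add_cancel (mFun_xExp_le κ)]
        omega
    · rw [h3, coeff_mul_monomial, if_neg (fun h => hc ((inCone_iff hN).2 h))]
    · have hc : p ^ k * mFun (xExp κ) ≤ s := (inCone_iff hN).1 (inCone_of_xExp_eq rfl hs)
      rw [h3, coeff_mul_monomial, if_pos hc, hC, mul_assoc, gamma_pow_eq hγ hβ κ hs, ← hs,
        Nat.mod_add_div]
  · rintro ⟨φ, hφ, rfl⟩
    have hY : ∀ (u : Fin n → ℤ) r, InCone (p ^ k) u (r + p ^ k * mFun u) := fun u r =>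
      (inCone_iff hN).2 (Nat.le_add_left _ _)
    have hdeg : ∀ (u : Fin n → ℤ) r, ((degree (yExp (p ^ k) u (r + p ^ k * mFun u)) : ℕ) : ℤ) =
        wFun u + (n + 1) * ((r / p ^ k : ℕ) : ℤ) := by
      intro u r
      rw [degree_eq_wFun, (hY u r).xExp_yExp, yExp_zero, Nat.add_mul_div_left _ _ hN,
        Nat.add_sub_cancel]
    have hsmall : ∀ η : ℝ, 0 < η → ∃ D : ℕ, ∀ u r,
        (D : ℤ) ≤ wFun u + (n + 1) * ((r / p ^ k : ℕ) : ℤ) →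
        ‖φ (r % p ^ k) (yExp (p ^ k) u (r + p ^ k * mFun u))‖ ≤ η := by
      intro η hη
      choose! D hD using fun c hc => (hφ c hc).small η hη
      refine ⟨(Finset.range (p ^ k)).sup D, fun u r hr => ?_⟩
      rw [← hdeg] at hr
      have hlt := Nat.mod_lt r hN
      refine hD _ hlt _ (le_trans (Finset.le_sup (Finset.mem_range.2 hlt)) ?_)
      exact_mod_cast hr
    have hcoef : ∀ u, HasCoeffs p n a g k (PowerSeries.mk fun r =>
        φ (r % p ^ k) (yExp (p ^ k) u (r + p ^ k * mFun u)) * β ^ (r * (n + 1)))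
        fun r => φ (r % p ^ k) (yExp (p ^ k) u (r + p ^ k * mFun u)) := fun u r => by
      rw [PowerSeries.coeff_mk]
    refine ⟨fun u => PowerSeries.mk fun r =>
      φ (r % p ^ k) (yExp (p ^ k) u (r + p ^ k * mFun u)) * β ^ (r * (n + 1)),
      fun u => ⟨_, fun r => (hφ _ (Nat.mod_lt r hN)).mem _, ?_, hcoef u⟩, fun ε hε => ?_,
      fun u => ?_⟩
    · rw [Metric.tendsto_atTop]
      intro ε hε
      obtain ⟨D, hD⟩ := hsmall (ε / 2) (half_pos hε)
      refine ⟨p ^ k * D, fun r hr => ?_⟩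
      rw [dist_zero_right]
      refine lt_of_le_of_lt (hD u r ?_) (half_lt_self hε)
      have h1 : D ≤ r / p ^ k := (Nat.le_div_iff_mul_le hN).2 (by rwa [mul_comm])
      have h2 : (0 : ℤ) ≤ wFun u := le_trans (by positivity) (le_wFun u).1
      have h3 : (D : ℤ) ≤ ((r / p ^ k : ℕ) : ℤ) := by exact_mod_cast h1
      have h4 : (0 : ℤ) ≤ n * ((r / p ^ k : ℕ) : ℤ) := by positivity
      linarith
    · obtain ⟨D, hD⟩ := hsmall ε hε
      refine ⟨D, fun u hu => ⟨_, hcoef u, fun r => hD u r ?_⟩⟩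
      have h4 : (0 : ℤ) ≤ (n + 1) * ((r / p ^ k : ℕ) : ℤ) := by positivity
      linarith
    · ext s
      rw [coeff_mul_monomial]
      split_ifs with hc
      · have hcone := (inCone_iff hN).2 hc
        have e := gamma_pow_eq hγ hβ (yExp (p ^ k) u s) (yExp_zero (p ^ k) u s).symm
        rw [hcone.xExp_yExp] at e
        rw [coeff_realize φ hcone.xExp_yExp (yExp_zero (p ^ k) u s).symm, ← e,
          PowerSeries.coeff_mk, Nat.sub_add_cancel hc, mul_assoc]
        congr 2
        conv_lhs => rw [← Nat.sub_add_cancel hc, Nat.add_mul_mod_self_left]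
      · exact coeff_realize_of_not φ fun h => hc ((inCone_iff hN).1 h)

end

/-! ### The operators `D_{t^{p^k}, l}` in terms of restricted power series -/

section
variable {p n a : ℕ} [hp : Fact p.Prime] {γ g : PadicAlgCl p} {k : ℕ}

/-- The series `h(y_i)` in one of the variables. -/
def varSer (h : ℕ → PadicAlgCl p) (i : Fin (n + 1)) : Ser p n := fun κ =>
  if κ = single i (κ i) then h (κ i) else 0

lemma varSer_single (h : ℕ → PadicAlgCl p) (i : Fin (n + 1)) (m : ℕ) :
    (varSer h i : Ser p n) (single i m) = h m := by
  rw [varSer, Finsupp.single_eq_same, if_pos rfl]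

lemma serMul_varSer (h : ℕ → PadicAlgCl p) (i : Fin (n + 1)) (f : Ser p n)
    (κ : Fin (n + 1) →₀ ℕ) : serMul (varSer h i) f κ =
      ∑ m ∈ Finset.range (κ i + 1), h m * f (κ - single i m) := by
  classical
  rw [serMul_apply]
  symm
  refine Finset.sum_bij_ne_zero (fun m _ _ => (single i m, κ - single i m))
    (fun m hm _ => ?_) (fun m _ _ m' _ _ h => ?_) (fun y hy hy0 => ?_) (fun m _ _ => ?_)
  · rw [Finset.HasAntidiagonal.mem_antidiagonal]
    exact add_tsub_cancel_of_le (single_le_of_mem_range hm)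
  · exact Finsupp.single_injective i (Prod.ext_iff.1 h).1
  · rw [Finset.HasAntidiagonal.mem_antidiagonal] at hy
    have h1 : y.1 = single i (y.1 i) := by
      by_contra h1
      rw [varSer, if_neg h1, zero_mul] at hy0
      exact hy0 rfl
    have h2 : κ - single i (y.1 i) = y.2 := by rw [← h1, ← hy, add_tsub_cancel_left]
    have h3 : y.1 i ∈ Finset.range (κ i + 1) := by
      rw [← hy, Finsupp.add_apply, Finset.mem_range]
      omega
    refine ⟨y.1 i, h3, ?_, ?_⟩
    · rw [h2]
      have := left_ne_zero_of_mul hy0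
      rw [h1, varSer_single] at this
      exact mul_ne_zero this (right_ne_zero_of_mul hy0)
    · rw [h2, ← h1]
  · dsimp only
    rw [varSer_single]

lemma serMul_sub_left (f f' φ : Ser p n) : serMul (f - f') φ = serMul f φ - serMul f' φ := by
  funext κ
  simp only [Pi.sub_apply, serMul_apply, sub_mul, Finset.sum_sub_distrib]

lemma diffOp_eq (h : ℕ → PadicAlgCl p) (l : Fin n) (f : Ser p n) (κ : Fin (n + 1) →₀ ℕ) :
    diffOp h l f κ = (xExp κ l : PadicAlgCl p) * f κ +
      serMul (varSer h l.succ - varSer h 0) f κ := by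
  rw [diffOp, LinearMap.sub_apply, Pi.sub_apply, coordOp_apply, coordOp_apply, serMul_sub_left,
    Pi.sub_apply, serMul_varSer, serMul_varSer, xExp]
  push_cast
  ring

lemma finsum_ite_eq_varSer (i : Fin (n + 1)) (κ : Fin (n + 1) →₀ ℕ) (hγ : γ ≠ 0) :
    (∑ᶠ j : ℕ, if κ = single i (p ^ j) then (p : PadicAlgCl p) ^ j * gammaSeq p γ j else 0) =
      varSer (twist p γ) i κ * γ ^ degree κ := by
  by_cases h : ∃ j, κ = single i (p ^ j)
  · obtain ⟨j, rfl⟩ := h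
    rw [varSer_single, Finsupp.degree_single, twist_pow, div_mul_cancel₀ _ (pow_ne_zero _ hγ),
      finsum_eq_single _ j, if_pos rfl]
    intro j' hj'
    refine if_neg fun h => hj' ?_
    exact (Nat.pow_right_injective hp.1.two_le (Finsupp.single_injective i h)).symm
  · rw [finsum_congr (fun j => if_neg fun hj => h ⟨j, hj⟩), finsum_zero, varSer]
    split_ifs with h1
    · rw [twist_of_ne, zero_mul]
      intro j hj
      exact h ⟨j, by rw [← hj]; exact h1⟩
    · rw [zero_mul]

lemma finite_support_ite (i : Fin (n + 1)) (κ : Fin (n + 1) →₀ ℕ) (b : ℕ → PadicAlgCl p) :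
    (Function.support fun j : ℕ => if κ = single i (p ^ j) then b j else 0).Finite := by
  refine Set.Subsingleton.finite fun j hj j' hj' => ?_
  rw [Function.mem_support, ne_eq, ite_eq_right_iff, not_forall] at hj hj'
  obtain ⟨h1, -⟩ := hj
  obtain ⟨h2, -⟩ := hj'
  exact Nat.pow_right_injective hp.1.two_le (Finsupp.single_injective i (h1.symm.trans h2))

lemma xExp_single_succ (l : Fin n) (m : ℕ) : xExp (single l.succ m) = Pi.single l (m : ℤ) := by
  funext l'
  rw [xExp, Finsupp.single_eq_of_ne (Fin.succ_ne_zero l).symm, Nat.cast_zero, sub_zero]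
  rcases eq_or_ne l' l with rfl | h
  · rw [Finsupp.single_eq_same, Pi.single_eq_same]
  · rw [Finsupp.single_eq_of_ne (fun h' => h (Fin.succ_injective _ h')), Pi.single_eq_of_ne h,
      Nat.cast_zero]

lemma xExp_single_zero (m : ℕ) : xExp (single (0 : Fin (n + 1)) m) = fun _ => -(m : ℤ) := by
  funext l'
  rw [xExp, Finsupp.single_eq_same, Finsupp.single_eq_of_ne (Fin.succ_ne_zero l'), Nat.cast_zero,
    zero_sub]

lemma serK_apply (N M : ℕ) (u : Fin n → ℤ) : serK p n N M u =
    (∑ j : Fin n, if u = Pi.single j (M : ℤ) then 1 else 0) +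
      if u = (fun _ => -(M : ℤ)) then PowerSeries.X ^ N else 0 := by
  classical
  have h : ∀ (v : Fin n → ℤ) (c : PowerSeries (PadicAlgCl p)),
      mono v c u = if u = v then c else 0 := fun v c => by
    rw [mono, Pi.single_apply]
  rw [serK, Pi.add_apply, Finset.sum_apply, h]
  simp only [h]

lemma finite_support_serH (hn : 1 ≤ n) (u : Fin n → ℤ) : (Function.support fun i : ℕ =>
    PowerSeries.C (gammaSeq p γ i) * serK p n (p ^ (i + k)) (p ^ i) u).Finite := by
  refine (Set.finite_Iio (∑ l, (u l).natAbs)).subset fun i hi => ?_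
  have hi' := right_ne_zero_of_mul (Function.mem_support.1 hi)
  rw [Set.mem_Iio]
  have hlt : i < p ^ i := Nat.lt_pow_self hp.1.one_lt
  have hle : ∀ l, (u l).natAbs ≤ ∑ l, (u l).natAbs := fun l =>
    Finset.single_le_sum (f := fun l => (u l).natAbs) (fun _ _ => Nat.zero_le _)
      (Finset.mem_univ l)
  by_contra hge
  refine hi' ?_
  rw [serK_apply, if_neg, Finset.sum_eq_zero, add_zero]
  · intro j _
    refine if_neg fun h => ?_
    have := hle j
    rw [h, Pi.single_eq_same] at this
    rw [h] at hge
    omega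
  · intro h
    have := hle ⟨0, hn⟩
    rw [congrFun h ⟨0, hn⟩] at this
    omega

/-- The coefficient of `t ^ s` in the coefficient of `x ^ u` in `x_l ∂H/∂x_l`. -/
lemma coeff_eulerOp_serH (hn : 1 ≤ n) (l : Fin n) (u : Fin n → ℤ) (s : ℕ) :
    PowerSeries.coeff s (eulerOp l (serH p n γ k) u) =
      ∑ᶠ i : ℕ, ((if u = Pi.single l ((p ^ i : ℕ) : ℤ) ∧ s = 0 then
          (p : PadicAlgCl p) ^ i * gammaSeq p γ i else 0) -
        if u = (fun _ => -((p ^ i : ℕ) : ℤ)) ∧ s = p ^ (i + k) then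
          (p : PadicAlgCl p) ^ i * gammaSeq p γ i else 0) := by
  have e : PowerSeries.coeff s (eulerOp l (serH p n γ k) u) =
      ((LinearMap.toAddMonoidHom (PowerSeries.coeff (R := PadicAlgCl p) s)).comp
        (smulAddHom ℤ (PowerSeries (PadicAlgCl p)) (u l))) (serH p n γ k u) := rfl
  rw [e, serH, AddMonoidHom.map_finsum _ (finite_support_serH hn u)]
  refine finsum_congr fun i => ?_
  rw [AddMonoidHom.comp_apply, smulAddHom_apply, LinearMap.toAddMonoidHom_coe, map_zsmul,
    PowerSeries.coeff_C_mul, serK_apply, map_add, map_sum, zsmul_eq_mul, mul_add, mul_add]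
  have h1 : ((u l : ℤ) : PadicAlgCl p) * (gammaSeq p γ i * ∑ j : Fin n, PowerSeries.coeff s
      (if u = Pi.single j ((p ^ i : ℕ) : ℤ) then (1 : PowerSeries (PadicAlgCl p)) else 0)) =
      if u = Pi.single l ((p ^ i : ℕ) : ℤ) ∧ s = 0 then
        (p : PadicAlgCl p) ^ i * gammaSeq p γ i else 0 := by
    rw [Finset.mul_sum, Finset.mul_sum, Finset.sum_eq_single l]
    · by_cases h : u = Pi.single l ((p ^ i : ℕ) : ℤ)
      · rw [if_pos h, PowerSeries.coeff_one]
        by_cases hs : s = 0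
        · rw [if_pos hs, if_pos ⟨h, hs⟩, h, Pi.single_eq_same]
          push_cast
          ring
        · rw [if_neg hs, if_neg fun h => hs h.2, mul_zero, mul_zero]
      · rw [if_neg h, if_neg fun h' => h h'.1, map_zero, mul_zero, mul_zero]
    · intro j _ hj
      by_cases h : u = Pi.single j ((p ^ i : ℕ) : ℤ)
      · rw [h, Pi.single_eq_of_ne hj.symm, Int.cast_zero, zero_mul]
      · rw [if_neg h, map_zero, mul_zero, mul_zero]
    · intro h; exact absurd (Finset.mem_univ l) h
  rw [h1, sub_eq_add_neg]
  congr 1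
  by_cases h : u = (fun _ => -((p ^ i : ℕ) : ℤ))
  · rw [if_pos h, PowerSeries.coeff_X_pow]
    by_cases hs : s = p ^ (i + k)
    · rw [if_pos hs, if_pos ⟨h, hs⟩, h]
      push_cast
      ring
    · rw [if_neg hs, if_neg fun h => hs h.2, mul_zero, mul_zero, neg_zero]
  · rw [if_neg h, if_neg fun h' => h h'.1, map_zero, mul_zero, mul_zero, neg_zero]

lemma eulerOp_serH_eq (hn : 1 ≤ n) (hγ : γ ≠ 0) (β : PadicAlgCl p) (l : Fin n) :
    eulerOp l (serH p n γ k) = realize (p ^ k) γ β fun c => if c = 0 then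
      varSer (twist p γ) l.succ - varSer (twist p γ) 0 else 0 := by
  have hN : 0 < p ^ k := pow_pos hp.1.pos k
  refine ext_realize (fun u s hc => ?_) fun κ s hs => ?_
  · rw [coeff_eulerOp_serH hn]
    refine (finsum_congr fun i => ?_).trans finsum_zero
    rw [if_neg, if_neg, sub_zero]
    · rintro ⟨rfl, rfl⟩
      refine hc (inCone_of_xExp_eq (xExp_single_zero (p ^ i)) ?_)
      rw [Finsupp.single_eq_same, pow_add, Nat.mul_div_cancel _ hN]
    · rintro ⟨rfl, rfl⟩
      refine hc (inCone_of_xExp_eq (xExp_single_succ l (p ^ i)) ?_)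
      rw [Finsupp.single_eq_of_ne (Fin.succ_ne_zero l).symm, Nat.zero_div]
  · have h1 : ∀ i, (xExp κ = Pi.single l ((p ^ i : ℕ) : ℤ) ∧ s = 0) ↔
        (s % p ^ k = 0 ∧ κ = single l.succ (p ^ i)) := by
      intro i
      constructor
      · rintro ⟨h1, rfl⟩
        refine ⟨Nat.zero_mod _, ?_⟩
        rw [eq_yExp h1 hs]
        refine (eq_yExp (xExp_single_succ l (p ^ i)) ?_).symm
        rw [Finsupp.single_eq_of_ne (Fin.succ_ne_zero l).symm, Nat.zero_div]
      · rintro ⟨h1, rfl⟩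
        refine ⟨xExp_single_succ l _, ?_⟩
        rw [Finsupp.single_eq_of_ne (Fin.succ_ne_zero l).symm] at hs
        rw [← Nat.mod_add_div s (p ^ k), h1, hs]
        rfl
    have h2 : ∀ i, (xExp κ = (fun _ => -((p ^ i : ℕ) : ℤ)) ∧ s = p ^ (i + k)) ↔
        (s % p ^ k = 0 ∧ κ = single 0 (p ^ i)) := by
      intro i
      constructor
      · rintro ⟨h3, rfl⟩
        refine ⟨by rw [pow_add, Nat.mul_mod_left], ?_⟩
        rw [eq_yExp h3 hs]
        refine (eq_yExp (xExp_single_zero (p ^ i)) ?_).symm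
        rw [Finsupp.single_eq_same, pow_add, Nat.mul_div_cancel _ hN]
      · rintro ⟨h3, rfl⟩
        refine ⟨xExp_single_zero _, ?_⟩
        rw [Finsupp.single_eq_same] at hs
        rw [← Nat.mod_add_div s (p ^ k), h3, hs, zero_add, pow_add, mul_comm]
    rw [coeff_eulerOp_serH hn]
    simp only [h1, h2]
    by_cases hc : s % p ^ k = 0
    · simp only [hc, true_and, if_true]
      rw [finsum_sub_distrib (finite_support_ite _ κ _) (finite_support_ite _ κ _),
        finsum_ite_eq_varSer _ κ hγ, finsum_ite_eq_varSer _ κ hγ, mul_zero, pow_zero, mul_one,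
        Pi.sub_apply, sub_mul]
    · simp only [hc, false_and, if_false, sub_zero, finsum_zero, Pi.zero_apply, zero_mul]

/-- `D_{t^{p^k}, l}` acts on each member of the family of power series separately. -/
theorem opD_realize (hn : 1 ≤ n) (hγ : γ ≠ 0) (β : PadicAlgCl p) (l : Fin n) (φ : ℕ → Ser p n) :
    opD p n γ k l (realize (p ^ k) γ β φ) =
      realize (p ^ k) γ β fun c => diffOp (twist p γ) l (φ c) := by
  have hN : 0 < p ^ k := pow_pos hp.1.pos k
  rw [opD, eulerOp_serH_eq hn hγ β l, lmul_realize hN]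
  refine ext_realize (fun u s hc => ?_) fun κ s hs => ?_
  · rw [Pi.add_apply, map_add, coeff_realize_of_not _ hc, add_zero, eulerOp, map_zsmul,
      coeff_realize_of_not _ hc, smul_zero]
  · rw [Pi.add_apply, map_add, eulerOp, map_zsmul, coeff_realize _ rfl hs,
      coeff_realize _ rfl hs, diffOp_eq, zsmul_eq_mul]
    ring

end

/-! ### Combinations of the basis elements -/

section
variable {p n a : ℕ} [hp : Fact p.Prime] {γ g β : PadicAlgCl p} {N k : ℕ}

lemma stairExp_zero_right (d : ℕ) : stairExp n d 0 = d / (n + 1) := by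
  rw [stairExp_apply, if_neg, add_zero]
  rintro ⟨h, -⟩
  exact absurd h (by simp)

lemma xExp_eq_stairs_iff (κ : Fin (n + 1) →₀ ℕ) (j : Fin (n + 1)) :
    xExp κ = stairs j ↔ κ = stairExp n ((n + 1) * κ 0 + j) := by
  have h1 : ((n + 1) * κ 0 + j) / (n + 1) = κ 0 := by
    rw [Nat.mul_add_div n.succ_pos, Nat.div_eq_of_lt j.2, add_zero]
  have h2 : ((n + 1) * κ 0 + j) % (n + 1) = j := by
    rw [Nat.mul_add_mod, Nat.mod_eq_of_lt j.2]
  constructor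
  · intro h
    ext i
    rw [stairExp_apply, h1, h2]
    refine Fin.cases (by simp) (fun l => ?_) i
    have := congrFun h l
    rw [xExp, stairs] at this
    rw [Fin.val_succ]
    split_ifs at this ⊢ <;> omega
  · intro h
    funext l
    have := congrArg (fun v => v l.succ) h
    simp only [stairExp_apply, h1, h2, Fin.val_succ] at this
    rw [xExp, stairs, this]
    split_ifs <;> omega

lemma coeff_mul_basisE (A : PowerSeries (PadicAlgCl p)) (j : Fin (n + 1)) (u : Fin n → ℤ) (s : ℕ) :
    PowerSeries.coeff s (A * basisE p n γ j u) =
      if u = stairs j then PowerSeries.coeff s A * γ ^ j.val else 0 := by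
  rw [basisE, mono, Pi.single_apply]
  split_ifs
  · rw [PowerSeries.coeff_mul_C]
  · rw [mul_zero, map_zero]

/-- The combination `∑ j, A_j e_j` of the basis elements, in terms of the coefficients of the
`A_j`. -/
lemma sum_mul_basisE (hβ : β ^ N = γ) {A : Fin (n + 1) → PowerSeries (PadicAlgCl p)}
    {c : Fin (n + 1) → ℕ → PadicAlgCl p}
    (hc : ∀ j r, PowerSeries.coeff r (A j) = c j r * β ^ (r * (n + 1))) :
    (fun u => ∑ j, A j * basisE p n γ j u) = realize N γ β fun b =>
      stairSer fun d => c (Fin.ofNat (n + 1) d) (b + N * (d / (n + 1))) := by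
  refine ext_realize (fun u s h => ?_) fun κ s hs => ?_
  · rw [map_sum]
    refine Finset.sum_eq_zero fun j _ => ?_
    rw [coeff_mul_basisE, if_neg]
    rintro rfl
    refine h fun l => add_nonneg (Int.natCast_nonneg _) ?_
    rw [stairs]
    split_ifs
    · exact zero_le_one
    · exact le_rfl
  · have hdeg : ∀ j : Fin (n + 1), κ = stairExp n ((n + 1) * κ 0 + j) →
        degree κ = (n + 1) * κ 0 + j := fun j h => by
      rw [congrArg degree h, degree_stairExp]
    rw [map_sum, stairSer_apply]
    simp only [coeff_mul_basisE, xExp_eq_stairs_iff]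
    by_cases h : κ = stairExp n (degree κ)
    · have h0 : κ 0 = degree κ / (n + 1) := by
        conv_lhs => rw [h, stairExp_zero_right]
      have hd : degree κ = (n + 1) * κ 0 + (Fin.ofNat (n + 1) (degree κ)).val := by
        rw [h0]
        exact (Nat.div_add_mod _ _).symm
      rw [if_pos h, Finset.sum_eq_single (Fin.ofNat (n + 1) (degree κ)), ← hd, if_pos h, hc, ← h0,
        ← hs, Nat.mod_add_div]
      · have hγ : γ ^ ((n + 1) * κ 0) = β ^ (N * ((n + 1) * (s / N))) := by
          rw [← hβ, ← pow_mul, hs]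
        have hγ' := congrArg (γ ^ ·) hd
        rw [pow_add, hγ] at hγ'
        rw [hγ']
        have : β ^ (s * (n + 1)) = β ^ (N * ((n + 1) * (s / N))) * β ^ ((n + 1) * (s % N)) := by
          rw [← pow_add]
          congr 1
          conv_lhs => rw [← Nat.mod_add_div s N]
          ring
        rw [this]
        ring
      · intro j _ hj
        rw [if_neg]
        intro h'
        refine hj (Fin.ext ?_)
        have := hdeg j h'
        omega
      · intro h'
        exact absurd (Finset.mem_univ _) h'
    · rw [if_neg h, zero_mul]
      refine Finset.sum_eq_zero fun j _ => if_neg fun h' => h ?_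
      rw [hdeg j h']
      exact h'

lemma basisE_eq_realize (j : Fin (n + 1)) : basisE p n γ j =
    realize N γ β fun b => if b = 0 then Pi.single (stairExp n j) 1 else 0 := by
  have h1 : ∀ u s, PowerSeries.coeff s (basisE p n γ j u) =
      if u = stairs j ∧ s = 0 then γ ^ j.val else 0 := fun u s => by
    rw [← one_mul (basisE p n γ j u), coeff_mul_basisE, PowerSeries.coeff_one]
    by_cases hu : u = stairs j
    · by_cases hs : s = 0
      · rw [if_pos hu, if_pos hs, if_pos ⟨hu, hs⟩, one_mul]
      · rw [if_pos hu, if_neg hs, if_neg fun h => hs h.2, zero_mul]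
    · rw [if_neg hu, if_neg fun h => hu h.1]
  have hj : stairExp n j 0 = 0 := by
    rw [stairExp_zero_right, Nat.div_eq_of_lt j.2]
  refine ext_realize (fun u s h => ?_) fun κ s hs => ?_
  · rw [h1, if_neg]
    rintro ⟨rfl, -⟩
    refine h fun l => add_nonneg (Int.natCast_nonneg _) ?_
    rw [stairs]
    split_ifs
    · exact zero_le_one
    · exact le_rfl
  · have h2 : (xExp κ = stairs j ∧ s = 0) ↔ (s % N = 0 ∧ κ = stairExp n j) := by
      rw [xExp_eq_stairs_iff]
      constructor
      · rintro ⟨h, rfl⟩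
        rw [Nat.zero_div] at hs
        rw [← hs, mul_zero, zero_add] at h
        exact ⟨Nat.zero_mod _, h⟩
      · rintro ⟨h, h'⟩
        have h0 : κ 0 = 0 := by rw [h', hj]
        refine ⟨by rwa [h0, mul_zero, zero_add], ?_⟩
        rw [← Nat.mod_add_div s N, h, hs, h0]
        rfl
    rw [h1]
    by_cases h : s % N = 0 ∧ κ = stairExp n j
    · rw [if_pos (h2.2 h), if_pos h.1, h.1, h.2, Pi.single_eq_same, degree_stairExp, mul_zero,
        pow_zero, one_mul, mul_one]
    · rw [if_neg (fun h' => h (h2.1 h'))]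
      by_cases hs0 : s % N = 0
      · rw [if_pos hs0, Pi.single_eq_of_ne (fun h' => h ⟨hs0, h'⟩), zero_mul]
      · rw [if_neg hs0, Pi.zero_apply, zero_mul]

/-! ### Boundaries -/

/-- Multiplication by a power series in `t` commutes with multiplication by a series in the
`y_l`. -/
lemma lmul_const_mul (hN : 0 < N) (f : Ser p n) (φ : ℕ → Ser p n)
    (A : PowerSeries (PadicAlgCl p)) :
    lmul (realize N γ β fun c => if c = 0 then f else 0) (fun u => A * realize N γ β φ u) =
      fun u => A * lmul (realize N γ β fun c => if c = 0 then f else 0) (realize N γ β φ) u := by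
  funext u
  ext s
  have hfin := fun s' => (Finset.finite_toSet _).subset
    (finite_support_lmul (γ := γ) (β := β) hN f φ u s')
  rw [lmul, PowerSeries.coeff_mk, PowerSeries.coeff_mul]
  simp only [lmul, PowerSeries.coeff_mk]
  have h1 : ∀ v, PowerSeries.coeff s (realize N γ β (fun c => if c = 0 then f else 0) v *
      (A * realize N γ β φ (u - v))) = ∑ x ∈ Finset.HasAntidiagonal.antidiagonal s,
        PowerSeries.coeff x.1 A * PowerSeries.coeff x.2
          (realize N γ β (fun c => if c = 0 then f else 0) v * realize N γ β φ (u - v)) :=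
    fun v => by rw [mul_left_comm, PowerSeries.coeff_mul]
  simp only [h1]
  rw [finsum_sum_comm]
  · exact Finset.sum_congr rfl fun x _ => (mul_finsum _ _).symm
  · intro x _
    exact (hfin x.2).subset (Function.support_mul_subset_right _ _)

lemma rootGamma_pow (hg : g ^ p ^ a = γ) (hk : k ≤ a) : rootGamma p a g k ^ p ^ k = γ := by
  rw [rootGamma, ← pow_mul, ← pow_add, Nat.sub_add_cancel hk, hg]

lemma opD_const_mul (hn : 1 ≤ n) (hγ : γ ≠ 0) (β : PadicAlgCl p) (l : Fin n) (φ : ℕ → Ser p n)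
    (A : PowerSeries (PadicAlgCl p)) :
    opD p n γ k l (fun u => A * realize (p ^ k) γ β φ u) =
      fun u => A * opD p n γ k l (realize (p ^ k) γ β φ) u := by
  rw [opD, opD, eulerOp_serH_eq hn hγ β l, lmul_const_mul (pow_pos hp.1.pos k)]
  funext u
  rw [Pi.add_apply, Pi.add_apply, mul_add, eulerOp, eulerOp, mul_smul_comm]

lemma realize_sum {ι : Type*} [Fintype ι] (φ : ι → ℕ → Ser p n) :
    (realize N γ β fun c => ∑ i, φ i c) = ∑ i, realize N γ β (φ i) := by
  have h : (fun c => ∑ i, φ i c) = ∑ i, φ i := by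
    funext c
    rw [Finset.sum_apply]
  rw [h]
  exact map_sum (realizeHom N γ β) _ _

lemma diffOp_zsmul (h : ℕ → PadicAlgCl p) (l : Fin n) (e : ℤ) (f : Ser p n) :
    diffOp h l (e • f) = e • diffOp h l f := map_zsmul (diffOp h l) e f

lemma IsRestricted.zsmul {f : Ser p n} (hf : IsRestricted p n a g f) (e : ℤ) :
    IsRestricted p n a g (e • f) := by
  refine ⟨fun κ => zsmul_mem (hf.mem κ) e, fun η hη => ?_⟩
  obtain ⟨D, hD⟩ := hf.small η hη
  refine ⟨D, fun κ hκ => ?_⟩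
  rw [Pi.smul_apply, zsmul_eq_mul, norm_mul]
  exact (mul_le_of_le_one_left (norm_nonneg _) (norm_intCast_le p e)).trans (hD κ hκ)

lemma koszulTop_realize (hn : 1 ≤ n) (hγ : γ ≠ 0) (β : PadicAlgCl p) (φ : Fin n → ℕ → Ser p n) :
    koszulTop p n γ k (fun l => realize (p ^ k) γ β (φ l)) =
      realize (p ^ k) γ β fun c => ∑ l, diffOp (twist p γ) l ((-1 : ℤ) ^ l.val • φ l c) := by
  rw [koszulTop, realize_sum]
  refine Finset.sum_congr rfl fun l _ => ?_
  rw [opD_realize hn hγ]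
  simp only [diffOp_zsmul]
  exact (map_zsmul (realizeHom (p ^ k) γ β) ((-1 : ℤ) ^ l.val)
    fun c => diffOp (twist p γ) l (φ l c)).symm

/-- The boundaries are already a submodule, and they correspond to the sums of the images of the
operators `diffOp`, one for each class of exponents of `t` modulo `p ^ k`. -/
theorem mem_boundaries_iff (hn : 1 ≤ n) (hγ : γ ≠ 0) (hβ : rootGamma p a g k ^ p ^ k = γ)
    (x : modC p n a γ g k) : x ∈ boundaries p n a γ g k ↔ ∃ φ : Fin n → ℕ → Ser p n,
      (∀ l, ∀ c < p ^ k, IsRestricted p n a g (φ l c)) ∧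
      (x : Laurent p n) = realize (p ^ k) γ (rootGamma p a g k) fun c =>
        ∑ l, diffOp (twist p γ) l (φ l c) := by
  set β := rootGamma p a g k with hβd
  rw [boundaries, Submodule.mem_comap, Submodule.subtype_apply]
  constructor
  · intro hx
    refine Submodule.span_induction ?_ ?_ ?_ ?_ hx
    · rintro f ⟨ζ, hζ, rfl⟩
      choose φ hφ h using fun l => (mem_modC_iff hγ hβ).1 (hζ l)
      refine ⟨fun l c => (-1 : ℤ) ^ l.val • φ l c, fun l c hc => (hφ l c hc).zsmul _, ?_⟩
      rw [← koszulTop_realize hn hγ]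
      exact congrArg _ (funext h)
    · refine ⟨fun _ _ => 0, fun _ _ _ => .zero, ?_⟩
      simp only [map_zero, Finset.sum_const_zero]
      exact realize_zero.symm
    · rintro f f' - - ⟨φ, hφ, rfl⟩ ⟨φ', hφ', rfl⟩
      refine ⟨fun l c => φ l c + φ' l c, fun l c hc => (hφ l c hc).add (hφ' l c hc), ?_⟩
      rw [← realize_add]
      congr 1
      funext c
      simp only [Pi.add_apply, map_add, Finset.sum_add_distrib]
    · rintro A f - ⟨φ, hφ, rfl⟩
      have h1 : ∀ l, realize (p ^ k) γ β (φ l) ∈ modC p n a γ g k := fun l =>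
        (mem_modC_iff hγ hβ).2 ⟨φ l, hφ l, rfl⟩
      choose φ' hφ' h' using fun l => (mem_modC_iff hγ hβ).1 ((modC p n a γ g k).smul_mem A (h1 l))
      refine ⟨φ', hφ', ?_⟩
      rw [← hβd] at h'
      have h2 : ∀ φ : Fin n → ℕ → Ser p n,
          (realize (p ^ k) γ β fun c => ∑ l, diffOp (twist p γ) l (φ l c)) =
            ∑ l, opD p n γ k l (realize (p ^ k) γ β (φ l)) := fun φ => by
        simp only [opD_realize hn hγ]
        exact realize_sum _
      rw [h2, h2, Finset.smul_sum]
      refine Finset.sum_congr rfl fun l _ => ?_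
      rw [← h' l]
      exact (opD_const_mul hn hγ β l (φ l) A).symm
  · rintro ⟨φ, hφ, h⟩
    refine Submodule.subset_span ⟨fun l => realize (p ^ k) γ β fun c => (-1 : ℤ) ^ l.val • φ l c,
      fun l => (mem_modC_iff hγ hβ).2 ⟨_, fun c hc => (hφ l c hc).zsmul _, rfl⟩, ?_⟩
    rw [koszulTop_realize hn hγ, h]
    simp only [smul_smul, ← mul_pow, neg_mul_neg, one_mul, one_pow, one_smul]

end

/-! ### The basis of the cohomology -/

section
variable {p n a : ℕ} [hp : Fact p.Prime] {γ g : PadicAlgCl p} {k : ℕ}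

lemma basisE_mem (hγ : γ ≠ 0) (hβ : rootGamma p a g k ^ p ^ k = γ) (j : Fin (n + 1)) :
    basisE p n γ j ∈ modC p n a γ g k := by
  refine (mem_modC_iff hγ hβ).2 ⟨_, fun c _ => ?_, basisE_eq_realize j⟩
  split_ifs
  · exact IsRestricted.single _ (one_mem _)
  · exact .zero

/-- The class of `e_j`. -/
def basisCls (n : ℕ) (hγ : γ ≠ 0) (hβ : rootGamma p a g k ^ p ^ k = γ) (j : Fin (n + 1)) :
    HTop p n a γ g k := cls p n a γ g k (basisE p n γ j) (basisE_mem hγ hβ j)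

/-- A combination of the classes of the `e_j` is the class of the combination. -/
lemma sum_smul_basisCls (hγ : γ ≠ 0) (hβ : rootGamma p a g k ^ p ^ k = γ)
    {A : Fin (n + 1) → ringO p n a g k} {c : Fin (n + 1) → ℕ → PadicAlgCl p}
    (hc : ∀ j, HasCoeffs p n a g k (A j) (c j)) :
    ∃ y : modC p n a γ g k, ∑ j, A j • basisCls n hγ hβ j = Submodule.Quotient.mk y ∧
      (y : Laurent p n) = realize (p ^ k) γ (rootGamma p a g k) fun b =>
        stairSer fun d => c (Fin.ofNat (n + 1) d) (b + p ^ k * (d / (n + 1))) := by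
  refine ⟨∑ j, A j • ⟨basisE p n γ j, basisE_mem hγ hβ j⟩, ?_, ?_⟩
  · rw [← Submodule.mkQ_apply, map_sum]
    rfl
  · rw [← sum_mul_basisE hβ hc, Submodule.coe_sum]
    funext u
    rw [Finset.sum_apply]
    rfl

lemma mk_eq_mk_of_realize (hn : 1 ≤ n) (hγ : γ ≠ 0) (hβ : rootGamma p a g k ^ p ^ k = γ)
    {x y : modC p n a γ g k} {φ φ' : ℕ → Ser p n} {G : Fin n → ℕ → Ser p n}
    (hx : (x : Laurent p n) = realize (p ^ k) γ (rootGamma p a g k) φ)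
    (hy : (y : Laurent p n) = realize (p ^ k) γ (rootGamma p a g k) φ')
    (hG : ∀ l, ∀ c < p ^ k, IsRestricted p n a g (G l c))
    (h : ∀ c < p ^ k, φ c = φ' c + ∑ l, diffOp (twist p γ) l (G l c)) :
    (Submodule.Quotient.mk x : HTop p n a γ g k) = Submodule.Quotient.mk y := by
  rw [Submodule.Quotient.eq, mem_boundaries_iff hn hγ hβ]
  refine ⟨G, hG, ?_⟩
  rw [Submodule.coe_sub, sub_eq_iff_eq_add', hx, hy, ← realize_add]
  exact realize_congr (pow_pos hp.1.pos k) h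

/-- Every class is a combination of the classes of the `e_j`, and a growth condition on the
coefficients of a representative carries over to the coefficients of the combination. -/
theorem exists_eq_sum_basisCls (hn : 1 ≤ n) (ha : 1 ≤ a) (hγ : γ ≠ 0)
    (hβ : rootGamma p a g k ^ p ^ k = γ) (hh : IsTwist p a g (twist p γ)) {B : ℕ → ℝ} {r : ℝ}
    (hB : ∀ c, 0 ≤ B c) (hr : (p : ℝ)⁻¹ ≤ r) (hr1 : r ≤ 1) {φ : ℕ → Ser p n}
    (hφ : ∀ c < p ^ k, IsRestricted p n a g (φ c))
    (hφB : ∀ c < p ^ k, ∀ κ, ‖φ c κ‖ ≤ B c * r ^ degree κ) {x : modC p n a γ g k}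
    (hx : (x : Laurent p n) = realize (p ^ k) γ (rootGamma p a g k) φ) :
    ∃ (A : Fin (n + 1) → ringO p n a g k) (c : Fin (n + 1) → ℕ → PadicAlgCl p),
      (∀ j, HasCoeffs p n a g k (A j) (c j)) ∧
      (∀ j s, c j s ∈ intRing p a g ∧
        ‖c j s‖ ≤ B (s % p ^ k) * r ^ ((n + 1) * (s / p ^ k) + j)) ∧
      Submodule.Quotient.mk x = ∑ j, A j • basisCls n hγ hβ j := by
  have hN : 0 < p ^ k := pow_pos hp.1.pos k
  have key : ∀ c, ∃ (d : ℕ → PadicAlgCl p) (G : Fin n → Ser p n), c < p ^ k →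
      (∀ e, d e ∈ intRing p a g ∧ ‖d e‖ ≤ B c * r ^ e) ∧
      (∀ η : ℝ, 0 < η → ∃ D : ℕ, ∀ e, D ≤ e → ‖d e‖ ≤ η) ∧
      (∀ l, IsRestricted p n a g (G l)) ∧
      φ c = stairSer d + ∑ l, diffOp (twist p γ) l (G l) := by
    intro c
    by_cases hc : c < p ^ k
    · obtain ⟨d, G, h⟩ := exists_eq_stairSer_add ha hh (hB c) hr hr1 (hφ c hc) (hφB c hc)
      exact ⟨d, G, fun _ => h⟩
    · exact ⟨0, 0, fun h => absurd h hc⟩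
  choose d G h1 h2 h3 h4 using key
  let c : Fin (n + 1) → ℕ → PadicAlgCl p := fun j s =>
    d (s % p ^ k) ((n + 1) * (s / p ^ k) + j)
  have hmod : ∀ s, s % p ^ k < p ^ k := fun s => Nat.mod_lt s hN
  have hc0 : ∀ j, Filter.Tendsto (c j) Filter.atTop (nhds 0) := by
    intro j
    rw [Metric.tendsto_atTop]
    intro ε hε
    choose! D hD using fun b hb => h2 b hb (ε / 2) (half_pos hε)
    refine ⟨p ^ k * (Finset.range (p ^ k)).sup D, fun s hs => ?_⟩
    rw [dist_zero_right]
    refine lt_of_le_of_lt (hD _ (hmod s) _ ?_) (half_lt_self hε)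
    have e1 : D (s % p ^ k) ≤ (Finset.range (p ^ k)).sup D :=
      Finset.le_sup (Finset.mem_range.2 (hmod s))
    have e2 : (Finset.range (p ^ k)).sup D ≤ s / p ^ k := by
      rwa [Nat.le_div_iff_mul_le hN, mul_comm]
    have e3 : s / p ^ k ≤ (n + 1) * (s / p ^ k) := Nat.le_mul_of_pos_left _ n.succ_pos
    omega
  let A : Fin (n + 1) → ringO p n a g k := fun j =>
    ⟨PowerSeries.mk fun s => c j s * rootGamma p a g k ^ (s * (n + 1)), c j,
      fun s => (h1 _ (hmod s) _).1, hc0 j, fun s => PowerSeries.coeff_mk _ _⟩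
  have hA : ∀ j, HasCoeffs p n a g k (A j) (c j) := fun j s =>
    PowerSeries.coeff_mk s fun s => c j s * rootGamma p a g k ^ (s * (n + 1))
  refine ⟨A, c, hA, fun j s => h1 _ (hmod s) _, ?_⟩
  obtain ⟨y, hy, hy'⟩ := sum_smul_basisCls hγ hβ hA
  rw [hy]
  refine mk_eq_mk_of_realize hn hγ hβ hx hy' (G := fun l c => G c l) (fun l c hc => h3 c hc l) ?_
  intro b hb
  rw [h4 b hb]
  congr 2
  funext e
  change d b e = d ((b + p ^ k * (e / (n + 1))) % p ^ k)
    ((n + 1) * ((b + p ^ k * (e / (n + 1))) / p ^ k) + e % (n + 1))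
  rw [add_mul_div_of_lt hb, add_mul_mod_of_lt hb, Nat.div_add_mod]

lemma linearIndependent_basisCls (hn : 1 ≤ n) (hγ : γ ≠ 0)
    (hβ : rootGamma p a g k ^ p ^ k = γ) (hh : IsTwist p a g (twist p γ)) :
    LinearIndependent (ringO p n a g k) (basisCls n hγ hβ) := by
  have hN : 0 < p ^ k := pow_pos hp.1.pos k
  have hβ0 : rootGamma p a g k ≠ 0 := by
    intro h
    rw [h, zero_pow hN.ne'] at hβ
    exact hγ hβ.symm
  rw [Fintype.linearIndependent_iff]
  intro A hA j
  choose c hc hc0 hAc using fun j => (A j).2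
  obtain ⟨y, hy, hy'⟩ := sum_smul_basisCls hγ hβ hAc
  rw [hA, eq_comm, Submodule.Quotient.mk_eq_zero, mem_boundaries_iff hn hγ hβ] at hy
  obtain ⟨φ, hφ, h⟩ := hy
  rw [hy'] at h
  refine Subtype.ext (PowerSeries.ext fun s => ?_)
  have hs : s % p ^ k < p ^ k := Nat.mod_lt s hN
  have h1 := eq_zero_of_stairSer_eq hh ?_ (fun l => hφ l _ hs) (realize_injective hγ hβ0 h hs)
  · have h2 := congrFun h1 ((n + 1) * (s / p ^ k) + j)
    have h3 : Fin.ofNat (n + 1) ((n + 1) * (s / p ^ k) + j) = j := by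
      refine Fin.ext ?_
      change ((n + 1) * (s / p ^ k) + j) % (n + 1) = j
      rw [Nat.mul_add_mod, Nat.mod_eq_of_lt j.2]
    rw [h3, Nat.mul_add_div n.succ_pos, Nat.div_eq_of_lt j.2, add_zero, Nat.mod_add_div] at h2
    rw [hAc j s, h2]
    simp
  · intro η hη
    have h2 := fun j => (Metric.tendsto_atTop.1 (hc0 j)) η hη
    choose D hD using h2
    refine ⟨(n + 1) * Finset.univ.sup D, fun d hd => ?_⟩
    have h3 : Finset.univ.sup D ≤ d / (n + 1) := by
      rwa [Nat.le_div_iff_mul_le n.succ_pos, mul_comm]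
    have h4 : d / (n + 1) ≤ p ^ k * (d / (n + 1)) := Nat.le_mul_of_pos_left _ hN
    have h5 : D (Fin.ofNat (n + 1) d) ≤ Finset.univ.sup D := Finset.le_sup (Finset.mem_univ _)
    have h6 := hD (Fin.ofNat (n + 1) d) (s % p ^ k + p ^ k * (d / (n + 1)))
      (h5.trans (h3.trans (h4.trans (Nat.le_add_left _ _))))
    rw [dist_zero_right] at h6
    exact h6.le

lemma span_basisCls (hn : 1 ≤ n) (ha : 1 ≤ a) (hγ : γ ≠ 0)
    (hβ : rootGamma p a g k ^ p ^ k = γ) (hh : IsTwist p a g (twist p γ)) :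
    ⊤ ≤ Submodule.span (ringO p n a g k) (Set.range (basisCls (p := p) (a := a) n hγ hβ)) := by
  intro z _
  obtain ⟨x, rfl⟩ := Submodule.Quotient.mk_surjective _ z
  obtain ⟨φ, hφ, hx⟩ := (mem_modC_iff hγ hβ).1 x.2
  obtain ⟨A, c, -, -, h⟩ := exists_eq_sum_basisCls hn ha hγ hβ hh (B := fun _ => 1) (r := 1)
    (fun _ => zero_le_one) (inv_p_lt_one p).le le_rfl hφ
    (fun c hc κ => by rw [one_pow, one_mul]; exact ((hφ c hc).mem κ).2) hx
  rw [h]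
  exact Submodule.sum_mem _ fun j _ =>
    Submodule.smul_mem _ _ (Submodule.subset_span (Set.mem_range_self j))

end

/-! ### The Frobenius and the operators -/

section
variable {n : ℕ}

/-- The exponent `p κ + (c, …, c)`. -/
def frobExp (p c : ℕ) (κ : Fin (n + 1) →₀ ℕ) : Fin (n + 1) →₀ ℕ :=
  Finsupp.equivFunOnFinite.symm fun i => c + p * κ i

lemma frobExp_apply (p c : ℕ) (κ : Fin (n + 1) →₀ ℕ) (i : Fin (n + 1)) :
    frobExp p c κ i = c + p * κ i := rfl

lemma degree_frobExp (p c : ℕ) (κ : Fin (n + 1) →₀ ℕ) :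
    degree (frobExp p c κ) = (n + 1) * c + p * degree κ := by
  rw [Finsupp.degree_eq_sum, Finsupp.degree_eq_sum]
  simp only [frobExp_apply, Finset.sum_add_distrib, Finset.sum_const, Finset.card_univ,
    Fintype.card_fin, smul_eq_mul, Finset.mul_sum]

lemma frobExp_sub_single {p c m : ℕ} {κ : Fin (n + 1) →₀ ℕ} {i : Fin (n + 1)} (hm : m ≤ κ i) :
    frobExp p c κ - single i (p * m) = frobExp p c (κ - single i m) := by
  ext j
  rw [Finsupp.tsub_apply, frobExp_apply, frobExp_apply, Finsupp.tsub_apply]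
  rcases eq_or_ne j i with rfl | h
  · rw [Finsupp.single_eq_same, Finsupp.single_eq_same, Nat.mul_sub,
      Nat.add_sub_assoc (Nat.mul_le_mul_left p hm)]
  · rw [Finsupp.single_eq_of_ne h, Finsupp.single_eq_of_ne h, tsub_zero, tsub_zero]

end

section
variable {p n a : ℕ} [hp : Fact p.Prime] {γ g : PadicAlgCl p}

/-- The coefficients of the Artin–Hasse series. -/
def ahCoeff (p : ℕ) [Fact p.Prime] (m : ℕ) : PadicAlgCl p :=
  ((PowerSeries.coeff m (artinHasse p) : ℚ) : PadicAlgCl p)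

lemma ahCoeff_rec (m : ℕ) : (m : PadicAlgCl p) * ahCoeff p m =
    ∑ k ∈ Finset.range (m + 1), (powInd p k : PadicAlgCl p) * ahCoeff p (m - k) := by
  have := congrArg (fun x : ℚ => (x : PadicAlgCl p)) (artinHasse_rec (p := p) m)
  push_cast at this
  exact this

/-- The product `E(y_0) ⋯ E(y_n)` of Artin–Hasse series. -/
def ahSer (p n : ℕ) [Fact p.Prime] : Ser p n := fun κ => ∏ i, ahCoeff p (κ i)

/-- The coefficients of `y_i ∂f/∂y_i`. -/
def wtMul (i : Fin (n + 1)) (f : Ser p n) : Ser p n := fun κ => (κ i : PadicAlgCl p) * f κ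

lemma serMul_assoc (f f' f'' : Ser p n) : serMul (serMul f f') f'' = serMul f (serMul f' f'') :=
  mul_assoc (G := MvPowerSeries (Fin (n + 1)) (PadicAlgCl p)) f f' f''

lemma serMul_comm (f f' : Ser p n) : serMul f f' = serMul f' f :=
  mul_comm (G := MvPowerSeries (Fin (n + 1)) (PadicAlgCl p)) f f'

lemma serMul_add_right (f f' f'' : Ser p n) :
    serMul f (f' + f'') = serMul f f' + serMul f f'' :=
  mul_add (R := MvPowerSeries (Fin (n + 1)) (PadicAlgCl p)) f f' f''

lemma varSer_sub (h h' : ℕ → PadicAlgCl p) (i : Fin (n + 1)) :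
    (varSer (h - h') i : Ser p n) = varSer h i - varSer h' i := by
  funext κ
  simp only [varSer, Pi.sub_apply]
  split_ifs
  · rfl
  · rw [sub_zero]

lemma coordOp_eq (h : ℕ → PadicAlgCl p) (i : Fin (n + 1)) (f : Ser p n) :
    coordOp h i f = wtMul i f + serMul (varSer h i) f := by
  funext κ
  rw [Pi.add_apply, coordOp_apply, serMul_varSer, wtMul]

lemma wtMul_serMul (i : Fin (n + 1)) (f f' : Ser p n) :
    wtMul i (serMul f f') = serMul (wtMul i f) f' + serMul f (wtMul i f') := by
  funext κ
  rw [Pi.add_apply, serMul_apply, serMul_apply, wtMul, serMul_apply, Finset.mul_sum,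
    ← Finset.sum_add_distrib]
  refine Finset.sum_congr rfl fun y hy => ?_
  rw [← Finset.HasAntidiagonal.mem_antidiagonal.1 hy, Finsupp.add_apply, Nat.cast_add, wtMul,
    wtMul]
  ring

/-- The logarithmic derivative of the Artin–Hasse series is `∑ j, y ^ (p ^ j)`. -/
lemma wtMul_ahSer (i : Fin (n + 1)) : wtMul i (ahSer p n) =
    serMul (varSer (fun m => (powInd p m : PadicAlgCl p)) i) (ahSer p n) := by
  classical
  funext κ
  have h : ∀ m, ahSer p n (κ - single i m) =
      ahCoeff p (κ i - m) * ∏ j ∈ Finset.univ.erase i, ahCoeff p (κ j) := by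
    intro m
    rw [ahSer, ← Finset.mul_prod_erase _ _ (Finset.mem_univ i), Finsupp.tsub_apply,
      Finsupp.single_eq_same]
    congr 1
    refine Finset.prod_congr rfl fun j hj => ?_
    rw [Finsupp.tsub_apply, Finsupp.single_eq_of_ne (Finset.ne_of_mem_erase hj), tsub_zero]
  have h0 := h 0
  rw [Finsupp.single_zero, tsub_zero, tsub_zero] at h0
  rw [serMul_varSer, wtMul, h0, ← mul_assoc, ahCoeff_rec, Finset.sum_mul]
  exact Finset.sum_congr rfl fun m _ => by rw [h, mul_assoc]

/-- Conjugation by `E(y_0) ⋯ E(y_n)` removes the terms `y ^ (p ^ j)` from `h(y)`. -/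
lemma serMul_coordOp (h : ℕ → PadicAlgCl p) (i : Fin (n + 1)) (f : Ser p n) :
    serMul (ahSer p n) (coordOp h i f) =
      coordOp (h - fun m => (powInd p m : PadicAlgCl p)) i (serMul (ahSer p n) f) := by
  rw [coordOp_eq, coordOp_eq, serMul_add_right, wtMul_serMul, wtMul_ahSer, varSer_sub,
    serMul_sub_left, ← serMul_assoc, serMul_comm (ahSer p n) (varSer h i), serMul_assoc,
    serMul_assoc]
  abel

/-- The part of `ψ_x f` with exponents of `t` congruent to `c` modulo `p`, with the powers of `γ`
and of its `p`-th root `β` which come from the normalization of the variables. -/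
def frobSer (γ β : PadicAlgCl p) (c : ℕ) (f : Ser p n) : Ser p n := fun κ =>
  f (frobExp p c κ) * (γ ^ ((p - 1) * degree κ) * β ^ ((p - 1) * ((n + 1) * c)))

/-- A part of `ψ_x ∘ x ∂/∂x = p x ∂/∂x ∘ ψ_x`. The term with the factor `c` does not depend on
`i` and hence cancels in differences. -/
lemma frobSer_coordOp (hγ : γ ≠ 0) (β : PadicAlgCl p) {c : ℕ} (hc : c < p) (i : Fin (n + 1))
    (f : Ser p n) :
    frobSer γ β c (coordOp (twist p γ - fun m => (powInd p m : PadicAlgCl p)) i f) =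
      (c : PadicAlgCl p) • frobSer γ β c f +
        (p : PadicAlgCl p) • coordOp (twist p γ) i (frobSer γ β c f) := by
  have hp0 := hp.1.pos
  have hq : ∀ m, (twist p γ - fun m => (powInd p m : PadicAlgCl p)) m =
      if p ∣ m then (p : PadicAlgCl p) * (γ ^ (m / p) / γ ^ m) * twist p γ (m / p) else 0 :=
    fun m => by rw [Pi.sub_apply, twist_eq_add hγ, add_sub_cancel_left]
  funext κ
  have hsum : (∑ m ∈ Finset.range (frobExp p c κ i + 1),
      (twist p γ - fun m => (powInd p m : PadicAlgCl p)) m * f (frobExp p c κ - single i m)) =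
      ∑ m ∈ Finset.range (κ i + 1), (p : PadicAlgCl p) * (γ ^ m / γ ^ (p * m)) * twist p γ m *
        f (frobExp p c (κ - single i m)) := by
    symm
    refine Finset.sum_of_injOn (fun m => p * m) (fun m _ m' _ h => Nat.eq_of_mul_eq_mul_left hp0 h)
      (fun m hm => ?_) (fun m hm hm' => ?_) (fun m hm => ?_)
    · rw [Finset.mem_coe, Finset.mem_range] at hm ⊢
      have := Nat.mul_le_mul_left p (Nat.lt_succ_iff.1 hm)
      rw [frobExp_apply]
      change p * m < c + p * κ i + 1
      omega
    · rw [hq, if_neg, zero_mul]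
      rintro ⟨m, rfl⟩
      refine hm' ⟨m, ?_, rfl⟩
      rw [Finset.mem_range, frobExp_apply] at hm
      rw [Finset.mem_coe, Finset.mem_range]
      by_contra hlt
      have := Nat.mul_le_mul_left p (not_lt.1 hlt)
      rw [mul_add, mul_one] at this
      omega
    · rw [Finset.mem_range] at hm
      rw [hq, if_pos (dvd_mul_right p m), Nat.mul_div_cancel_left m hp0,
        frobExp_sub_single (Nat.lt_succ_iff.1 hm)]
  rw [frobSer, coordOp_apply, hsum, Pi.add_apply, Pi.smul_apply, Pi.smul_apply, smul_eq_mul,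
    smul_eq_mul, coordOp_apply, frobExp_apply, mul_add (p : PadicAlgCl p), Finset.mul_sum, add_mul,
    Finset.sum_mul, ← add_assoc]
  congr 1
  · rw [frobSer]
    push_cast
    ring
  · refine Finset.sum_congr rfl fun m hm => ?_
    have h1 : γ ^ ((p - 1) * degree κ) * γ ^ m =
        γ ^ ((p - 1) * degree (κ - single i m)) * γ ^ (p * m) := by
      rw [← pow_add, ← pow_add, ← degree_sub_single hm]
      congr 1
      conv_rhs => rw [← Nat.sub_add_cancel hp.1.one_le]
      rw [Nat.add_sub_cancel]
      ring
    have h2 : γ ^ (p * m) ≠ 0 := pow_ne_zero _ hγ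
    rw [frobSer, mul_div_assoc', div_mul_eq_mul_div, div_mul_eq_mul_div, div_mul_eq_mul_div,
      div_eq_iff h2]
    linear_combination (p : PadicAlgCl p) * twist p γ m * f (frobExp p c (κ - single i m)) *
      β ^ ((p - 1) * ((n + 1) * c)) * h1

/-- The components of the relative Frobenius. -/
def frobMap (γ β : PadicAlgCl p) (c : ℕ) (f : Ser p n) : Ser p n :=
  frobSer γ β c (serMul (ahSer p n) f)

lemma frobSer_sub (γ β : PadicAlgCl p) (c : ℕ) (f f' : Ser p n) :
    frobSer γ β c (f - f') = frobSer γ β c f - frobSer γ β c f' := by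
  funext κ
  simp only [frobSer, Pi.sub_apply, sub_mul]

lemma frobSer_add (γ β : PadicAlgCl p) (c : ℕ) (f f' : Ser p n) :
    frobSer γ β c (f + f') = frobSer γ β c f + frobSer γ β c f' := by
  funext κ
  simp only [frobSer, Pi.add_apply, add_mul]

lemma frobMap_add (γ β : PadicAlgCl p) (c : ℕ) (f f' : Ser p n) :
    frobMap γ β c (f + f') = frobMap γ β c f + frobMap γ β c f' := by
  rw [frobMap, serMul_add_right, frobSer_add]
  rfl

/-- The Frobenius commutes with the operators up to the factor `p`. -/
theorem frobMap_diffOp (hγ : γ ≠ 0) (β : PadicAlgCl p) {c : ℕ} (hc : c < p) (l : Fin n)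
    (f : Ser p n) : frobMap γ β c (diffOp (twist p γ) l f) =
      diffOp (twist p γ) l ((p : PadicAlgCl p) • frobMap γ β c f) := by
  have h : serMul (ahSer p n) (diffOp (twist p γ) l f) =
      serMul (ahSer p n) (coordOp (twist p γ) l.succ f) -
        serMul (ahSer p n) (coordOp (twist p γ) 0 f) :=
    mul_sub (α := MvPowerSeries (Fin (n + 1)) (PadicAlgCl p)) _ _ _
  rw [frobMap, h, serMul_coordOp, serMul_coordOp, frobSer_sub, frobSer_coordOp hγ β hc,
    frobSer_coordOp hγ β hc, add_sub_add_left_eq_sub, ← smul_sub, map_smul]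
  rfl

end

/-! ### The relative Frobenius in terms of restricted power series -/

section
variable {p n a : ℕ} [hp : Fact p.Prime] {γ g : PadicAlgCl p}

lemma ahCoeff_mem (m : ℕ) : ahCoeff p m ∈ intRing p a g := by
  have h : ahCoeff p m = algebraMap ℚ_[p] (PadicAlgCl p)
      ((PowerSeries.coeff m (artinHasse p) : ℚ) : ℚ_[p]) := (map_ratCast _ _).symm
  rw [h]
  refine ⟨algebraMap_mem _ _, ?_⟩
  rw [norm_algebraMap']
  exact norm_coeff_artinHasse_le m

lemma serMul_mem {f f' : Ser p n} (hf : ∀ κ, f κ ∈ intRing p a g)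
    (hf' : ∀ κ, f' κ ∈ intRing p a g) (κ : Fin (n + 1) →₀ ℕ) :
    serMul f f' κ ∈ intRing p a g := by
  rw [serMul_apply]
  exact sum_mem fun y _ => mul_mem (hf _) (hf' _)

lemma serMul_ahSer_mem {f : Ser p n} (hf : ∀ κ, f κ ∈ intRing p a g) (κ : Fin (n + 1) →₀ ℕ) :
    serMul (ahSer p n) f κ ∈ intRing p a g :=
  serMul_mem (fun _ => prod_mem fun _ _ => ahCoeff_mem _) hf κ

lemma norm_frobMap_le (hord : ‖γ‖ = (p : ℝ) ^ (-(1 / ((p : ℝ) - 1)))) (β : PadicAlgCl p) (c : ℕ)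
    {f : Ser p n} (hf : ∀ κ, f κ ∈ intRing p a g) (κ : Fin (n + 1) →₀ ℕ) :
    ‖frobMap γ β c f κ‖ ≤ ‖β‖ ^ ((p - 1) * ((n + 1) * c)) * (p : ℝ)⁻¹ ^ degree κ := by
  rw [frobMap, frobSer, norm_mul, norm_mul, norm_pow, norm_pow, pow_mul ‖γ‖, norm_gamma_pow hord,
    mul_comm ((p : ℝ)⁻¹ ^ degree κ)]
  exact mul_le_of_le_one_left (mul_nonneg (pow_nonneg (norm_nonneg _) _)
    (pow_nonneg (inv_p_pos p).le _)) (serMul_ahSer_mem hf _).2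

lemma IsRestricted.frobMap (hord : ‖γ‖ = (p : ℝ) ^ (-(1 / ((p : ℝ) - 1))))
    (hg : γ ∈ intRing p a g) {β : PadicAlgCl p} (hβ : β ∈ intRing p a g) (c : ℕ)
    {f : Ser p n} (hf : IsRestricted p n a g f) : IsRestricted p n a g (frobMap γ β c f) := by
  refine ⟨fun κ => mul_mem (serMul_ahSer_mem hf.mem _) (mul_mem (pow_mem hg _) (pow_mem hβ _)),
    fun η hη => ?_⟩
  obtain ⟨t, ht⟩ := exists_inv_p_pow_le p hη
  refine ⟨t, fun κ hκ => (norm_frobMap_le hord β c hf.mem κ).trans ?_⟩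
  exact (mul_le_of_le_one_left (pow_nonneg (inv_p_pos p).le _)
    (pow_le_one₀ (norm_nonneg _) hβ.2)).trans
      ((pow_le_pow_of_le_one (inv_p_pos p).le (inv_p_lt_one p).le hκ).trans ht)

lemma serF_eq_realize (γ β : PadicAlgCl p) :
    serF p n γ = realize 1 γ β fun c => if c = 0 then ahSer p n else 0 := by
  refine ext_realize (fun u s h => ?_) fun κ s hs => ?_
  · rw [serF, PowerSeries.coeff_mk, if_neg]
    intro h'
    refine h fun l => ?_
    rw [Nat.div_one, add_comm]
    exact h' l
  · rw [Nat.div_one] at hs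
    have h1 : ∀ l : Fin n, xExp κ l + (s : ℤ) = κ l.succ := fun l => by
      rw [hs, xExp, sub_add_cancel]
    rw [serF, PowerSeries.coeff_mk, if_pos (fun l => by rw [h1]; exact Int.natCast_nonneg _),
      Nat.mod_one, if_pos rfl, mul_zero, pow_zero, mul_one, ahSer, Fin.prod_univ_succ,
      Finsupp.degree_eq_sum, Fin.sum_univ_succ, hs, pow_add, ← Finset.prod_pow_eq_pow_sum]
    simp only [← hs, h1, Int.toNat_natCast, theta, Finset.prod_mul_distrib, ahCoeff]
    ring

lemma psiX_realize {β : PadicAlgCl p} (hβ : β ^ p = γ) (β' : PadicAlgCl p) (φ : ℕ → Ser p n) :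
    psiX (realize 1 γ β' φ) = realize p γ β fun c => frobSer γ β c (φ 0) := by
  have hp0 := hp.1.pos
  refine ext_realize (fun u s h => ?_) fun κ s hs => ?_
  · rw [psiX, coeff_realize_of_not]
    refine fun h' => h fun l => ?_
    have h1 := h' l
    rw [Nat.div_one, Pi.smul_apply, smul_eq_mul] at h1
    have h2 : (s : ℤ) < p * ((s / p : ℕ) + 1) := by
      have := Nat.lt_mul_div_succ s hp0
      exact_mod_cast this
    by_contra h3
    have h4 : ((s / p : ℕ) : ℤ) + 1 ≤ -u l := by omega
    have h5 := mul_le_mul_of_nonneg_left h4 (Int.natCast_nonneg p)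
    linarith
  · have hs' : s = s % p + p * κ 0 := by rw [← hs, Nat.mod_add_div]
    have hu : xExp (frobExp p (s % p) κ) = (p : ℤ) • xExp κ := by
      funext l
      rw [Pi.smul_apply, xExp, xExp, frobExp_apply, frobExp_apply, smul_eq_mul]
      push_cast
      ring
    rw [psiX, coeff_realize φ hu (by rw [Nat.div_one]; exact hs'), Nat.mod_one, mul_zero, pow_zero,
      mul_one, frobSer, mul_assoc]
    congr 1
    have hpx : ∀ x, p * x = (p - 1) * x + x := fun x => by
      conv_lhs => rw [← Nat.sub_add_cancel hp.1.one_le]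
      ring
    have h1 : degree (frobExp p (s % p) κ) =
        (p - 1) * degree κ + degree κ + (n + 1) * (s % p) := by
      rw [degree_frobExp, hpx (degree κ), add_comm]
    have h2 : γ ^ ((n + 1) * (s % p)) =
        β ^ ((p - 1) * ((n + 1) * (s % p))) * β ^ ((n + 1) * (s % p)) := by
      rw [← hβ, ← pow_mul, ← pow_add, hpx]
    rw [h1, pow_add, pow_add, h2]
    ring

theorem alphaOne_realize {β : PadicAlgCl p} (hβ : β ^ p = γ) (β' : PadicAlgCl p)
    (φ : ℕ → Ser p n) :
    alphaOne p n γ (realize 1 γ β' φ) = realize p γ β fun c => frobMap γ β c (φ 0) := by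
  rw [alphaOne, serF_eq_realize γ β', lmul_realize one_pos, psiX_realize hβ]
  rfl

end

/-! ### The relative Frobenius on cohomology -/

section
variable {p n a : ℕ} [hp : Fact p.Prime] {γ g : PadicAlgCl p}

lemma pow_mem_intRing {x : PadicAlgCl p} (hx : x ∈ baseField p a g) {m : ℕ} (hm : m ≠ 0)
    (hx1 : ‖x ^ m‖ ≤ 1) : x ∈ intRing p a g := by
  refine ⟨hx, ?_⟩
  rw [norm_pow] at hx1
  exact (pow_le_one_iff_of_nonneg (norm_nonneg _) hm).1 hx1

lemma gamma_mem_intRing (hord : ‖γ‖ = (p : ℝ) ^ (-(1 / ((p : ℝ) - 1)))) (hg : g ^ p ^ a = γ) :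
    γ ∈ intRing p a g := ⟨gamma_mem_baseField hg, (norm_gamma_lt_one hord).le⟩

lemma rootGamma_mem_intRing (hord : ‖γ‖ = (p : ℝ) ^ (-(1 / ((p : ℝ) - 1))))
    (hg : g ^ p ^ a = γ) {k : ℕ} (hk : k ≤ a) : rootGamma p a g k ∈ intRing p a g := by
  refine pow_mem_intRing (pow_mem root_mem_baseField _) (pow_pos hp.1.pos k).ne' ?_
  rw [rootGamma_pow hg hk]
  exact (norm_gamma_lt_one hord).le

lemma rootGamma_one_pow (ha : 1 ≤ a) (hg : g ^ p ^ a = γ) : rootGamma p a g 1 ^ p = γ := by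
  have := rootGamma_pow hg ha
  rwa [pow_one] at this

/-- `ord_p (γ ^ (1 / p)) = 1 / (p (p - 1))`. -/
lemma norm_rootGamma_one_pow (ha : 1 ≤ a) (hord : ‖γ‖ = (p : ℝ) ^ (-(1 / ((p : ℝ) - 1))))
    (hg : g ^ p ^ a = γ) : ‖rootGamma p a g 1‖ ^ (p - 1) = (p : ℝ) ^ (-(1 / p) : ℝ) := by
  have hp0 : (0 : ℝ) < p := by exact_mod_cast hp.1.pos
  refine (pow_left_inj₀ (pow_nonneg (norm_nonneg _) _) (Real.rpow_nonneg hp0.le _)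
    hp.1.ne_zero).1 ?_
  rw [← pow_mul, mul_comm, pow_mul, ← norm_pow, rootGamma_one_pow ha hg, norm_gamma_pow hord,
    ← Real.rpow_natCast, ← Real.rpow_mul hp0.le, neg_mul, one_div, inv_mul_cancel₀ hp0.ne',
    Real.rpow_neg_one]

lemma frobMap_restricted (ha : 1 ≤ a) (hord : ‖γ‖ = (p : ℝ) ^ (-(1 / ((p : ℝ) - 1))))
    (hg : g ^ p ^ a = γ) (c : ℕ) {f : Ser p n} (hf : IsRestricted p n a g f) :
    IsRestricted p n a g (frobMap γ (rootGamma p a g 1) c f) :=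
  hf.frobMap hord (gamma_mem_intRing hord hg) (rootGamma_mem_intRing hord hg ha) c

lemma alphaOne_eq (ha : 1 ≤ a) (hg : g ^ p ^ a = γ) (φ : ℕ → Ser p n) :
    alphaOne p n γ (realize (p ^ 0) γ (rootGamma p a g 0) φ) =
      realize (p ^ 1) γ (rootGamma p a g 1) fun c => frobMap γ (rootGamma p a g 1) c (φ 0) := by
  rw [pow_zero, pow_one]
  exact alphaOne_realize (rootGamma_one_pow ha hg) _ φ

lemma alphaOne_mem (ha : 1 ≤ a) (hord : ‖γ‖ = (p : ℝ) ^ (-(1 / ((p : ℝ) - 1))))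
    (hg : g ^ p ^ a = γ) {ζ : Laurent p n} (hζ : ζ ∈ modC p n a γ g 0) :
    alphaOne p n γ ζ ∈ modC p n a γ g 1 := by
  have hγ := gamma_ne_zero hord
  obtain ⟨φ, hφ, rfl⟩ := (mem_modC_iff hγ (rootGamma_pow hg a.zero_le)).1 hζ
  rw [alphaOne_eq ha hg]
  exact (mem_modC_iff hγ (rootGamma_pow hg ha)).2
    ⟨_, fun c _ => frobMap_restricted ha hord hg c (hφ 0 (by simp)), rfl⟩

/-- The relative Frobenius on `C`. -/
def alphaHom (ha : 1 ≤ a) (hord : ‖γ‖ = (p : ℝ) ^ (-(1 / ((p : ℝ) - 1))))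
    (hg : g ^ p ^ a = γ) : modC p n a γ g 0 →+ modC p n a γ g 1 :=
  AddMonoidHom.mk' (fun ζ => ⟨alphaOne p n γ ζ, alphaOne_mem ha hord hg ζ.2⟩) fun x y => by
    have hγ := gamma_ne_zero hord
    obtain ⟨φ, hφ, hx⟩ := (mem_modC_iff hγ (rootGamma_pow hg a.zero_le)).1 x.2
    obtain ⟨φ', hφ', hy⟩ := (mem_modC_iff hγ (rootGamma_pow hg a.zero_le)).1 y.2
    refine Subtype.ext ?_
    change alphaOne p n γ (x + y) = alphaOne p n γ x + alphaOne p n γ y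
    rw [hx, hy, ← realize_add, alphaOne_eq ha hg, alphaOne_eq ha hg,
      alphaOne_eq ha hg, ← realize_add]
    congr 1
    funext c
    rw [Pi.add_apply, Pi.add_apply, frobMap_add]

lemma alphaHom_mem_boundaries (hn : 1 ≤ n) (ha : 1 ≤ a)
    (hord : ‖γ‖ = (p : ℝ) ^ (-(1 / ((p : ℝ) - 1)))) (hg : g ^ p ^ a = γ) {x : modC p n a γ g 0}
    (hx : x ∈ boundaries p n a γ g 0) :
    alphaHom ha hord hg x ∈ boundaries p n a γ g 1 := by
  have hγ := gamma_ne_zero hord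
  obtain ⟨φ, hφ, hx'⟩ := (mem_boundaries_iff hn hγ (rootGamma_pow hg a.zero_le) x).1 hx
  refine (mem_boundaries_iff hn hγ (rootGamma_pow hg ha) _).2
    ⟨fun l c => (p : ℤ) • frobMap γ (rootGamma p a g 1) c (φ l 0),
      fun l c _ => (frobMap_restricted ha hord hg c (hφ l 0 (by simp))).zsmul _, ?_⟩
  have h1 : (alphaHom ha hord hg x : Laurent p n) = alphaOne p n γ x := rfl
  rw [h1, hx', alphaOne_eq ha hg]
  refine realize_congr (pow_pos hp.1.pos 1) fun c hc => ?_
  rw [pow_one] at hc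
  refine (map_sum (AddMonoidHom.mk' (frobMap γ (rootGamma p a g 1) c) (frobMap_add γ _ c)) _
    _).trans (Finset.sum_congr rfl fun l _ => ?_)
  refine (frobMap_diffOp hγ _ hc l (φ l 0)).trans ?_
  congr 1
  funext κ
  change _ = ((p : ℤ) • frobMap γ (rootGamma p a g 1) c (φ l 0)) κ
  rw [Pi.smul_apply, Pi.smul_apply, zsmul_eq_mul, smul_eq_mul, Int.cast_natCast]

/-- The relative Frobenius on cohomology. -/
def alphaBar (hn : 1 ≤ n) (ha : 1 ≤ a) (hord : ‖γ‖ = (p : ℝ) ^ (-(1 / ((p : ℝ) - 1))))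
    (hg : g ^ p ^ a = γ) : HTop p n a γ g 0 →+ HTop p n a γ g 1 :=
  QuotientAddGroup.map (boundaries p n a γ g 0).toAddSubgroup
    (boundaries p n a γ g 1).toAddSubgroup (alphaHom ha hord hg)
    fun _ hx => alphaHom_mem_boundaries hn ha hord hg hx

lemma alphaBar_cls (hn : 1 ≤ n) (ha : 1 ≤ a) (hord : ‖γ‖ = (p : ℝ) ^ (-(1 / ((p : ℝ) - 1))))
    (hg : g ^ p ^ a = γ) {ζ : Laurent p n} (hζ : ζ ∈ modC p n a γ g 0) :
    alphaBar hn ha hord hg (cls p n a γ g 0 ζ hζ) =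
      cls p n a γ g 1 (alphaOne p n γ ζ) (alphaOne_mem ha hord hg hζ) := rfl

/-- The bound for the coefficient of degree `s = c + p m` in `t`: the powers of `γ` introduced by
`ψ_x` give `c (n + 1) / p`, and the degree `(n + 1) m + j` of the basis monomial gives the rest. -/
lemma frob_bound_eq (ha : 1 ≤ a) (hord : ‖γ‖ = (p : ℝ) ^ (-(1 / ((p : ℝ) - 1))))
    (hg : g ^ p ^ a = γ) (s j : ℕ) :
    ‖rootGamma p a g 1‖ ^ ((p - 1) * ((n + 1) * (s % p))) *
        (p : ℝ)⁻¹ ^ ((n + 1) * (s / p) + j) =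
      (p : ℝ) ^ (-(((n : ℝ) + 1) / p * s + j)) := by
  have hp0 : (0 : ℝ) < p := by exact_mod_cast hp.1.pos
  have hs : (s : ℝ) = (s % p : ℕ) + p * (s / p : ℕ) := by
    exact_mod_cast (Nat.mod_add_div s p).symm
  rw [pow_mul, norm_rootGamma_one_pow ha hord hg, ← Real.rpow_neg_one, ← Real.rpow_natCast,
    ← Real.rpow_natCast, ← Real.rpow_mul hp0.le, ← Real.rpow_mul hp0.le, ← Real.rpow_add hp0]
  congr 1
  rw [hs]
  push_cast
  field_simp
  ring

/-- The image of `e_i` under the Frobenius has coefficients of geometric decay, which passes to its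
coordinates in the basis. -/
theorem exists_alphaBar_eq (hn : 1 ≤ n) (ha : 1 ≤ a)
    (hord : ‖γ‖ = (p : ℝ) ^ (-(1 / ((p : ℝ) - 1)))) (hg : g ^ p ^ a = γ)
    (hh : IsTwist p a g (twist p γ)) (i : Fin (n + 1)) :
    ∃ A : Fin (n + 1) → ringO p n a g 1,
      (∀ j : Fin (n + 1), (A j : PowerSeries (PadicAlgCl p)) ∈
        growthO p n a g 1 (((n : ℝ) + 1) / p) (j : ℕ)) ∧
      alphaBar hn ha hord hg (basisCls n (gamma_ne_zero hord) (rootGamma_pow hg a.zero_le) i) =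
        ∑ j, A j • basisCls n (gamma_ne_zero hord) (rootGamma_pow hg ha) j := by
  have hγ := gamma_ne_zero hord
  have hE : IsRestricted p n a g (Pi.single (stairExp n i) 1) :=
    IsRestricted.single _ (one_mem _)
  have hx : alphaOne p n γ (basisE p n γ i) = realize (p ^ 1) γ (rootGamma p a g 1) fun c =>
      frobMap γ (rootGamma p a g 1) c (Pi.single (stairExp n i) 1) := by
    rw [basisE_eq_realize (N := p ^ 0) (β := rootGamma p a g 0), alphaOne_eq ha hg]
    simp only [if_true]
  obtain ⟨A, c, hA, hc, h⟩ := exists_eq_sum_basisCls hn ha hγ (rootGamma_pow hg ha) hh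
    (B := fun c => ‖rootGamma p a g 1‖ ^ ((p - 1) * ((n + 1) * c))) (r := (p : ℝ)⁻¹)
    (fun _ => pow_nonneg (norm_nonneg _) _) le_rfl (inv_p_lt_one p).le
    (fun c _ => frobMap_restricted ha hord hg c hE)
    (fun c _ κ => norm_frobMap_le hord _ c hE.mem κ)
    (x := ⟨_, alphaOne_mem ha hord hg (basisE_mem hγ (rootGamma_pow hg a.zero_le) i)⟩) hx
  refine ⟨A, fun j => ⟨c j, fun s => ⟨(hc j s).1, ?_⟩, hA j⟩, h⟩
  have h1 := (hc j s).2
  rw [pow_one] at h1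
  exact h1.trans (frob_bound_eq ha hord hg s j).le

lemma opD_mem (hn : 1 ≤ n) (hord : ‖γ‖ = (p : ℝ) ^ (-(1 / ((p : ℝ) - 1))))
    (hg : g ^ p ^ a = γ) (hh : IsTwist p a g (twist p γ)) {k : ℕ} (hk : k ≤ a) (l : Fin n)
    {ζ : Laurent p n} (hζ : ζ ∈ modC p n a γ g k) : opD p n γ k l ζ ∈ modC p n a γ g k := by
  have hγ := gamma_ne_zero hord
  obtain ⟨φ, hφ, rfl⟩ := (mem_modC_iff hγ (rootGamma_pow hg hk)).1 hζ
  rw [opD_realize hn hγ]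
  exact (mem_modC_iff hγ (rootGamma_pow hg hk)).2 ⟨_, fun c hc => (hφ c hc).diffOp hh l, rfl⟩

end

end HyperKloosterman

end

theorem theorem5p2 (p : ℕ) [Fact p.Prime] (n a : ℕ) (hn : 1 ≤ n) (ha : 1 ≤ a)
    (γ g : PadicAlgCl p)
    (hroot : HasSum (fun j : ℕ => γ ^ p ^ j / (p : PadicAlgCl p) ^ j) 0)
    (hord : ‖γ‖ = (p : ℝ) ^ (-(1 / ((p : ℝ) - 1))))
    (hg : g ^ p ^ a = γ) :
    (∀ k ≤ 1, ∀ l : Fin n, ∀ ζ ∈ HyperKloosterman.modC p n a γ g k,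
      HyperKloosterman.opD p n γ k l ζ ∈ HyperKloosterman.modC p n a γ g k) ∧
    ∃ (b₀ : Module.Basis (Fin (n + 1)) (HyperKloosterman.ringO p n a g 0)
          (HyperKloosterman.HTop p n a γ g 0))
      (b₁ : Module.Basis (Fin (n + 1)) (HyperKloosterman.ringO p n a g 1)
          (HyperKloosterman.HTop p n a γ g 1))
      (αbar : HyperKloosterman.HTop p n a γ g 0 →+ HyperKloosterman.HTop p n a γ g 1),
      (∀ i, ∃ h : HyperKloosterman.basisE p n γ i ∈ HyperKloosterman.modC p n a γ g 0,
        b₀ i = HyperKloosterman.cls p n a γ g 0 (HyperKloosterman.basisE p n γ i) h) ∧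
      (∀ j, ∃ h : HyperKloosterman.basisE p n γ j ∈ HyperKloosterman.modC p n a γ g 1,
        b₁ j = HyperKloosterman.cls p n a γ g 1 (HyperKloosterman.basisE p n γ j) h) ∧
      (∀ (ζ : HyperKloosterman.Laurent p n) (hζ : ζ ∈ HyperKloosterman.modC p n a γ g 0),
        ∃ h : HyperKloosterman.alphaOne p n γ ζ ∈ HyperKloosterman.modC p n a γ g 1,
          αbar (HyperKloosterman.cls p n a γ g 0 ζ hζ) =
            HyperKloosterman.cls p n a γ g 1 (HyperKloosterman.alphaOne p n γ ζ) h) ∧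
      ∀ i j : Fin (n + 1),
        (b₁.repr (αbar (b₀ i)) j : PowerSeries (PadicAlgCl p)) ∈
          HyperKloosterman.growthO p n a g 1 (((n : ℝ) + 1) / p) (j : ℕ) := by
  open HyperKloosterman in
  have hγ := gamma_ne_zero hord
  have hh := isTwist_twist hroot hord hg
  have hβ₀ : rootGamma p a g 0 ^ p ^ 0 = γ := rootGamma_pow hg a.zero_le
  have hβ₁ : rootGamma p a g 1 ^ p ^ 1 = γ := rootGamma_pow hg ha
  refine ⟨fun k hk l ζ hζ => opD_mem hn hord hg hh (hk.trans ha) l hζ,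
    Module.Basis.mk (linearIndependent_basisCls hn hγ hβ₀ hh) (span_basisCls hn ha hγ hβ₀ hh),
    Module.Basis.mk (linearIndependent_basisCls hn hγ hβ₁ hh) (span_basisCls hn ha hγ hβ₁ hh),
    alphaBar hn ha hord hg, fun i => ⟨basisE_mem hγ hβ₀ i, ?_⟩, fun j => ⟨basisE_mem hγ hβ₁ j, ?_⟩,
    fun ζ hζ => ⟨alphaOne_mem ha hord hg hζ, alphaBar_cls hn ha hord hg hζ⟩, fun i j => ?_⟩
  · rw [Module.Basis.mk_apply]
    rfl
  · rw [Module.Basis.mk_apply]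
    rfl
  · obtain ⟨A, hA, h⟩ := exists_alphaBar_eq hn ha hord hg hh i
    rw [Module.Basis.mk_apply, h]
    have h1 : ∑ j, A j • basisCls n hγ hβ₁ j = ∑ j, A j • Module.Basis.mk
        (linearIndependent_basisCls hn hγ hβ₁ hh) (span_basisCls hn ha hγ hβ₁ hh) j :=
      Finset.sum_congr rfl fun j _ => by rw [Module.Basis.mk_apply]
    rw [h1, Module.Basis.repr_sum_self]
    exact hA j
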